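/- Let $K$ be a field of characteristic $0$, complete with respect to a non-trivial non-archimedean absolute value $|\cdot|$, equipped with a non-zero bounded derivation $\partial$. Let $p=p(K)$ be the characteristic of the residue field of $K$ and assume $p>0$. For a map $f$ put $|f|_{op}=\sup_{x\ne 0}|f(x)|/|x|$ and $|f|_{sp}=\inf_{n>0}|f^n|_{op}^{1/n}$, let $\omega=|p|^{1/(p-1)}$, and let $r(K,\partial)=\omega/|\partial|_{sp,K}$. Let $K\langle T\rangle$ be the ring of twisted polynomials over $(K,\partial)$, where $Tc=cT+\partial(c)$ for $c\in K$, and let $\mathcal C^f$ be the category of left $K\langle T\rangle$-modules that are finite-dimensional over $K$. *Submodules defined by radii.* For $M\in\mathcal C^f$ and $r\in(0,r(K,\partial)]$, let $m(M)(r)$ be the sum of the dimensions of those Jordan–Hölder factors $M_j$ of $M$ (with multiplicity) with $\omega/|T|_{sp,M_j}=r$, the spectral norm being taken for any ultrametric norm on the $K$-vector space $M_j$; let $\operatorname{supp} m(M)\subset(0,r(K,\partial)]$ be the support of $m(M)$. Let $F_{sp,[r,r]}M$ be the largest submodule $N$ of $M$ with $\operatorname{supp} m(N)\subset\{r\}$.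 *Submodules defined by duality.* Let $g_0:K\to K[[X]]$, $c\mapsto\sum_i\frac{\partial^i(c)}{i!}X^i$, and let $f_{0*}L_0$ be $K[[X]]$ regarded as a left $K\langle T\rangle$-module on which $c\in K$ acts as multiplication by $g_0(c)$ and $T$ acts as $d/dX$. A second action of $K\langle T\rangle$ on $f_{0*}L_0$, commuting with the first, is given by $\rho^s(c)(a_i)_i=(ca_i)_i$ and $\rho^s(T)(a_i)_i=(\partial(a_i)-(i+1)a_{i+1})_i$. For a left $K\langle T\rangle$-module $M$ let $DM=\operatorname{Hom}_{K\langle T\rangle}(M,f_{0*}L_0)$, a left $K\langle T\rangle$-module through $\rho^s$, and let $c_M:M\to DDM$ be the natural map, $c_M(x)(s)=\big(\big((\tfrac1{i!}T^i\cdot s)(x)\big)_0\big)_i$. (With $D_0$ the usual $K$-linear dual, in which $(T\chi)(x)=\partial(\chi(x))-\chi(Tx)$, and $\Phi:D\to D_0$ the isomorphism $s\mapsto(x\mapsto s(x)_0)$, this is the composite of the evaluation map $M\to D_0D_0M$ with the isomorphism $D_0D_0M\cong DDM$ induced by $\Phi$.) For $s>0$ let $K[[X/s]]_0=\{(a_i):\sup_i|a_i|s^i<\infty\}$.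 Let $f_{r*}L_r\subset f_{0*}L_0$ be the subobject with underlying group $\bigcap_{0<s<r}K[[X/s]]_0$ for $0<r\le r(K,\partial)$, and $f_{r+*}L_{r+}$ the one with underlying group $\bigcup_{s>r}K[[X/s]]_0$ for $0<r<r(K,\partial)$. For $r\in(0,r(K,\partial)]$ put $$F_{[r,r(K,\partial)]}M=\{x\in M:\ c_M(x)(s)\in f_{r*}L_r\ \text{ for all } s\in DM\},$$ $$F_{(0,r]}M=\{x\in M:\ c_M(x)(s)=0\ \text{ for all } s\in \operatorname{Hom}_{K\langle T\rangle}(M,f_{r+*}L_{r+})\}\quad\text{if } r<r(K,\partial),$$ and $F_{(0,r(K,\partial)]}M=M$. Put $F_{[r,r]}M=F_{(0,r]}M\cap F_{[r,r(K,\partial)]}M$; it is a subfunctor of the identity. **Theorem.** (1) For all $M\in\mathcal C^f$ and $r\in(0,r(K,\partial)]$, the largest submodule $F_{sp,[r,r]}M$ exists, and $F_{sp,[r,r]}M=F_{[r,r]}M$. (2) For all $M\in\mathcal C^f$, the map $\bigoplus_{r\in(0,r(K,\partial)]}F_{sp,[r,r]}M\to M$ induced by the inclusions is an isomorphism of $K\langle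 T\rangle$-modules, and it is natural in $M$: every morphism $M'\to M$ in $\mathcal C^f$ maps $F_{sp,[r,r]}M'$ into $F_{sp,[r,r]}M$ for each $r$, and the resulting square commutes. (3) For all $r\in(0,r(K,\partial)]$, the functor $F_{[r,r]}$ on $\mathcal C^f$ is exact. -/

import Mathlib

open scoped PowerSeries

universe u v w

noncomputable section

set_option linter.unusedSectionVars false

/-! ### Twisted polynomials -/

/-- The underlying additive group `R^(ℕ)` of the ring `R⟨T⟩` of twisted polynomials over the
differential ring `(R, d)`; the family `(q_i)` stands for `∑ q_i T^i`, where `T q = q T + d q`. -/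
@[nolint unusedArguments]
def TwistedPoly {k : Type w} {R : Type u} [CommRing k] [CommRing R] [Algebra k R]
    (_d : Derivation k R R) : Type u := ℕ →₀ R

theorem end_mul_apply {A : Type*} [AddCommMonoid A] (f g : AddMonoid.End A) (x : A) :
    (f * g) x = f (g x) := rfl

theorem end_one_apply {A : Type*} [AddCommMonoid A] (x : A) : (1 : AddMonoid.End A) x = x := rfl

namespace TwistedPoly

section Basic

variable {k : Type w} {R : Type u} [CommRing k] [CommRing R] [Algebra k R] (d : Derivation k R R)

instance : AddCommGroup (TwistedPoly d) := inferInstanceAs (AddCommGroup (ℕ →₀ R))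
instance : Module R (TwistedPoly d) := inferInstanceAs (Module R (ℕ →₀ R))

/-- The monomial `a T^i`. -/
def monomial (i : ℕ) : R →+ TwistedPoly d := Finsupp.singleAddHom i

variable {d}

theorem addHom_ext' {A : Type*} [AddMonoid A] {f g : TwistedPoly d →+ A}
    (h : ∀ i a, f (monomial d i a) = g (monomial d i a)) : f = g :=
  Finsupp.addHom_ext h

@[elab_as_elim]
theorem induction_mono {P : TwistedPoly d → Prop} (p : TwistedPoly d)
    (hadd : ∀ p q, P p → P q → P (p + q)) (hmono : ∀ i a, P (monomial d i a)) : P p := by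
  have h0 : P 0 := by simpa using hmono 0 0
  exact Finsupp.induction_linear (motive := P) p h0 hadd hmono

theorem smul_monomial (c : R) (i : ℕ) (a : R) :
    c • monomial d i a = monomial d i (c * a) :=
  Finsupp.smul_single c i a

/-- The substitution `∑ q_i T^i ↦ ∑ μ(q_i) u^i`, as an additive map. -/
def evalHom {U : Type*} [Ring U] (μ : R →+* U) (t : U) : TwistedPoly d →+ U :=
  Finsupp.liftAddHom fun i => (AddMonoidHom.mulRight (t ^ i)).comp μ.toAddMonoidHom

@[simp]
theorem evalHom_monomial {U : Type*} [Ring U] (μ : R →+* U) (t : U) (i : ℕ) (a : R) :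
    evalHom μ t (monomial d i a) = μ a * t ^ i :=
  Finsupp.liftAddHom_apply_single _ _ _

variable (d) in
/-- The differential operator `(q_i) ↦ (d q_i + q_{i-1})` on `R^(ℕ)`, with `q_{-1} = 0`. -/
def opT : AddMonoid.End (TwistedPoly d) :=
  Finsupp.liftAddHom fun i =>
    (monomial d i).comp d.toLinearMap.toAddMonoidHom + monomial d (i + 1)

@[simp]
theorem opT_monomial (i : ℕ) (a : R) :
    opT d (monomial d i a) = monomial d i (d a) + monomial d (i + 1) a :=
  Finsupp.liftAddHom_apply_single _ _ _

/-- The product of twisted polynomials: `(∑ q_i T^i) * y = ∑ q_i • T^i(y)`, where `T` acts on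
`R^(ℕ)` as the differential operator `opT`. -/
instance : Mul (TwistedPoly d) :=
  ⟨fun x y => evalHom (Module.toAddMonoidEnd R (TwistedPoly d)) (opT d) x y⟩

instance : One (TwistedPoly d) := ⟨monomial d 0 1⟩

theorem mul_eq (x y : TwistedPoly d) :
    x * y = evalHom (Module.toAddMonoidEnd R (TwistedPoly d)) (opT d) x y := rfl

theorem add_mul' (x y z : TwistedPoly d) : (x + y) * z = x * z + y * z := by
  rw [mul_eq, map_add]
  rfl

theorem one_eq : (1 : TwistedPoly d) = monomial d 0 1 := rfl

theorem monomial_mul (i : ℕ) (a : R) (y : TwistedPoly d) :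
    monomial d i a * y = a • (opT d ^ i) y := by
  rw [mul_eq, evalHom_monomial]
  rfl

section
variable {U : Type*} [Ring U] {μ : R →+* U} {t : U}

theorem evalHom_smul (c : R) (y : TwistedPoly d) :
    evalHom μ t (c • y) = μ c * evalHom μ t y := by
  induction y using induction_mono with
  | hadd p q hp hq => rw [smul_add, map_add, hp, hq, map_add, mul_add]
  | hmono i a => rw [smul_monomial, evalHom_monomial, evalHom_monomial, map_mul, mul_assoc]

theorem evalHom_opT (h : ∀ r, t * μ r = μ r * t + μ (d r)) (y : TwistedPoly d) :
    evalHom μ t (opT d y) = t * evalHom μ t y := by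
  induction y using induction_mono with
  | hadd p q hp hq => rw [map_add, map_add, hp, hq, map_add, mul_add]
  | hmono i a =>
    rw [opT_monomial, map_add, evalHom_monomial, evalHom_monomial, evalHom_monomial,
      ← mul_assoc, h, add_mul, pow_succ', mul_assoc, add_comm]

theorem evalHom_mul (h : ∀ r, t * μ r = μ r * t + μ (d r)) (x y : TwistedPoly d) :
    evalHom μ t (x * y) = evalHom μ t x * evalHom μ t y := by
  induction x using induction_mono with
  | hadd p q hp hq =>
    have : (p + q) * y = p * y + q * y := add_mul' p q y
    rw [this, map_add, hp, hq, map_add, add_mul]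
  | hmono i a =>
    rw [monomial_mul, evalHom_smul, evalHom_monomial, mul_assoc]
    congr 1
    induction i with
    | zero => simp
    | succ i ih => rw [pow_succ', pow_succ', end_mul_apply, evalHom_opT h, ih, mul_assoc]

end

theorem opT_rel (r : R) :
    opT d * Module.toAddMonoidEnd R (TwistedPoly d) r =
      Module.toAddMonoidEnd R (TwistedPoly d) r * opT d +
        Module.toAddMonoidEnd R (TwistedPoly d) (d r) := by
  refine addHom_ext' fun i a => ?_
  change opT d (r • monomial d i a) = r • opT d (monomial d i a) + d r • monomial d i a
  simp only [smul_monomial, opT_monomial, smul_add, Derivation.leibniz, smul_eq_mul, map_add]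
  rw [mul_comm a]
  abel

theorem opT_pow_one (i : ℕ) : (opT d ^ i) (1 : TwistedPoly d) = monomial d i 1 := by
  induction i with
  | zero => simp [one_eq]
  | succ i ih => rw [pow_succ', end_mul_apply, ih, opT_monomial]; simp

instance : Ring (TwistedPoly d) :=
  { (inferInstance : AddCommGroup (TwistedPoly d)) with
    mul := (· * ·)
    one := 1
    left_distrib := fun x y z => by simp only [mul_eq, map_add]
    right_distrib := add_mul'
    zero_mul := fun x => by
      rw [mul_eq, map_zero]
      rfl
    mul_zero := fun x => by simp only [mul_eq, map_zero]
    mul_assoc := fun x y z => by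
      rw [mul_eq (x * y), evalHom_mul opT_rel]
      rfl
    one_mul := fun x => by
      rw [one_eq, monomial_mul]; simp
    mul_one := fun x => by
      induction x using induction_mono with
      | hadd p q hp hq =>
        have : (p + q) * 1 = p * 1 + q * 1 := add_mul' p q 1
        rw [this, hp, hq]
      | hmono i a => rw [monomial_mul, opT_pow_one, smul_monomial, mul_one] }

variable (d) in
/-- The element `T` of `R⟨T⟩`. -/
def T : TwistedPoly d := monomial d 1 1

variable (d) in
/-- The ring homomorphism `i : R → R⟨T⟩`, `q ↦ q T^0`. -/
def C : R →+* TwistedPoly d where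
  toFun := monomial d 0
  map_zero' := map_zero _
  map_one' := rfl
  map_add' := map_add _
  map_mul' a b := by
    rw [monomial_mul, pow_zero, end_one_apply, smul_monomial]

theorem C_mul (c : R) (p : TwistedPoly d) : C d c * p = c • p := by
  change monomial d 0 c * p = _
  rw [monomial_mul, pow_zero, end_one_apply]

theorem T_mul (p : TwistedPoly d) : T d * p = opT d p := by
  rw [T, monomial_mul, pow_one, one_smul]

theorem T_mul_C (c : R) : T d * C d c = C d c * T d + C d (d c) := by
  rw [T_mul, C_mul]
  change opT d (monomial d 0 c) = c • monomial d 1 1 + monomial d 0 (d c)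
  rw [opT_monomial, smul_monomial, mul_one, add_comm]

theorem T_pow (i : ℕ) : T d ^ i = monomial d i 1 := by
  induction i with
  | zero => rfl
  | succ i ih => rw [pow_succ', ih, T_mul, opT_monomial]; simp

theorem monomial_eq (i : ℕ) (a : R) : monomial d i a = C d a * T d ^ i := by
  rw [T_pow, C_mul, smul_monomial, mul_one]

/-- The ring homomorphism `R⟨T⟩ → U` with `i(r) ↦ μ r` and `T ↦ t` attached to a ring
homomorphism `μ : R → U` and an element `t` of `U` with `t μ(r) = μ(r) t + μ(d r)`. -/
def lift {U : Type*} [Ring U] (μ : R →+* U) (t : U) (h : ∀ r, t * μ r = μ r * t + μ (d r)) :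
    TwistedPoly d →+* U :=
  { evalHom μ t with
    map_one' := by
      change evalHom μ t (monomial d 0 1) = 1
      rw [evalHom_monomial]; simp
    map_mul' := evalHom_mul h }

@[simp]
theorem lift_C {U : Type*} [Ring U] (μ : R →+* U) (t : U)
    (h : ∀ r, t * μ r = μ r * t + μ (d r)) (r : R) : lift μ t h (C d r) = μ r := by
  change evalHom μ t (monomial d 0 r) = _
  rw [evalHom_monomial, pow_zero, mul_one]

@[simp]
theorem lift_T {U : Type*} [Ring U] (μ : R →+* U) (t : U)
    (h : ∀ r, t * μ r = μ r * t + μ (d r)) : lift μ t h (T d) = t := by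
  change evalHom μ t (monomial d 1 1) = _
  rw [evalHom_monomial, pow_one, map_one, one_mul]

instance : IsScalarTower R (TwistedPoly d) (TwistedPoly d) :=
  ⟨fun c p q => by rw [smul_eq_mul, smul_eq_mul, ← C_mul, ← C_mul, mul_assoc]⟩

theorem smul_def {M : Type v} [AddCommGroup M] [Module R M] [Module (TwistedPoly d) M]
    [IsScalarTower R (TwistedPoly d) M] (c : R) (x : M) : c • x = C d c • x := by
  rw [← mul_one (C d c), C_mul, smul_assoc, one_smul]

theorem T_smul_smul {M : Type v} [AddCommGroup M] [Module R M] [Module (TwistedPoly d) M]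
    [IsScalarTower R (TwistedPoly d) M] (c : R) (x : M) :
    T d • c • x = c • T d • x + d c • x := by
  simp only [smul_def (d := d), smul_smul, T_mul_C, add_smul]

/-- An additive map that commutes with scalars from `R` and with `T` is `R⟨T⟩`-linear. -/
def mkLinear {M N : Type*} [AddCommGroup M] [Module (TwistedPoly d) M]
    [AddCommGroup N] [Module (TwistedPoly d) N] (f : M →+ N)
    (hC : ∀ c x, f (C d c • x) = C d c • f x) (hT : ∀ x, f (T d • x) = T d • f x) :
    M →ₗ[TwistedPoly d] N :=
  { f with
    map_smul' := fun p x => by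
      change f (p • x) = p • f x
      induction p using induction_mono with
      | hadd p q hp hq => rw [add_smul, map_add, hp, hq, add_smul]
      | hmono i a =>
        rw [monomial_eq, mul_smul, hC, mul_smul]
        congr 1
        induction i with
        | zero => simp
        | succ i ih => rw [pow_succ', mul_smul, hT, ih, mul_smul] }

@[simp]
theorem mkLinear_apply {M N : Type*} [AddCommGroup M] [Module (TwistedPoly d) M]
    [AddCommGroup N] [Module (TwistedPoly d) N] (f : M →+ N)
    (hC : ∀ c x, f (C d c • x) = C d c • f x) (hT : ∀ x, f (T d • x) = T d • f x) (x : M) :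
    mkLinear f hC hT x = f x := rfl

/-- The `R⟨T⟩`-module structure on an `R`-module with an operator `t` such that
`t (r x) = r t(x) + d(r) x`; the element `T` acts as `t`. -/
@[reducible]
def moduleOfOp {A : Type v} [AddCommGroup A] [Module R A] (t : AddMonoid.End A)
    (h : ∀ (r : R) (x : A), t (r • x) = r • t x + d r • x) : Module (TwistedPoly d) A :=
  Module.compHom A (lift (d := d) (Module.toAddMonoidEnd R A) t
    fun r => AddMonoidHom.ext fun x => h r x)

/-- The left `R⟨T⟩`-module `L(R, d)`: the additive group of `R`, on which `R` acts by
multiplication and `T` acts as `d`. -/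
@[nolint unusedArguments]
def L (_d : Derivation k R R) : Type u := R

instance : AddCommGroup (L d) := inferInstanceAs (AddCommGroup R)

theorem L_rel (r x : R) : d.toLinearMap.toAddMonoidHom (r • x) =
    r • d.toLinearMap.toAddMonoidHom x + d r • x := by
  change d (r * x) = r * d x + d r * x
  rw [Derivation.leibniz, smul_eq_mul, smul_eq_mul, mul_comm x]

instance : Module (TwistedPoly d) (L d) :=
  moduleOfOp (A := R) d.toLinearMap.toAddMonoidHom L_rel

theorem moduleOfOp_C_smul {A : Type v} [AddCommGroup A] [Module R A] (t : AddMonoid.End A)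
    (h : ∀ (r : R) (x : A), t (r • x) = r • t x + d r • x) (c : R) (x : A) :
    letI := moduleOfOp t h
    C d c • x = c • x :=
  DFunLike.congr_fun (lift_C (d := d) (Module.toAddMonoidEnd R A) t
    (fun r => AddMonoidHom.ext fun x => h r x) c) x

theorem moduleOfOp_T_smul {A : Type v} [AddCommGroup A] [Module R A] (t : AddMonoid.End A)
    (h : ∀ (r : R) (x : A), t (r • x) = r • t x + d r • x) (x : A) :
    letI := moduleOfOp t h
    T d • x = t x :=
  DFunLike.congr_fun (lift_T (d := d) (Module.toAddMonoidEnd R A) t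
    (fun r => AddMonoidHom.ext fun x => h r x)) x

theorem C_smul_L (c : R) (x : L d) : C d c • x = (show R from c * (show R from x)) :=
  moduleOfOp_C_smul (A := R) _ L_rel c x

theorem T_smul_L (x : L d) : T d • x = (show R from d (show R from x)) :=
  moduleOfOp_T_smul (A := R) _ L_rel x

/-- The ring homomorphism `R⟨T⟩ → S⟨T⟩` attached to a homomorphism of differential rings. -/
def map {l S : Type*} [CommRing l] [CommRing S] [Algebra l S] {e : Derivation l S S} (g : R →+* S)
    (hg : ∀ r, g (d r) = e (g r)) : TwistedPoly d →+* TwistedPoly e :=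
  lift ((C e).comp g) (T e) fun r => by
    simp only [RingHom.comp_apply, hg, T_mul_C]

end Basic

end TwistedPoly

open TwistedPoly

/-! ### The module `f_{0*} L_0` and the dual functors -/

section Duality

variable {K : Type u} [Field K]

/-- `Dⁿ(c x)/n! = ∑_{i+j=n} (dⁱ c / i!) (Dʲ x / j!)`. -/
theorem divPow_leibniz [CharZero K] (d : Derivation ℤ K K) {A : Type v} [AddCommGroup A]
    [Module K A] (t : AddMonoid.End A) (h : ∀ (r : K) (x : A), t (r • x) = r • t x + d r • x)
    (n : ℕ) (c : K) (x : A) :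
    ((n.factorial : K)⁻¹) • (t ^ n) (c • x) =
      ∑ ij ∈ Finset.HasAntidiagonal.antidiagonal n,
        (d^[ij.1] c / (ij.1.factorial : K)) • ((ij.2.factorial : K)⁻¹ • (t ^ ij.2) x) := by
  have key : (t ^ n) (c • x) = ∑ ij ∈ Finset.HasAntidiagonal.antidiagonal n,
      n.choose ij.1 • (d^[ij.1] c • (t ^ ij.2) x) := by
    induction n with
    | zero => simp
    | succ n ih =>
      rw [Finset.sum_antidiagonal_choose_succ_nsmul (M := A)
        (fun i j => d^[i] c • (t ^ j) x) n, pow_succ', end_mul_apply, ih, map_sum,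
        ← Finset.sum_add_distrib]
      refine Finset.sum_congr rfl fun ij hij => ?_
      have hij' : ij.1 + ij.2 = n := Finset.HasAntidiagonal.mem_antidiagonal.1 hij
      rw [map_nsmul, h, smul_add, Function.iterate_succ_apply', pow_succ',
        end_mul_apply, n.choose_symm_of_eq_add hij'.symm]
  rw [key, Finset.smul_sum]
  refine Finset.sum_congr rfl fun ij hij => ?_
  have hn := Finset.HasAntidiagonal.mem_antidiagonal.1 hij
  have h1 : ((ij.1.factorial : K)) ≠ 0 := Nat.cast_ne_zero.2 (Nat.factorial_ne_zero _)
  have h2 : ((ij.2.factorial : K)) ≠ 0 := Nat.cast_ne_zero.2 (Nat.factorial_ne_zero _)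
  have h3 : ((n.factorial : K)) ≠ 0 := Nat.cast_ne_zero.2 (Nat.factorial_ne_zero _)
  have h4 : (n.choose ij.1 : K) * ij.1.factorial * ij.2.factorial = n.factorial := by
    rw [← hn, Nat.choose_symm_add]
    exact_mod_cast Nat.add_choose_mul_factorial_mul_factorial ij.1 ij.2
  rw [← Nat.cast_smul_eq_nsmul K, smul_smul, smul_smul, smul_smul]
  congr 1
  field_simp
  rw [← h4]; ring

/-- The derivation `∂_X : (a_i) ↦ ((i+1) a_{i+1})` of `K[[X]]`. -/
abbrev dX (K : Type u) [Field K] : Derivation K K⟦X⟧ K⟦X⟧ := PowerSeries.derivative K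

theorem coeff_dX (a : K⟦X⟧) (i : ℕ) :
    PowerSeries.coeff i (dX K a) = PowerSeries.coeff (i + 1) a * (i + 1) :=
  PowerSeries.coeff_derivative a i

variable [CharZero K] (d : Derivation ℤ K K)

/-- The Taylor homomorphism `g_0 : K → K[[X]]`, `c ↦ (dⁱ(c)/i!)_i`. -/
def taylorHom : K →+* K⟦X⟧ where
  toFun c := PowerSeries.mk fun i => d^[i] c / (i.factorial : K)
  map_zero' := by ext i; simp
  map_one' := by
    ext i
    rw [PowerSeries.coeff_mk, PowerSeries.coeff_one]
    cases i with
    | zero => simp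
    | succ i => simp
  map_add' a b := by ext i; simp [add_div]
  map_mul' a b := by
    ext n
    let t : AddMonoid.End K := d.toLinearMap.toAddMonoidHom
    have h := divPow_leibniz d (A := K) t
      (fun r x => by
        change d (r * x) = r * d x + d r * x
        rw [Derivation.leibniz, smul_eq_mul, smul_eq_mul, mul_comm x]) n a b
    have hp : ∀ (n : ℕ) (x : K),
        (t ^ n) x = d^[n] x := fun n x => by
      induction n with
      | zero => rfl
      | succ n ih => rw [pow_succ', end_mul_apply, ih, Function.iterate_succ_apply']; rfl
    simp only [hp, smul_eq_mul] at h
    rw [PowerSeries.coeff_mk, PowerSeries.coeff_mul, div_eq_inv_mul, h]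
    refine Finset.sum_congr rfl fun ij _ => ?_
    rw [PowerSeries.coeff_mk, PowerSeries.coeff_mk, ← div_eq_inv_mul]

theorem coeff_taylorHom (c : K) (i : ℕ) :
    PowerSeries.coeff i (taylorHom d c) = d^[i] c / (i.factorial : K) := by
  change PowerSeries.coeff i (PowerSeries.mk fun i => d^[i] c / (i.factorial : K)) = _
  rw [PowerSeries.coeff_mk]

theorem taylorHom_d (c : K) : taylorHom d (d c) = dX K (taylorHom d c) := by
  ext i
  rw [coeff_dX, coeff_taylorHom, coeff_taylorHom, ← Function.iterate_succ_apply,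
    Nat.factorial_succ]
  have h1 : ((i.factorial : K)) ≠ 0 := Nat.cast_ne_zero.2 (Nat.factorial_ne_zero _)
  have h2 : ((i : K) + 1) ≠ 0 := Nat.cast_add_one_ne_zero i
  push_cast
  field_simp

/-- The ring homomorphism `f_0 : K⟨T⟩ → K[[X]]⟨T⟩` attached to `g_0`. -/
def f₀ : TwistedPoly d →+* TwistedPoly (dX K) := TwistedPoly.map (taylorHom d) (taylorHom_d d)

/-- The left `K⟨T⟩`-module `f_{0*} L_0`: the restriction along `f_0` of the left
`K[[X]]⟨T⟩`-module `L_0 = L(K[[X]], ∂_X)`. Its additive group is that of `K[[X]]`. -/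
@[nolint unusedArguments]
def F₀L₀ (_d : Derivation ℤ K K) : Type u := L (dX K)

namespace F₀L₀

instance : AddCommGroup (F₀L₀ d) := inferInstanceAs (AddCommGroup (L (dX K)))

instance : Module (TwistedPoly d) (F₀L₀ d) := Module.compHom (L (dX K)) (f₀ d)

variable {d}

/-- The identification of the additive group of `f_{0*} L_0` with `K[[X]]`. -/
def ser : F₀L₀ d ≃+ K⟦X⟧ := AddEquiv.refl K⟦X⟧

/-- The `i`-th coordinate `a_i` of `(a_i) ∈ f_{0*} L_0`. -/
def coord (i : ℕ) : F₀L₀ d →+ K := (PowerSeries.coeff i).toAddMonoidHom.comp ser.toAddMonoidHom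

theorem coord_eq (i : ℕ) (a : F₀L₀ d) : coord i a = PowerSeries.coeff i (ser a) := rfl

theorem ext' {a b : F₀L₀ d} (h : ∀ i, coord i a = coord i b) : a = b :=
  ser.injective (PowerSeries.ext h)

theorem ser_C_smul (c : K) (a : F₀L₀ d) : ser (C d c • a) = taylorHom d c * ser a := by
  change (f₀ d (C d c) • (show L (dX K) from a) : L (dX K)) = _
  rw [f₀, TwistedPoly.map, lift_C, RingHom.comp_apply, C_smul_L]
  rfl

theorem ser_T_smul (a : F₀L₀ d) : ser (T d • a) = dX K (ser a) := by
  change (f₀ d (T d) • (show L (dX K) from a) : L (dX K)) = _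
  rw [f₀, TwistedPoly.map, lift_T, T_smul_L]
  rfl

theorem coord_T_smul (a : F₀L₀ d) (i : ℕ) : coord i (T d • a) = coord (i + 1) a * (i + 1) := by
  rw [coord_eq, ser_T_smul, coeff_dX, coord_eq]

theorem coord_zero_C_smul (a : F₀L₀ d) (c : K) : coord 0 (C d c • a) = c * coord 0 a := by
  rw [coord_eq, ser_C_smul, PowerSeries.coeff_mul]
  simp [coeff_taylorHom, coord_eq]

/-- The endomorphism `(a_i) ↦ (c a_i)` of the left `K⟨T⟩`-module `f_{0*} L_0`. -/
def scal : K →+* Module.End (TwistedPoly d) (F₀L₀ d) where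
  toFun c := mkLinear (ser.symm.toAddMonoidHom.comp
      ((AddMonoidHom.mulLeft (PowerSeries.C c)).comp ser.toAddMonoidHom))
    (fun e x => (ser (d := d)).injective (by
      change PowerSeries.C c * ser (C d e • x) = ser (C d e • ser.symm (PowerSeries.C c * ser x))
      rw [ser_C_smul, ser_C_smul, AddEquiv.apply_symm_apply]
      ring))
    (fun x => (ser (d := d)).injective (by
      change PowerSeries.C c * ser (T d • x) = ser (T d • ser.symm (PowerSeries.C c * ser x))
      rw [ser_T_smul, ser_T_smul, AddEquiv.apply_symm_apply]
      ext i
      rw [PowerSeries.coeff_C_mul, coeff_dX, coeff_dX, PowerSeries.coeff_C_mul, mul_assoc]))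
  map_zero' := LinearMap.ext fun x => by
    change ser.symm (PowerSeries.C 0 * ser x) = 0
    simp
  map_one' := LinearMap.ext fun x => by
    change ser.symm (PowerSeries.C 1 * ser x) = x
    simp
  map_add' a b := LinearMap.ext fun x => by
    change ser.symm (PowerSeries.C (a + b) * ser x) =
      ser.symm (PowerSeries.C a * ser x) + ser.symm (PowerSeries.C b * ser x)
    rw [map_add, add_mul, map_add]
  map_mul' a b := LinearMap.ext fun x => by
    change ser.symm (PowerSeries.C (a * b) * ser x) =
      ser.symm (PowerSeries.C a * ser (ser.symm (PowerSeries.C b * ser x)))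
    rw [AddEquiv.apply_symm_apply, ← mul_assoc, ← map_mul PowerSeries.C]

theorem coord_scal (c : K) (a : F₀L₀ d) (i : ℕ) : coord i (scal c a) = c * coord i a :=
  PowerSeries.coeff_C_mul i (ser a) c

/-- The additive endomorphism `(a_i) ↦ (d(a_i) - (i+1) a_{i+1})` of `K[[X]]`. -/
def opSerAux (d : Derivation ℤ K K) : K⟦X⟧ →+ K⟦X⟧ where
  toFun a := PowerSeries.mk (fun i => d (PowerSeries.coeff i a)) - dX K a
  map_zero' := by ext; simp
  map_add' a b := by ext; simp; ring

theorem coeff_opSerAux (a : K⟦X⟧) (i : ℕ) : PowerSeries.coeff i (opSerAux d a) =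
    d (PowerSeries.coeff i a) - PowerSeries.coeff (i + 1) a * (i + 1) := by
  change PowerSeries.coeff i (PowerSeries.mk (fun i => d (PowerSeries.coeff i a)) - dX K a) = _
  rw [map_sub, PowerSeries.coeff_mk, coeff_dX]

theorem opSerAux_mul (c : K) (a : K⟦X⟧) :
    opSerAux d (taylorHom d c * a) = taylorHom d c * opSerAux d a := by
  have h1 : PowerSeries.mk (fun i => d (PowerSeries.coeff i (taylorHom d c * a))) =
      taylorHom d (d c) * a +
        taylorHom d c * PowerSeries.mk (fun i => d (PowerSeries.coeff i a)) := by
    ext n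
    rw [PowerSeries.coeff_mk, map_add, PowerSeries.coeff_mul, PowerSeries.coeff_mul,
      PowerSeries.coeff_mul, map_sum, ← Finset.sum_add_distrib]
    refine Finset.sum_congr rfl fun ij _ => ?_
    have h2 : d (d^[ij.1] c / (ij.1.factorial : K)) = d^[ij.1] (d c) / (ij.1.factorial : K) := by
      rw [div_eq_mul_inv, Derivation.leibniz, ← Function.iterate_succ_apply,
        Function.iterate_succ_apply']
      have : d ((ij.1.factorial : K)⁻¹) = 0 := by
        rw [Derivation.leibniz_inv, Derivation.map_natCast]; simp
      rw [this, smul_zero, zero_add, smul_eq_mul, div_eq_inv_mul]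
    rw [Derivation.leibniz, coeff_taylorHom, coeff_taylorHom, PowerSeries.coeff_mk, h2,
      smul_eq_mul, smul_eq_mul]
    ring
  change PowerSeries.mk _ - dX K _ = _ * (PowerSeries.mk _ - dX K _)
  rw [h1, Derivation.leibniz, taylorHom_d, smul_eq_mul, smul_eq_mul]
  ring

/-- The endomorphism `(a_i) ↦ (d(a_i) - (i+1) a_{i+1})` of the left `K⟨T⟩`-module
`f_{0*} L_0`. -/
def op : Module.End (TwistedPoly d) (F₀L₀ d) :=
  mkLinear (ser.symm.toAddMonoidHom.comp ((opSerAux d).comp ser.toAddMonoidHom))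
    (fun e x => (ser (d := d)).injective (by
      change opSerAux d (ser (C d e • x)) = ser (C d e • ser.symm (opSerAux d (ser x)))
      rw [ser_C_smul, ser_C_smul, AddEquiv.apply_symm_apply, opSerAux_mul]))
    (fun x => (ser (d := d)).injective (by
      change opSerAux d (ser (T d • x)) = ser (T d • ser.symm (opSerAux d (ser x)))
      rw [ser_T_smul, ser_T_smul, AddEquiv.apply_symm_apply]
      ext i
      rw [coeff_opSerAux, coeff_dX, coeff_dX, coeff_dX, coeff_opSerAux, Derivation.leibniz]
      have : d ((i : K) + 1) = 0 := by
        rw [map_add, Derivation.map_natCast, Derivation.map_one_eq_zero, add_zero]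
      rw [this, smul_zero, zero_add, smul_eq_mul]
      push_cast
      ring))

theorem coord_op (a : F₀L₀ d) (i : ℕ) :
    coord i (op a) = d (coord i a) - coord (i + 1) a * (i + 1) :=
  coeff_opSerAux (ser a) i

variable (d) in
/-- The ring homomorphism `ρˢ : K⟨T⟩ → End(f_{0*} L_0)` with `ρˢ(c)(a_i) = (c a_i)` for `c ∈ K` and
`ρˢ(T)(a_i) = (d(a_i) - (i+1) a_{i+1})`, which makes `f_{0*} L_0` a left `K⟨T⟩`-object in the
category of left `K⟨T⟩`-modules. -/
def rhoS : TwistedPoly d →+* Module.End (TwistedPoly d) (F₀L₀ d) :=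
  lift scal op fun r => LinearMap.ext fun a => ext' fun i => by
    change coord i (op (scal r a)) = coord i (scal r (op a) + scal (d r) a)
    rw [map_add, coord_op, coord_scal, coord_scal, coord_scal, coord_scal, coord_op,
      Derivation.leibniz, smul_eq_mul, smul_eq_mul]
    ring

end F₀L₀

open F₀L₀

section Functors

variable (M : Type v) [AddCommGroup M] [Module K M] [Module (TwistedPoly d) M]
  [IsScalarTower K (TwistedPoly d) M]

/-- The operator `χ ↦ (x ↦ d(χ(x)) - χ(T x))` on the linear dual of `M`. -/
def dualOp : AddMonoid.End (M →ₗ[K] K) where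
  toFun χ :=
    { toFun := fun x => d (χ x) - χ (T d • x)
      map_add' := fun x y => by rw [smul_add, map_add, map_add, map_add]; ring
      map_smul' := fun c x => by
        rw [T_smul_smul, map_add, χ.map_smul, χ.map_smul, χ.map_smul, RingHom.id_apply]
        simp only [smul_eq_mul, Derivation.leibniz]
        ring }
  map_zero' := by ext; simp
  map_add' χ ψ := by ext; simp; ring

theorem dualOp_rel (r : K) (χ : M →ₗ[K] K) :
    dualOp d M (r • χ) = r • dualOp d M χ + d r • χ := by
  ext x
  change d (r * χ x) - r * χ (T d • x) = r * (d (χ x) - χ (T d • x)) + d r * χ x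
  rw [Derivation.leibniz, smul_eq_mul, smul_eq_mul]
  ring

/-- The usual dual `D_0 M`: the `K`-linear dual of `M`, with `(T χ)(x) = d(χ(x)) - χ(T x)`. -/
instance : Module (TwistedPoly d) (M →ₗ[K] K) := moduleOfOp (dualOp d M) (dualOp_rel d M)

/-- `D M = Hom(M, f_{0*} L_0)` is a left `K⟨T⟩`-module through the action `ρˢ` on the target:
`(p s)(x) = ρˢ(p)(s(x))`. -/
instance : Module (TwistedPoly d) (M →ₗ[TwistedPoly d] F₀L₀ d) :=
  Module.compHom _ (rhoS d)

instance : Module K (M →ₗ[TwistedPoly d] F₀L₀ d) :=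
  Module.compHom _ (C d)

instance : IsScalarTower K (TwistedPoly d) (M →ₗ[TwistedPoly d] F₀L₀ d) :=
  ⟨fun c p s => by
    rw [← C_mul, mul_smul]
    rfl⟩

/-- The dual functor `D = Hom(-, f_{0*} L_0)`. -/
abbrev Dual : Type (max u v) := M →ₗ[TwistedPoly d] F₀L₀ d

variable {d M}

theorem Dual.smul_apply (p : TwistedPoly d) (s : Dual d M) (x : M) :
    (p • s) x = rhoS d p (s x) := rfl

theorem Dual.coord_C_smul (c : K) (s : Dual d M) (x : M) (i : ℕ) :
    coord i ((C d c • s) x) = c * coord i (s x) := by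
  rw [Dual.smul_apply, rhoS, lift_C, coord_scal]

theorem Dual.coord_T_smul (s : Dual d M) (x : M) (i : ℕ) :
    coord i ((T d • s) x) = d (coord i (s x)) - coord (i + 1) (s x) * (i + 1) := by
  rw [Dual.smul_apply, rhoS, lift_T, coord_op]

theorem dual₀_C_smul (c : K) (χ : M →ₗ[K] K) : C d c • χ = c • χ :=
  moduleOfOp_C_smul (dualOp d M) (dualOp_rel d M) c χ

theorem dual₀_C_smul_apply (c : K) (χ : M →ₗ[K] K) (x : M) : (C d c • χ) x = c * χ x := by
  rw [dual₀_C_smul]; rfl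

theorem dual₀_T_smul_apply (χ : M →ₗ[K] K) (x : M) :
    (T d • χ) x = d (χ x) - χ (T d • x) :=
  DFunLike.congr_fun (moduleOfOp_T_smul (dualOp d M) (dualOp_rel d M) χ) x

instance : IsScalarTower K (TwistedPoly d) (M →ₗ[K] K) :=
  ⟨fun c p χ => by rw [← C_mul, mul_smul, dual₀_C_smul]⟩

variable (d M)

/-- The natural map `Φ_M : D M → D_0 M`, `s ↦ θ ∘ s`, where `θ(a_i) = a_0`. -/
def dualPhi : Dual d M →ₗ[TwistedPoly d] (M →ₗ[K] K) :=
  mkLinear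
    { toFun := fun s =>
        { toFun := fun x => coord 0 (s x)
          map_add' := fun x y => by rw [map_add, map_add]
          map_smul' := fun c x => by
            rw [smul_def (d := d), map_smul, coord_zero_C_smul]; rfl }
      map_zero' := by ext x; exact map_zero (coord (d := d) 0)
      map_add' := fun s t => by ext x; exact map_add (coord (d := d) 0) _ _ }
    (fun c s => by
      ext x
      rw [dual₀_C_smul_apply]
      exact Dual.coord_C_smul c s x 0)
    (fun s => by
      ext x
      rw [dual₀_T_smul_apply]
      change coord 0 ((T d • s) x) = d (coord 0 (s x)) - coord 0 (s (T d • x))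
      rw [Dual.coord_T_smul, map_smul, F₀L₀.coord_T_smul])

@[simp]
theorem dualPhi_apply (s : Dual d M) (x : M) : dualPhi d M s x = coord 0 (s x) := rfl

variable {M}

/-- The family `(χ((1/i!) Tⁱ x))_i` as a power series, for a linear form `χ`. -/
def psiAux (χ : M →ₗ[K] K) : M →+ F₀L₀ d where
  toFun x := ser.symm (PowerSeries.mk fun i => χ (((i.factorial : K)⁻¹) • T d ^ i • x))
  map_zero' := by
    apply ser.injective; ext i; simp
  map_add' x y := by
    apply ser.injective; ext i; simp

theorem coord_psiAux (χ : M →ₗ[K] K) (x : M) (i : ℕ) :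
    coord i (psiAux d χ x) = χ (((i.factorial : K)⁻¹) • T d ^ i • x) := by
  change PowerSeries.coeff i (PowerSeries.mk fun i => χ (((i.factorial : K)⁻¹) • T d ^ i • x)) = _
  rw [PowerSeries.coeff_mk]

theorem psiAux_succ (χ : M →ₗ[K] K) (x : M) (i : ℕ) :
    coord (i + 1) (psiAux d χ x) * (i + 1) =
      χ (((i.factorial : K)⁻¹) • T d ^ (i + 1) • x) := by
  rw [coord_psiAux, χ.map_smul, χ.map_smul, Nat.factorial_succ, smul_eq_mul, smul_eq_mul]
  have h1 : ((i.factorial : K)) ≠ 0 := Nat.cast_ne_zero.2 (Nat.factorial_ne_zero _)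
  have h2 : ((i : K) + 1) ≠ 0 := Nat.cast_add_one_ne_zero i
  push_cast
  field_simp

/-- The element `Ψ_M(χ)` of `D M` for `χ ∈ D_0 M`: `Ψ_M(χ)(x) = (χ((1/i!) Tⁱ x))_i`. -/
def psiFun (χ : M →ₗ[K] K) : Dual d M :=
  mkLinear (psiAux d χ)
    (fun c x => ext' fun i => by
      have h := divPow_leibniz d (A := M) (Module.toAddMonoidEnd (TwistedPoly d) M (T d))
        (fun r x => T_smul_smul r x) i c x
      have hT : ∀ (n : ℕ) (y : M),
          (Module.toAddMonoidEnd (TwistedPoly d) M (T d) ^ n) y = T d ^ n • y := fun n y => by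
        rw [← map_pow]; rfl
      simp only [hT] at h
      rw [coord_psiAux, ← smul_def, h, map_sum, coord_eq, ser_C_smul, PowerSeries.coeff_mul]
      refine Finset.sum_congr rfl fun ij _ => ?_
      rw [← coord_eq, coord_psiAux, coeff_taylorHom, χ.map_smul, smul_eq_mul])
    (fun x => ext' fun i => by
      rw [F₀L₀.coord_T_smul, psiAux_succ, coord_psiAux, pow_succ, mul_smul])

theorem coord_psiFun (χ : M →ₗ[K] K) (x : M) (i : ℕ) :
    coord i (psiFun d χ x) = χ (((i.factorial : K)⁻¹) • T d ^ i • x) := coord_psiAux d χ x i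

theorem d_inv_factorial (i : ℕ) : d ((i.factorial : K)⁻¹) = 0 := by
  rw [Derivation.leibniz_inv, Derivation.map_natCast]; simp

variable (M)

/-- The natural map `Ψ_M : D_0 M → D M`, the inverse of `Φ_M`. -/
def dualPsi : (M →ₗ[K] K) →ₗ[TwistedPoly d] Dual d M :=
  mkLinear
    { toFun := psiFun d
      map_zero' := LinearMap.ext fun x => ext' fun i => by
        rw [coord_psiFun]; simp
      map_add' := fun χ ψ => LinearMap.ext fun x => ext' fun i => by
        rw [LinearMap.add_apply, map_add, coord_psiFun, coord_psiFun, coord_psiFun]; rfl }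
    (fun c χ => LinearMap.ext fun x => ext' fun i => by
      change coord i (psiFun d (C d c • χ) x) = coord i ((C d c • psiFun d χ) x)
      rw [Dual.coord_C_smul, coord_psiFun, coord_psiFun, dual₀_C_smul_apply])
    (fun χ => LinearMap.ext fun x => ext' fun i => by
      change coord i (psiFun d (T d • χ) x) = coord i ((T d • psiFun d χ) x)
      have h := psiAux_succ d χ x i
      change coord (i + 1) (psiFun d χ x) * (i + 1) = _ at h
      rw [Dual.coord_T_smul, h, coord_psiFun, coord_psiFun, dual₀_T_smul_apply, T_smul_smul,
        d_inv_factorial, zero_smul, add_zero, ← mul_smul, ← pow_succ'])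

theorem coord_dualPsi (χ : M →ₗ[K] K) (x : M) (i : ℕ) :
    coord i (dualPsi d M χ x) = χ (((i.factorial : K)⁻¹) • T d ^ i • x) := coord_psiAux d χ x i

/-- The natural map `c_0 : M → D_0 D_0 M`, `c_0(x)(χ) = χ(x)`. -/
def biDual₀ : M →ₗ[TwistedPoly d] ((M →ₗ[K] K) →ₗ[K] K) :=
  mkLinear (LinearMap.id (R := K) (M := M →ₗ[K] K)).flip.toAddMonoidHom
    (fun c x => by
      ext χ
      rw [dual₀_C_smul_apply, ← smul_def]
      exact χ.map_smul c x)
    (fun x => by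
      ext χ
      rw [dual₀_T_smul_apply]
      change χ (T d • x) = d (χ x) - (T d • χ) x
      rw [dual₀_T_smul_apply, sub_sub_cancel])

@[simp]
theorem biDual₀_apply (x : M) (χ : M →ₗ[K] K) : biDual₀ d M x χ = χ x := rfl

variable {M} {M' : Type v} [AddCommGroup M'] [Module K M'] [Module (TwistedPoly d) M']
  [IsScalarTower K (TwistedPoly d) M']

/-- The map `D_0 α : D_0 M → D_0 M'`, `χ ↦ χ ∘ α`. -/
def dual₀Map {M : Type v} {M' : Type w} [AddCommGroup M] [Module K M] [Module (TwistedPoly d) M]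
    [IsScalarTower K (TwistedPoly d) M] [AddCommGroup M'] [Module K M']
    [Module (TwistedPoly d) M'] [IsScalarTower K (TwistedPoly d) M']
    (α : M' →ₗ[TwistedPoly d] M) : (M →ₗ[K] K) →ₗ[TwistedPoly d] (M' →ₗ[K] K) :=
  mkLinear (LinearMap.lcomp K K (α.restrictScalars K)).toAddMonoidHom
    (fun c χ => by
      ext x
      rw [dual₀_C_smul_apply]
      exact dual₀_C_smul_apply c χ (α x))
    (fun χ => by
      ext x
      rw [dual₀_T_smul_apply]
      change (T d • χ) (α x) = d (χ (α x)) - χ (α (T d • x))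
      rw [dual₀_T_smul_apply, α.map_smul])

variable (M)

/-- The natural map `c_M : M → D D M`: the composite of `c_0 : M → D_0 D_0 M` with the
isomorphism `Ψ_{D M} ∘ D_0 Φ_M : D_0 D_0 M → D_0 D M → D D M`. -/
def biDual : M →ₗ[TwistedPoly d] Dual d (Dual d M) :=
  dualPsi d (Dual d M) ∘ₗ dual₀Map d (dualPhi d M) ∘ₗ biDual₀ d M

variable {M}

theorem coord_biDual (x : M) (s : Dual d M) (i : ℕ) :
    coord i (biDual d M x s) = coord 0 ((((i.factorial : K)⁻¹) • T d ^ i • s) x) :=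
  coord_dualPsi d (Dual d M) _ s i

theorem biDual_map (α : M' →ₗ[TwistedPoly d] M) (x : M') (s : Dual d M) :
    biDual d M (α x) s = biDual d M' x (s ∘ₗ α) := by
  refine ext' fun i => ?_
  rw [coord_biDual, coord_biDual]
  rfl

/-! ### The functors `F_-` and `F_+` attached to a subobject of `f_{0*} L_0` -/

variable {d} (M)

/-- `F_- M = {x ∈ M | c_M(x)(s) = 0 for all s ∈ Hom(M, Λ)}` for `Λ ⊆ f_{0*} L_0`. Here a morphism
from `M` to the submodule `Λ` is a morphism `s : M → f_{0*} L_0` with values in `Λ`. -/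
def Fminus (Λ : AddSubgroup (F₀L₀ d)) : Submodule (TwistedPoly d) M where
  carrier := {x | ∀ s : Dual d M, (∀ y, s y ∈ Λ) → biDual d M x s = 0}
  zero_mem' := fun s _ => by rw [map_zero, LinearMap.zero_apply]
  add_mem' := fun {x y} hx hy s hs => by
    rw [map_add, LinearMap.add_apply, hx s hs, hy s hs, add_zero]
  smul_mem' := fun p x hx s hs => by
    rw [map_smul, Dual.smul_apply, hx s hs, map_zero]

/-- `F_+ M = {x ∈ M | c_M(x)(s) ∈ Λ for all s ∈ D M}` for `Λ ⊆ f_{0*} L_0` stable under `ρˢ`. -/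
def Fplus (Λ : AddSubgroup (F₀L₀ d)) (hΛ : ∀ p, ∀ a ∈ Λ, rhoS d p a ∈ Λ) :
    Submodule (TwistedPoly d) M where
  carrier := {x | ∀ s : Dual d M, biDual d M x s ∈ Λ}
  zero_mem' := fun s => by rw [map_zero, LinearMap.zero_apply]; exact Λ.zero_mem
  add_mem' := fun {x y} hx hy s => by
    rw [map_add, LinearMap.add_apply]; exact Λ.add_mem (hx s) (hy s)
  smul_mem' := fun p x hx s => by
    rw [map_smul, Dual.smul_apply]; exact hΛ p _ (hx s)

variable {M}

theorem Fminus_map (Λ : AddSubgroup (F₀L₀ d)) (α : M' →ₗ[TwistedPoly d] M) {x : M'}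
    (hx : x ∈ Fminus M' Λ) : α x ∈ Fminus M Λ := fun s hs => by
  rw [biDual_map]; exact hx _ fun y => hs (α y)

theorem Fplus_map (Λ : AddSubgroup (F₀L₀ d)) (hΛ : ∀ p, ∀ a ∈ Λ, rhoS d p a ∈ Λ)
    (α : M' →ₗ[TwistedPoly d] M) {x : M'} (hx : x ∈ Fplus M' Λ hΛ) : α x ∈ Fplus M Λ hΛ :=
  fun s => by rw [biDual_map]; exact hx _

end Functors

end Duality

/-! ### Norms, radii, and the subobjects `f_{r*} L_r`, `f_{r+*} L_{r+}` -/

section Norms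

variable (K : Type u) [NontriviallyNormedField K] [IsUltrametricDist K]

/-- `p(K)`, the characteristic of the residue field of `K`. -/
def residueChar : ℕ :=
  ringChar (IsLocalRing.ResidueField (NormedField.valuation (K := K)).valuationSubring)

/-- `ω(K) = |p|^{1/(p-1)}` if `p = p(K) > 0`, and `ω(K) = 1` if `p(K) = 0`. -/
def omega : ℝ :=
  if residueChar K = 0 then 1 else ‖(residueChar K : K)‖ ^ ((1 : ℝ) / ((residueChar K : ℝ) - 1))

variable {K}

/-- The operator norm `sup {|f(x)|/|x| ; x ≠ 0}` of a map `f` with respect to `ν = | |`. -/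
def opNormWrt {X : Type v} [Zero X] (ν : X → ℝ) (f : X → X) : ℝ :=
  ⨆ x : {x : X // x ≠ 0}, ν (f x) / ν x

/-- The spectral norm `inf {|fⁿ|_op^{1/n} ; n > 0}`. -/
def specNormWrt {X : Type v} [Zero X] (ν : X → ℝ) (f : X → X) : ℝ :=
  ⨅ n : ℕ+, opNormWrt ν f^[n] ^ ((1 : ℝ) / (n : ℝ))

/-- The derivation `d` of `K` is bounded: it has a finite operator norm. -/
class IsBoundedDerivation (d : Derivation ℤ K K) : Prop where
  exists_bound : ∃ B : ℝ, ∀ x, ‖d x‖ ≤ B * ‖x‖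

/-- `r(K, d) = ω(K) / |d|_{sp,K}`. -/
def rad (d : Derivation ℤ K K) : ℝ := omega K / specNormWrt (fun x : K => ‖x‖) d

variable (K) in
/-- An ultrametric norm on a vector space: the sup norm with respect to a chosen basis. (On a
finite-dimensional space over a complete field all norms are equivalent, and therefore give rise to
the same spectral norms.) -/
def basisNorm (M : Type v) [AddCommGroup M] [Module K M] (x : M) : ℝ :=
  ⨆ i, ‖(Module.Basis.ofVectorSpace K M).repr x i‖

variable (K) in
/-- `K[[X/s]]_0`: the series with `sup_i |a_i| s^i < ∞`. -/
def boundedSeries (s : ℝ) : Set K⟦X⟧ :=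
  {a | BddAbove (Set.range fun i : ℕ => ‖PowerSeries.coeff i a‖ * s ^ i)}

theorem boundedSeries_iff {s : ℝ} {a : K⟦X⟧} : a ∈ boundedSeries K s ↔
    ∃ B : ℝ, ∀ i : ℕ, ‖PowerSeries.coeff i a‖ * s ^ i ≤ B := by
  simp [boundedSeries, BddAbove, Set.Nonempty, upperBounds]

theorem boundedSeries_zero (s : ℝ) : (0 : K⟦X⟧) ∈ boundedSeries K s :=
  boundedSeries_iff.2 ⟨0, fun i => by simp⟩

theorem boundedSeries_neg {s : ℝ} {a : K⟦X⟧} (ha : a ∈ boundedSeries K s) :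
    -a ∈ boundedSeries K s := by
  simpa [boundedSeries] using ha

theorem boundedSeries_add {s : ℝ} (hs : 0 < s) {a b : K⟦X⟧} (ha : a ∈ boundedSeries K s)
    (hb : b ∈ boundedSeries K s) : a + b ∈ boundedSeries K s := by
  obtain ⟨A, hA⟩ := boundedSeries_iff.1 ha
  obtain ⟨B, hB⟩ := boundedSeries_iff.1 hb
  refine boundedSeries_iff.2 ⟨A + B, fun i => ?_⟩
  calc ‖PowerSeries.coeff i (a + b)‖ * s ^ i
      ≤ (‖PowerSeries.coeff i a‖ + ‖PowerSeries.coeff i b‖) * s ^ i := by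
        rw [map_add]; gcongr; exact norm_add_le _ _
    _ ≤ A + B := by rw [add_mul]; exact add_le_add (hA i) (hB i)

theorem boundedSeries_anti {s t : ℝ} (hs : 0 < s) (hst : s ≤ t) {a : K⟦X⟧}
    (ha : a ∈ boundedSeries K t) : a ∈ boundedSeries K s := by
  obtain ⟨A, hA⟩ := boundedSeries_iff.1 ha
  exact boundedSeries_iff.2 ⟨A, fun i => le_trans (by gcongr) (hA i)⟩

variable (K) in
/-- `K{X/r} = ⋂_{0 < s < r} K[[X/s]]_0`. -/
def openSeries (r : ℝ) : AddSubgroup K⟦X⟧ where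
  carrier := {a | ∀ s, 0 < s → s < r → a ∈ boundedSeries K s}
  zero_mem' := fun s _ _ => boundedSeries_zero s
  add_mem' := fun ha hb s hs hr => boundedSeries_add hs (ha s hs hr) (hb s hs hr)
  neg_mem' := fun ha s hs hr => boundedSeries_neg (ha s hs hr)

variable (K) in
/-- `K{X/r+} = ⋃_{s > r} K[[X/s]]_0`, for `r > 0`. -/
def overSeries (r : ℝ) : AddSubgroup K⟦X⟧ where
  carrier := {a | ∃ s, 0 < s ∧ r < s ∧ a ∈ boundedSeries K s}
  zero_mem' := ⟨|r| + 1, by positivity, by linarith [le_abs_self r], boundedSeries_zero _⟩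
  add_mem' := by
    rintro a b ⟨s, hs, hr, ha⟩ ⟨t, ht, hr', hb⟩
    exact ⟨min s t, lt_min hs ht, lt_min hr hr',
      boundedSeries_add (lt_min hs ht) (boundedSeries_anti (lt_min hs ht) (min_le_left _ _) ha)
        (boundedSeries_anti (lt_min hs ht) (min_le_right _ _) hb)⟩
  neg_mem' := fun ⟨s, hs, hr, ha⟩ => ⟨s, hs, hr, boundedSeries_neg ha⟩

variable [CharZero K] (d : Derivation ℤ K K)

/-- The underlying group of the subobject `f_{r*} L_r` of `f_{0*} L_0`, for `0 < r ≤ r(K, d)`. -/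
def frLr (r : ℝ) : AddSubgroup (F₀L₀ d) := (openSeries K r).comap F₀L₀.ser.toAddMonoidHom

/-- The underlying group of the subobject `f_{r+*} L_{r+}` of `f_{0*} L_0`, for
`0 < r < r(K, d)`. -/
def frpLrp (r : ℝ) : AddSubgroup (F₀L₀ d) := (overSeries K r).comap F₀L₀.ser.toAddMonoidHom

variable {d}

theorem rhoS_bounded [hd : IsBoundedDerivation d] {s : ℝ} (hs : 0 < s) (a : F₀L₀ d)
    (ha : F₀L₀.ser a ∈ boundedSeries K s) (p : TwistedPoly d) :
    F₀L₀.ser (F₀L₀.rhoS d p a) ∈ boundedSeries K s := by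
  have hC : ∀ (c : K) (b : F₀L₀ d), F₀L₀.ser b ∈ boundedSeries K s →
      F₀L₀.ser (F₀L₀.scal c b) ∈ boundedSeries K s := by
    intro c b hb
    obtain ⟨B, hB⟩ := boundedSeries_iff.1 hb
    refine boundedSeries_iff.2 ⟨‖c‖ * B, fun i => ?_⟩
    rw [← F₀L₀.coord_eq, F₀L₀.coord_scal, norm_mul, mul_assoc]
    exact mul_le_mul_of_nonneg_left (hB i) (norm_nonneg c)
  have hT : ∀ (b : F₀L₀ d), F₀L₀.ser b ∈ boundedSeries K s →
      F₀L₀.ser (F₀L₀.op b) ∈ boundedSeries K s := by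
    intro b hb
    obtain ⟨B, hB⟩ := boundedSeries_iff.1 hb
    obtain ⟨D, hD⟩ := hd.exists_bound
    refine boundedSeries_iff.2 ⟨|D| * B + B / s, fun i => ?_⟩
    rw [← F₀L₀.coord_eq, F₀L₀.coord_op]
    have h1 : ‖d (F₀L₀.coord i b)‖ ≤ |D| * ‖F₀L₀.coord i b‖ :=
      (hD _).trans (mul_le_mul_of_nonneg_right (le_abs_self D) (norm_nonneg _))
    have h2 : ‖F₀L₀.coord (i + 1) b * (i + 1)‖ ≤ ‖F₀L₀.coord (i + 1) b‖ := by
      rw [norm_mul]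
      refine mul_le_of_le_one_right (norm_nonneg _) ?_
      exact_mod_cast IsUltrametricDist.norm_natCast_le_one K (i + 1)
    have h3 : ‖F₀L₀.coord i b‖ * s ^ i ≤ B := hB i
    have h4 : ‖F₀L₀.coord (i + 1) b‖ * s ^ i ≤ B / s := by
      rw [le_div_iff₀ hs, mul_assoc, ← pow_succ]; exact hB (i + 1)
    calc ‖d (F₀L₀.coord i b) - F₀L₀.coord (i + 1) b * (i + 1)‖ * s ^ i
        ≤ (|D| * ‖F₀L₀.coord i b‖ + ‖F₀L₀.coord (i + 1) b‖) * s ^ i := by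
          gcongr
          exact (norm_sub_le _ _).trans (add_le_add h1 h2)
      _ = |D| * (‖F₀L₀.coord i b‖ * s ^ i) + ‖F₀L₀.coord (i + 1) b‖ * s ^ i := by ring
      _ ≤ |D| * B + B / s := by gcongr
  induction p using induction_mono with
  | hadd p q hp hq =>
    rw [map_add, LinearMap.add_apply, map_add]; exact boundedSeries_add hs hp hq
  | hmono i c =>
    rw [monomial_eq, map_mul, map_pow, Module.End.mul_apply, F₀L₀.rhoS, lift_C, lift_T]
    refine hC c _ ?_
    induction i with
    | zero => simpa using ha
    | succ i ih => rw [pow_succ', Module.End.mul_apply]; exact hT _ ih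

theorem frLr_stable [IsBoundedDerivation d] (r : ℝ) :
    ∀ p, ∀ a ∈ frLr d r, F₀L₀.rhoS d p a ∈ frLr d r :=
  fun p a ha s hs hr => rhoS_bounded hs a (ha s hs hr) p

section Filtrations

variable (d) [IsBoundedDerivation d] (M : Type v) [AddCommGroup M] [Module K M]
  [Module (TwistedPoly d) M] [IsScalarTower K (TwistedPoly d) M]

/-- `F_{(0,r]} M`: it is `F_- M` for `f_{r+*} L_{r+}` if `0 < r < r(K, d)`, and `M` if
`r = r(K, d)`. -/
def FzeroTo (r : ℝ) : Submodule (TwistedPoly d) M :=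
  open Classical in if r < rad d then Fminus M (frpLrp d r) else ⊤

/-- `F_{[r, r(K,d)]} M`, which is `F_+ M` for `f_{r*} L_r`, for `0 < r ≤ r(K, d)`. -/
def FfromTop (r : ℝ) : Submodule (TwistedPoly d) M := Fplus M (frLr d r) (frLr_stable r)

/-- `F_{[r,r]} M = F_{(0,r]} M ∩ F_{[r, r(K,d)]} M`. -/
def Fat (r : ℝ) : Submodule (TwistedPoly d) M := FzeroTo d M r ⊓ FfromTop d M r

variable {M} {M' : Type v} [AddCommGroup M'] [Module K M'] [Module (TwistedPoly d) M']
  [IsScalarTower K (TwistedPoly d) M']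

theorem Fat_map (r : ℝ) (α : M' →ₗ[TwistedPoly d] M) :
    ∀ x ∈ Fat d M' r, α x ∈ Fat d M r := by
  rintro x ⟨h1, h2⟩
  refine ⟨?_, Fplus_map _ _ α h2⟩
  by_cases hr : r < rad d
  · simp only [FzeroTo, if_pos hr, SetLike.mem_coe] at h1 ⊢
    exact Fminus_map _ α h1
  · simp [FzeroTo, if_neg hr]

/-- The action of the functor `F_{[r,r]}` on morphisms. -/
def FatMap (r : ℝ) (α : M' →ₗ[TwistedPoly d] M) : Fat d M' r →ₗ[TwistedPoly d] Fat d M r :=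
  α.restrict (Fat_map d r α)

end Filtrations

/-! ### The multiplicities `m(M)` and the submodules `F_{sp,Y} M` -/

section Spectral

variable (d) (M : Type v) [AddCommGroup M] [Module K M]
  [Module (TwistedPoly d) M] [IsScalarTower K (TwistedPoly d) M]

/-- The generic radius `ω(K) / |T|_{sp,M}` (used for irreducible finite-dimensional `M`). -/
def genRad : ℝ := omega K / specNormWrt (basisNorm K M) fun x => T d • x

variable {M} in
/-- The `i`-th factor of a composition series of `M`. -/
abbrev factor (s : CompositionSeries (Submodule (TwistedPoly d) M)) (i : Fin s.length) : Type v :=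
  s i.succ ⧸ (s i.castSucc).submoduleOf (s i.succ)

/-- The multiplicity `m(M)(r)`: the sum of the dimensions of those Jordan-Hölder factors of `M`
whose generic radius is `r`, computed in a chosen composition series from `0` to `M`. -/
def mult (r : ℝ) : ℕ :=
  open Classical in
  if h : ∃ s : CompositionSeries (Submodule (TwistedPoly d) M), s.head = ⊥ ∧ s.last = ⊤ then
    ∑ i : Fin h.choose.length,
      if genRad d (factor d h.choose i) = r then Module.finrank K (factor d h.choose i) else 0
  else 0

/-- `supp m(M)`, a subset of `(0, r(K, d)]`. -/
def suppMult : Set ℝ := {r | r ∈ Set.Ioc 0 (rad d) ∧ mult d M r ≠ 0}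

/-- `F_{sp,Y} M`: the largest submodule `N` of `M` with `supp m(N) ⊆ Y`, defined as the supremum of
all such `N`. -/
def Fsp (Y : Set ℝ) : Submodule (TwistedPoly d) M :=
  sSup {N : Submodule (TwistedPoly d) M | suppMult d N ⊆ Y}

/-- The natural map `I_{sp,M} : ⨁_{r ∈ (0, r(K,d)]} F_{sp,[r,r]} M → M`. -/
def Isp : (DirectSum (Set.Ioc 0 (rad d)) fun r => Fsp d M {r.1}) →ₗ[TwistedPoly d] M :=
  DirectSum.coeLinearMap fun r : Set.Ioc 0 (rad d) => Fsp d M {r.1}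

end Spectral

end Norms

end

noncomputable section

set_option linter.unusedSectionVars false

open TwistedPoly F₀L₀

/-! ### Sequences and spectral norms -/

/-! The radius is a rate of convergence. By Legendre's formula `|n!| ≥ ω^n`, and `|n!| = O(μ^n)` for
every `μ > ω`. Hence the generic radius of a nonzero `M` is the largest `r ≤ r(K,∂)` such that
`|χ(Tⁿx/n!)| sⁿ` is bounded for all `s < r`, all linear forms `χ` and all `x` (`radGE_genRad`,
`le_genRad_of_radGE`). Everything is therefore expressed by two conditions on subquotients `B / A`:
radius at least `r` (`RadGE`), and no nonzero subquotient of radius at least `r` (`RadLT`). Both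
pass to submodules, quotients and extensions (`ConvOn.trans`, `RadLT.trans`), and to duals, because
the Leibniz rule moves divided powers of `T` across a pairing (`bddDivT_iff_dual`).

The heart is that extensions between the two kinds split, in either order. The obstruction for `L ⊆
M` lies in the cokernel of the commutator with `T` on `(M/L)^* ⊗ L`. One factor, `X`, has only radii
below `r`; the other, `Y`, has radius at least `r`. Modulo commutators, `(q Tⁱx/i!) ⊗ y` equals `± x
⊗ Tⁱ(q y)/i!`. If `x` is, up to vectors already known to be harmless, a combination of terms `q
Tⁱx/i!` with `|q|/sⁱ` small, then `x ⊗ y` is congruent to `x ⊗ φ(y)` with `φ` a contraction of `Y`.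
Since `1 - φ` is surjective, `x ⊗ y` is a commutator for all `y`. If `x` is not such a combination,
the gauge counting these coefficients yields a nonzero subquotient of `X` of radius at least `r`,
which is excluded (`pairing_mem_of_radLT_of_radGE`).

Splitting makes every module, for each `r`, a sum of a part of radius at least `r` and a part with
smaller radii (`exists_radGE_sup_radLT`). Induction on submodules gives a sum of pure pieces, and
comparing largest radii shows that the sum is direct. Under duality `F_{[r,r(K,∂)]}` consists of the
vectors converging up to `r`. Moreover `F_{(0,r]}` is killed by every linear form that comes from a
quotient of radius greater than `r`, while a module pure of radius `r` has no nonzero map to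
`f_{r+*}L_{r+}`. So `F_{[r,r]}` is the largest pure submodule. Uniqueness of components makes
morphisms strict, whence exactness. -/

theorem exists_le_mul_pow_of_submultiplicative {a : ℕ → ℝ} (h0 : ∀ n, 0 ≤ a n)
    (hmul : ∀ m n, a (m + n) ≤ a m * a n) {μ : ℝ} (hμ : 0 < μ) {k : ℕ} (hk : 0 < k)
    (hak : a k ≤ μ ^ k) : ∃ C : ℝ, 0 < C ∧ ∀ n, a n ≤ C * μ ^ n := by
  have hnn : ∀ j, 0 ≤ a j / μ ^ j := fun j => div_nonneg (h0 j) (pow_pos hμ j).le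
  have hC : 0 < ∑ j ∈ Finset.range k, a j / μ ^ j + 1 :=
    add_pos_of_nonneg_of_pos (Finset.sum_nonneg fun j _ => hnn j) one_pos
  -- The constant covers all remainders `j < k`; each removal of a block of length `k` from the
  -- index costs at most `μ ^ k`.
  refine ⟨∑ j ∈ Finset.range k, a j / μ ^ j + 1, hC, fun n => ?_⟩
  induction n using Nat.strong_induction_on with
  | _ n ih =>
    rcases lt_or_ge n k with h | h
    · rw [← div_le_iff₀ (pow_pos hμ n)]
      have := Finset.single_le_sum (f := fun j => a j / μ ^ j) (fun j _ => hnn j)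
        (Finset.mem_range.2 h)
      linarith
    · obtain ⟨m, rfl⟩ := Nat.exists_eq_add_of_le h
      calc a (k + m) ≤ a k * a m := hmul k m
        _ ≤ μ ^ k * ((∑ j ∈ Finset.range k, a j / μ ^ j + 1) * μ ^ m) :=
          mul_le_mul hak (ih m (by omega)) (h0 m) (pow_pos hμ k).le
        _ = _ := by ring

section SpecNorm

variable {X : Type v} [Zero X] {ν : X → ℝ} {f : X → X}

theorem iterate_bound (B : ℝ) (hB : 0 ≤ B) (hf : ∀ x, ν (f x) ≤ B * ν x) (n : ℕ) (x : X) :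
    ν (f^[n] x) ≤ B ^ n * ν x := by
  induction n with
  | zero => simp
  | succ n ih =>
    rw [Function.iterate_succ_apply', pow_succ', mul_assoc]
    exact (hf _).trans (mul_le_mul_of_nonneg_left ih hB)

theorem opNormWrt_le (hν : ∀ x, x ≠ 0 → 0 < ν x) {g : X → X} {B : ℝ} (hB : 0 ≤ B)
    (hg : ∀ x, ν (g x) ≤ B * ν x) : opNormWrt ν g ≤ B :=
  Real.iSup_le (fun x => (div_le_iff₀ (hν x.1 x.2)).2 (hg x.1)) hB

theorem le_opNormWrt (hν0 : ν 0 = 0) (hν : ∀ x, x ≠ 0 → 0 < ν x) {g : X → X} {B : ℝ}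
    (hg : ∀ x, ν (g x) ≤ B * ν x) (x : X) : ν (g x) ≤ opNormWrt ν g * ν x := by
  by_cases hx : x = 0
  · have := hg x
    rw [hx, hν0, mul_zero] at *
    exact this
  · rw [← div_le_iff₀ (hν x hx)]
    refine le_ciSup (f := fun x : {x : X // x ≠ 0} => ν (g x) / ν x) ⟨B, ?_⟩ ⟨x, hx⟩
    rintro _ ⟨y, rfl⟩
    exact (div_le_iff₀ (hν y.1 y.2)).2 (hg y.1)

theorem opNormWrt_nonneg (hν0 : ν 0 = 0) (hν : ∀ x, x ≠ 0 → 0 < ν x) (g : X → X) :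
    0 ≤ opNormWrt ν g := by
  have hnn : ∀ x, 0 ≤ ν x := fun x => by
    by_cases hx : x = 0
    · rw [hx, hν0]
    · exact (hν x hx).le
  exact Real.iSup_nonneg fun x => div_nonneg (hnn _) (hnn _)

theorem specNormWrt_nonneg (hν0 : ν 0 = 0) (hν : ∀ x, x ≠ 0 → 0 < ν x) (f : X → X) :
    0 ≤ specNormWrt ν f :=
  Real.iInf_nonneg fun _ => Real.rpow_nonneg (opNormWrt_nonneg hν0 hν _) _

theorem specNormWrt_le_of_pow (hν0 : ν 0 = 0) (hν : ∀ x, x ≠ 0 → 0 < ν x) {μ : ℝ} (hμ : 0 ≤ μ)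
    {n : ℕ} (hn : 0 < n) (h : opNormWrt ν f^[n] ≤ μ ^ n) : specNormWrt ν f ≤ μ := by
  have h1 : specNormWrt ν f ≤ opNormWrt ν f^[n] ^ ((1 : ℝ) / (n : ℝ)) :=
    ciInf_le (f := fun n : ℕ+ => opNormWrt ν f^[n] ^ ((1 : ℝ) / (n : ℝ)))
      ⟨0, by
        rintro _ ⟨m, rfl⟩
        exact Real.rpow_nonneg (opNormWrt_nonneg hν0 hν _) _⟩ ⟨n, hn⟩
  refine h1.trans ?_
  calc opNormWrt ν f^[n] ^ ((1 : ℝ) / (n : ℝ)) ≤ (μ ^ n) ^ ((1 : ℝ) / (n : ℝ)) :=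
        Real.rpow_le_rpow (opNormWrt_nonneg hν0 hν _) h (by positivity)
    _ = μ := by rw [one_div, Real.pow_rpow_inv_natCast hμ hn.ne']

/-- The infimum lies below `μ`, so some iterate already has operator norm at most `μ ^ k`, and
submultiplicativity controls all the others. The bound `hf` ensures that the suprema are taken over
bounded sets; an unbounded real supremum has the default value `0`. -/
theorem exists_iterate_le_of_specNormWrt_lt (hν0 : ν 0 = 0) (hν : ∀ x, x ≠ 0 → 0 < ν x)
    {B : ℝ} (hB : 0 ≤ B) (hf : ∀ x, ν (f x) ≤ B * ν x) {μ : ℝ} (h : specNormWrt ν f < μ) :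
    ∃ C : ℝ, 0 < C ∧ ∀ n x, ν (f^[n] x) ≤ C * μ ^ n * ν x := by
  have hμ : 0 < μ := (specNormWrt_nonneg hν0 hν f).trans_lt h
  have hnn : ∀ x, 0 ≤ ν x := fun x => by
    by_cases hx : x = 0
    · rw [hx, hν0]
    · exact (hν x hx).le
  obtain ⟨k, hk⟩ := exists_lt_of_ciInf_lt h
  have hle : ∀ n x, ν (f^[n] x) ≤ opNormWrt ν f^[n] * ν x := fun n =>
    le_opNormWrt hν0 hν (iterate_bound B hB hf n)
  obtain ⟨C, hC, hCn⟩ := exists_le_mul_pow_of_submultiplicative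
    (a := fun n => opNormWrt ν f^[n]) (fun n => opNormWrt_nonneg hν0 hν _)
    (fun m n => opNormWrt_le hν
      (mul_nonneg (opNormWrt_nonneg hν0 hν _) (opNormWrt_nonneg hν0 hν _)) fun x => by
        rw [Function.iterate_add_apply, mul_assoc]
        exact (hle m _).trans (mul_le_mul_of_nonneg_left (hle n x) (opNormWrt_nonneg hν0 hν _)))
    hμ k.pos (by
      have h1 := Real.rpow_le_rpow (Real.rpow_nonneg (opNormWrt_nonneg hν0 hν _) _) hk.le
        (Nat.cast_nonneg (k : ℕ))
      rwa [one_div, Real.rpow_inv_rpow (opNormWrt_nonneg hν0 hν _) (by simp),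
        Real.rpow_natCast] at h1)
  exact ⟨C, hC, fun n x => (hle n x).trans (mul_le_mul_of_nonneg_right (hCn n) (hnn x))⟩

end SpecNorm

/-! ### Norms of factorials -/

section ResidueChar

variable {K : Type u} [NontriviallyNormedField K] [IsUltrametricDist K]

theorem norm_natCast_lt_one_iff_residueChar_dvd (n : ℕ) : ‖(n : K)‖ < 1 ↔ residueChar K ∣ n := by
  rw [residueChar, ← ringChar.spec]
  rw [show (n : IsLocalRing.ResidueField (NormedField.valuation (K := K)).valuationSubring) =
    IsLocalRing.residue _ (n : (NormedField.valuation (K := K)).valuationSubring) by simp,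
    IsLocalRing.residue_eq_zero_iff, Valuation.mem_maximalIdeal_iff]
  simp [NormedField.valuation_apply, ← NNReal.coe_lt_coe]

theorem norm_natCast_le_one' (n : ℕ) : ‖(n : K)‖ ≤ 1 := IsUltrametricDist.norm_natCast_le_one K n

variable [CharZero K] (hp : 0 < residueChar K)

include hp

theorem residueChar_prime : (residueChar K).Prime := by
  rcases CharP.char_is_prime_or_zero
    (IsLocalRing.ResidueField (NormedField.valuation (K := K)).valuationSubring)
    (residueChar K) with h | h
  · exact h
  · omega

theorem omega_pow : omega K ^ (residueChar K - 1) = ‖(residueChar K : K)‖ := by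
  have h2 := (residueChar_prime hp).two_le
  have h1 : ((residueChar K - 1 : ℕ) : ℝ) = (residueChar K : ℝ) - 1 := by
    rw [Nat.cast_sub (by omega)]; simp
  rw [omega, if_neg hp.ne', ← h1, one_div, Real.rpow_inv_natCast_pow (norm_nonneg _) (by omega)]

theorem omega_pos : 0 < omega K := by
  rw [omega, if_neg hp.ne']
  exact Real.rpow_pos_of_pos (norm_pos_iff.2 (Nat.cast_ne_zero.2 hp.ne')) _

theorem omega_lt_one : omega K < 1 := by
  have h2 := (residueChar_prime hp).two_le
  by_contra! h
  have := one_le_pow₀ (n := residueChar K - 1) h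
  rw [omega_pow hp] at this
  exact absurd ((norm_natCast_lt_one_iff_residueChar_dvd (K := K) _).2 dvd_rfl) (not_lt.2 this)

/-- Legendre's formula `(p - 1) v_p(m!) = m - (sum of the base-p digits of m)`, combined with
`ω^(p-1) = |p|`. The part of `m!` prime to `p` has norm one. -/
theorem norm_factorial (m : ℕ) :
    ‖(m.factorial : K)‖ = omega K ^ (m - ((residueChar K).digits m).sum) := by
  have hP := residueChar_prime hp
  have : Fact (residueChar K).Prime := ⟨hP⟩
  rw [← sub_one_mul_padicValNat_factorial, pow_mul, omega_pow hp]
  obtain ⟨q, hq⟩ := pow_padicValNat_dvd (p := residueChar K) (n := m.factorial)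
  have hq' : ‖(q : K)‖ = 1 := by
    refine le_antisymm (norm_natCast_le_one' q) (not_lt.1 fun h => ?_)
    rw [norm_natCast_lt_one_iff_residueChar_dvd] at h
    obtain ⟨t, rfl⟩ := h
    refine pow_succ_padicValNat_not_dvd (p := residueChar K) m.factorial_ne_zero ⟨t, ?_⟩
    rw [pow_succ, mul_assoc]; exact hq
  conv_lhs => rw [hq]
  rw [Nat.cast_mul, norm_mul, hq', mul_one, Nat.cast_pow, norm_pow]

theorem omega_pow_le_norm_factorial (m : ℕ) : omega K ^ m ≤ ‖(m.factorial : K)‖ := by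
  rw [norm_factorial hp]
  exact pow_le_pow_of_le_one (omega_pos hp).le (omega_lt_one hp).le (Nat.sub_le _ _)

/-- The digit sum of a power of `p` is `1`. Along these exponents the lower bound `ω^n` is attained
up to one factor `ω`, so `ω` is the exact exponential rate there. -/
theorem norm_factorial_pow (h : ℕ) :
    ‖(((residueChar K) ^ h).factorial : K)‖ = omega K ^ (residueChar K ^ h - 1) := by
  have hP := residueChar_prime hp
  rw [norm_factorial hp]
  congr 2
  have := Nat.digits_base_pow_mul (b := residueChar K) (k := h) (m := 1) hP.one_lt one_pos
  rw [mul_one] at this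
  rw [this, Nat.digits_of_lt _ 1 one_ne_zero hP.one_lt]
  simp

theorem exists_norm_factorial_pow_le {C : ℝ} {t μ : ℝ} (ht : 0 ≤ t) (hμ : omega K * t < μ) :
    ∃ n : ℕ, 0 < n ∧ C * (‖(n.factorial : K)‖ * t ^ n) ≤ μ ^ n := by
  have hω := omega_pos hp
  have hP := residueChar_prime hp
  have hμ0 : 0 < μ := (mul_nonneg hω.le ht).trans_lt hμ
  -- The geometric decay along `n = p^h` absorbs both the constant `C` and the missing factor `ω⁻¹`.
  have hlim : Filter.Tendsto (fun h : ℕ => |C| * (omega K)⁻¹ * (omega K * t / μ) ^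
      (residueChar K ^ h)) Filter.atTop (nhds 0) := by
    rw [← mul_zero (|C| * (omega K)⁻¹)]
    refine Filter.Tendsto.const_mul _ ?_
    exact (tendsto_pow_atTop_nhds_zero_of_lt_one (by positivity)
      ((div_lt_one hμ0).2 hμ)).comp (tendsto_pow_atTop_atTop_of_one_lt hP.one_lt)
  obtain ⟨h, hh⟩ := (hlim.eventually (gt_mem_nhds one_pos)).exists
  have hn : 0 < residueChar K ^ h := pow_pos hp h
  refine ⟨residueChar K ^ h, hn, ?_⟩
  rw [norm_factorial_pow hp]
  set n := residueChar K ^ h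
  have e : omega K ^ (n - 1) = (omega K)⁻¹ * omega K ^ n := by
    rw [← Nat.sub_add_cancel hn, pow_succ]
    field_simp
    simp
  have h3 := hh.le
  rw [div_pow, ← mul_div_assoc, div_le_one (pow_pos hμ0 n), mul_pow] at h3
  rw [e]
  refine le_trans ?_ h3
  have : 0 ≤ (omega K)⁻¹ * omega K ^ n * t ^ n := by positivity
  nlinarith [le_abs_self C]

theorem exists_norm_factorial_le {μ : ℝ} (hμ : omega K < μ) :
    ∃ C : ℝ, 0 < C ∧ ∀ n : ℕ, ‖(n.factorial : K)‖ ≤ C * μ ^ n := by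
  obtain ⟨n, hn, h⟩ := exists_norm_factorial_pow_le hp (C := 1) zero_le_one
    (by rwa [mul_one] : omega K * 1 < μ)
  refine exists_le_mul_pow_of_submultiplicative (fun _ => norm_nonneg _) (fun m n => ?_)
    ((omega_pos hp).trans hμ) hn (by simpa using h)
  rw [← Nat.add_choose_mul_factorial_mul_factorial, Nat.cast_mul, Nat.cast_mul, norm_mul, norm_mul,
    mul_assoc]
  exact mul_le_of_le_one_left (by positivity) (norm_natCast_le_one' _)

/-- The spectral norm is an infimum, so it suffices to test exponents `n = p^h`, where `|n!|^(1/n)`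
tends to `ω`. -/
theorem specNormWrt_le_of_factorial {X : Type v} [Zero X] {ν : X → ℝ} {f : X → X} (hν0 : ν 0 = 0)
    (hν : ∀ x, x ≠ 0 → 0 < ν x) {C s : ℝ} (hC : 0 ≤ C) (hs : 0 < s)
    (h : ∀ n x, ν (f^[n] x) * s ^ n ≤ C * ‖(n.factorial : K)‖ * ν x) :
    specNormWrt ν f ≤ omega K / s := by
  refine le_of_forall_gt_imp_ge_of_dense fun μ hμ => ?_
  have hω := omega_pos hp
  obtain ⟨n, hn, h1⟩ := exists_norm_factorial_pow_le hp (C := C) (t := s⁻¹) (by positivity)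
    (by rwa [← div_eq_mul_inv] : omega K * s⁻¹ < μ)
  refine specNormWrt_le_of_pow hν0 hν ((by positivity : 0 ≤ omega K / s).trans hμ.le) hn ?_
  refine le_trans (opNormWrt_le hν (by positivity) fun x => ?_) h1
  rw [inv_pow, ← mul_assoc, mul_assoc, inv_mul_eq_div, ← mul_div_assoc, le_div_iff₀ (pow_pos hs n)]
  exact h n x

end ResidueChar

/-! ### The spectral norm of the derivation of `K` -/

/-- Leibniz solved for the first argument: moving `tA` off it is the difference of applying `tH`
outside and `tB` to the second argument. These two operations commute, so the binomial theorem
applies. -/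
theorem pairing_iterate {A B H : Type*} [AddCommGroup A] [AddCommGroup B] [AddCommGroup H]
    (b : A →+ B →+ H) (tA : A → A) (tB : B → B) (tH : H →+ H)
    (h : ∀ x y, tH (b x y) = b (tA x) y + b x (tB y)) (n : ℕ) (x : A) (y : B) :
    b (tA^[n] x) y = ∑ ij ∈ Finset.HasAntidiagonal.antidiagonal n,
      n.choose ij.1 • (tH^[ij.1] ((-1 : ℤ) ^ ij.2 • b x (tB^[ij.2] y))) := by
  induction n generalizing y with
  | zero => simp
  | succ n ih =>
    rw [Finset.sum_antidiagonal_choose_succ_nsmul (M := H)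
      (fun i j => tH^[i] ((-1 : ℤ) ^ j • b x (tB^[j] y))) n, Function.iterate_succ_apply',
      ← add_sub_cancel_right (b (tA (tA^[n] x)) y) (b (tA^[n] x) (tB y)), ← h, ih y, ih (tB y),
      map_sum, sub_eq_add_neg, add_comm, ← Finset.sum_neg_distrib]
    congr 1
    · refine Finset.sum_congr rfl fun ij _ => ?_
      rw [← smul_neg, ← iterate_map_neg, Function.iterate_succ_apply, pow_succ, mul_neg_one,
        neg_smul]
    · refine Finset.sum_congr rfl fun ij hij => ?_
      have hij' : ij.1 + ij.2 = n := Finset.HasAntidiagonal.mem_antidiagonal.1 hij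
      rw [map_nsmul, Function.iterate_succ_apply', n.choose_symm_of_eq_add hij'.symm]

/-! ### Multiplicativity of the Gauss norm on power series. -/

section Ultrametric

theorem norm_sum_le_of_forall {E : Type*} [SeminormedAddCommGroup E] [IsUltrametricDist E]
    {ι : Type*} {s : Finset ι} {f : ι → E} {B : ℝ} (hB : 0 ≤ B) (h : ∀ i ∈ s, ‖f i‖ ≤ B) :
    ‖∑ i ∈ s, f i‖ ≤ B :=
  IsUltrametricDist.norm_sum_le_of_forall_le_of_nonneg hB h

variable {K : Type u} [NontriviallyNormedField K] [IsUltrametricDist K]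

/-- `N` is the last index at which `|a_i| t^i` takes its maximal value `A`. -/
def IsLastMax (t : ℝ) (a : K⟦X⟧) (A : ℝ) (N : ℕ) : Prop :=
  (∀ i, ‖PowerSeries.coeff i a‖ * t ^ i ≤ A) ∧ ‖PowerSeries.coeff N a‖ * t ^ N = A ∧
    ∀ i, N < i → ‖PowerSeries.coeff i a‖ * t ^ i < A

/-- In degree `N + M` every product other than `a_N b_M` has a factor beyond its last maximum and is
strictly smaller, so the ultrametric inequality excludes cancellation. -/
theorem IsLastMax.mul {t : ℝ} (ht : 0 < t) {a b : K⟦X⟧} {A B : ℝ} {N M : ℕ} (hA : 0 < A)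
    (hB : 0 < B) (ha : IsLastMax t a A N) (hb : IsLastMax t b B M) :
    IsLastMax t (a * b) (A * B) (N + M) := by
  have hterm : ∀ i j, ‖PowerSeries.coeff i a * PowerSeries.coeff j b‖ * t ^ (i + j) =
      (‖PowerSeries.coeff i a‖ * t ^ i) * (‖PowerSeries.coeff j b‖ * t ^ j) := fun i j => by
    rw [norm_mul, pow_add]; ring
  have hlt : ∀ i j, N < i ∨ M < j →
      ‖PowerSeries.coeff i a * PowerSeries.coeff j b‖ * t ^ (i + j) < A * B := by
    rintro i j (h | h) <;> rw [hterm]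
    · exact (mul_le_mul_of_nonneg_left (hb.1 j) (by positivity)).trans_lt
        (mul_lt_mul_of_pos_right (ha.2.2 i h) hB)
    · exact (mul_le_mul_of_nonneg_right (ha.1 i) (by positivity)).trans_lt
        (mul_lt_mul_of_pos_left (hb.2.2 j h) hA)
  have hsum : ∀ (S : Finset (ℕ × ℕ)) (k : ℕ), (∀ ij ∈ S, ij.1 + ij.2 = k ∧ (N < ij.1 ∨ M < ij.2)) →
      ‖∑ ij ∈ S, PowerSeries.coeff ij.1 a * PowerSeries.coeff ij.2 b‖ * t ^ k < A * B := by
    intro S k hS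
    rw [← lt_div_iff₀ (pow_pos ht k)]
    rcases S.eq_empty_or_nonempty with rfl | hne
    · simpa using by positivity
    · obtain ⟨ij, hij, hle⟩ := IsUltrametricDist.exists_norm_finsetSum_le_of_nonempty hne
        (fun ij : ℕ × ℕ => PowerSeries.coeff ij.1 a * PowerSeries.coeff ij.2 b)
      refine hle.trans_lt ?_
      rw [lt_div_iff₀ (pow_pos ht k), ← (hS ij hij).1]
      exact hlt _ _ (hS ij hij).2
  refine ⟨fun k => ?_, ?_, fun k hk => ?_⟩
  · rw [PowerSeries.coeff_mul, ← le_div_iff₀ (pow_pos ht k)]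
    refine norm_sum_le_of_forall (by positivity) fun ij hij => ?_
    rw [le_div_iff₀ (pow_pos ht k), ← Finset.HasAntidiagonal.mem_antidiagonal.1 hij, hterm]
    exact mul_le_mul (ha.1 _) (hb.1 _) (by positivity) hA.le
  · have hmem : (N, M) ∈ Finset.HasAntidiagonal.antidiagonal (N + M) := by simp
    have h1 := hsum ((Finset.HasAntidiagonal.antidiagonal (N + M)).erase (N, M)) (N + M)
      fun ij hij => by
        rw [Finset.mem_erase, Finset.HasAntidiagonal.mem_antidiagonal] at hij
        refine ⟨hij.2, ?_⟩
        by_contra! h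
        exact hij.1 (Prod.ext (by omega) (by omega))
    have h2 : ‖PowerSeries.coeff N a * PowerSeries.coeff M b‖ * t ^ (N + M) = A * B := by
      rw [hterm, ha.2.1, hb.2.1]
    rw [PowerSeries.coeff_mul, ← Finset.add_sum_erase _ _ hmem,
      IsUltrametricDist.norm_add_eq_max_of_norm_ne_norm, max_eq_left, h2]
    · rw [← h2] at h1
      exact (lt_of_mul_lt_mul_right h1 (by positivity)).le
    · rintro h
      rw [← h2, ← h] at h1
      exact lt_irrefl _ h1
  · rw [PowerSeries.coeff_mul]
    refine hsum _ k fun ij hij => ?_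
    rw [Finset.HasAntidiagonal.mem_antidiagonal] at hij
    exact ⟨hij, by omega⟩

theorem IsLastMax.pow {t : ℝ} (ht : 0 < t) {a : K⟦X⟧} {A : ℝ} {N : ℕ} (hA : 0 < A)
    (ha : IsLastMax t a A N) (n : ℕ) : IsLastMax t (a ^ n) (A ^ n) (n * N) := by
  induction n with
  | zero =>
    refine ⟨fun i => ?_, by simp, fun i hi => ?_⟩
    · rw [pow_zero, pow_zero, PowerSeries.coeff_one]
      split_ifs with h
      · simp [h]
      · simp
    · rw [pow_zero, pow_zero, PowerSeries.coeff_one, if_neg (by omega)]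
      simp
  | succ n ih => rw [pow_succ, pow_succ, Nat.succ_mul]; exact ih.mul ht (pow_pos hA n) hA ha

theorem exists_isLastMax {t : ℝ} {a : K⟦X⟧}
    (h : Filter.Tendsto (fun i => ‖PowerSeries.coeff i a‖ * t ^ i) Filter.atTop (nhds 0)) {i₀ : ℕ}
    (h0 : 0 < ‖PowerSeries.coeff i₀ a‖ * t ^ i₀) :
    ∃ A N, IsLastMax t a A N ∧ ‖PowerSeries.coeff i₀ a‖ * t ^ i₀ ≤ A := by
  set u : ℕ → ℝ := fun i => ‖PowerSeries.coeff i a‖ * t ^ i with hu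
  obtain ⟨n₀, hn₀⟩ := Filter.eventually_atTop.1 (h.eventually (gt_mem_nhds h0))
  have hi₀ : i₀ < n₀ := by
    by_contra! hle
    exact lt_irrefl _ (hn₀ i₀ hle)
  obtain ⟨m, hm, hmax⟩ := Finset.exists_max_image (Finset.range n₀) u ⟨i₀, Finset.mem_range.2 hi₀⟩
  have hmA : u i₀ ≤ u m := hmax _ (Finset.mem_range.2 hi₀)
  obtain ⟨N, hN, hlast⟩ := Finset.exists_max_image ((Finset.range n₀).filter fun i => u i = u m) id
    ⟨m, Finset.mem_filter.2 ⟨hm, rfl⟩⟩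
  rw [Finset.mem_filter] at hN
  have hall : ∀ i, u i ≤ u m := fun i => by
    rcases lt_or_ge i n₀ with hi | hi
    · exact hmax _ (Finset.mem_range.2 hi)
    · exact (hn₀ i hi).le.trans hmA
  refine ⟨u m, N, ⟨hall, hN.2, fun i hi => lt_of_le_of_ne (hall i) fun heq => ?_⟩, hmA⟩
  have hin : i < n₀ := by
    by_contra! hle
    exact absurd (hn₀ i hle) (not_lt.2 (hmA.trans_eq heq.symm))
  exact absurd (hlast i (Finset.mem_filter.2 ⟨Finset.mem_range.2 hin, heq⟩)) (not_le.2 hi)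

end Ultrametric

/-! ### Taylor coefficients of a bounded derivation. -/

section Derivation

variable {K : Type u} [NontriviallyNormedField K] [IsUltrametricDist K] [CharZero K]
  (hp : 0 < residueChar K) (d : Derivation ℤ K K) [IsBoundedDerivation d]

theorem exists_bound_nonneg : ∃ B : ℝ, 0 ≤ B ∧ ∀ x, ‖d x‖ ≤ B * ‖x‖ := by
  obtain ⟨B, hB⟩ := IsBoundedDerivation.exists_bound (d := d)
  exact ⟨|B|, abs_nonneg B, fun x =>
    (hB x).trans (mul_le_mul_of_nonneg_right (le_abs_self B) (norm_nonneg x))⟩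

theorem specNormWrt_derivation_nonneg : 0 ≤ specNormWrt (fun x : K => ‖x‖) d :=
  specNormWrt_nonneg norm_zero (fun _ => norm_pos_iff.2) _

include hp

theorem exists_norm_divPow_le_of_specNormWrt_lt {s : ℝ} (hs : 0 < s)
    (h : specNormWrt (fun x : K => ‖x‖) d < omega K / s) :
    ∃ C : ℝ, 0 < C ∧ ∀ (i : ℕ) (c : K), ‖d^[i] c / (i.factorial : K)‖ * s ^ i ≤ C * ‖c‖ := by
  obtain ⟨B, hB, hd⟩ := exists_bound_nonneg d
  obtain ⟨C, hC, hb⟩ := exists_iterate_le_of_specNormWrt_lt norm_zero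
    (fun _ => norm_pos_iff.2) hB hd h
  refine ⟨C, hC, fun i c => ?_⟩
  have hω := omega_pos hp
  have hi : (0 : ℝ) < ‖(i.factorial : K)‖ := norm_pos_iff.2 (Nat.cast_ne_zero.2 i.factorial_ne_zero)
  rw [norm_div, div_mul_eq_mul_div, div_le_iff₀ hi]
  calc ‖d^[i] c‖ * s ^ i ≤ C * (omega K / s) ^ i * ‖c‖ * s ^ i := by
        gcongr; exact hb i c
    _ = C * ‖c‖ * omega K ^ i := by rw [div_pow]; field_simp
    _ ≤ C * ‖c‖ * ‖(i.factorial : K)‖ := by gcongr; exact omega_pow_le_norm_factorial hp i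

/-- A Liouville argument. If the spectral norm vanished, the Taylor series `g(c)` would converge on
every disc. The Taylor map is multiplicative, so the Gauss norm `A` of `g(c)` at radius `t` would
satisfy `A^n ≤ C |c|^n` for all `n`, hence `A ≤ |c|`. But `t` is chosen so that the linear
coefficient alone contributes `|c| + 1`. Without this lemma `rad d` could be a division by zero. -/
theorem specNormWrt_derivation_pos (hd : d ≠ 0) : 0 < specNormWrt (fun x : K => ‖x‖) d := by
  refine lt_of_le_of_ne (specNormWrt_derivation_nonneg d) fun h0 => hd ?_
  ext c
  rw [Derivation.zero_apply]
  by_contra hc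
  have hdc : 0 < ‖d c‖ := norm_pos_iff.2 hc
  set t : ℝ := (‖c‖ + 1) / ‖d c‖ with ht
  have ht0 : 0 < t := by positivity
  -- The bound is taken at `2 * t` so that at radius `t` the terms decay like `2⁻ⁱ` and a last
  -- maximum exists.
  obtain ⟨C, hC, hb⟩ := exists_norm_divPow_le_of_specNormWrt_lt hp d (s := 2 * t) (by positivity)
    (h0 ▸ div_pos (omega_pos hp) (by positivity))
  have hcoef : ∀ (n i : ℕ), ‖PowerSeries.coeff i (taylorHom d c ^ n)‖ * t ^ i ≤
      C * ‖c‖ ^ n * (1 / 2) ^ i := fun n i => by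
    have := hb i (c ^ n)
    rw [norm_pow, mul_pow] at this
    rw [← map_pow, coeff_taylorHom, one_div, inv_pow, ← div_eq_mul_inv, le_div_iff₀ (by positivity)]
    linarith
  have hlim : Filter.Tendsto (fun i => ‖PowerSeries.coeff i (taylorHom d c)‖ * t ^ i)
      Filter.atTop (nhds 0) := by
    refine squeeze_zero (fun i => by positivity) (fun i => ?_) (g := fun i : ℕ =>
      C * ‖c‖ ^ 1 * (1 / 2) ^ i) ?_
    · simpa using hcoef 1 i
    · rw [← mul_zero (C * ‖c‖ ^ 1)]
      exact (tendsto_pow_atTop_nhds_zero_of_lt_one (by norm_num) (by norm_num)).const_mul _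
  have h1 : ‖PowerSeries.coeff 1 (taylorHom d c)‖ * t ^ 1 = ‖c‖ + 1 := by
    rw [coeff_taylorHom]
    simp only [Function.iterate_one, Nat.factorial_one, Nat.cast_one, div_one, pow_one, ht]
    field_simp
  obtain ⟨A, N, hA, hle⟩ := exists_isLastMax hlim (i₀ := 1) (by rw [h1]; positivity)
  rw [h1] at hle
  have hA0 : 0 < A := by linarith [norm_nonneg c]
  have hpow : ∀ n : ℕ, A ^ n ≤ C * ‖c‖ ^ n := fun n => by
    rw [← (hA.pow ht0 hA0 n).2.1]
    refine (hcoef n _).trans (mul_le_of_le_one_right (by positivity) ?_)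
    exact pow_le_one₀ (by norm_num) (by norm_num)
  have hlim2 : Filter.Tendsto (fun n : ℕ => C * (‖c‖ / A) ^ n) Filter.atTop (nhds 0) := by
    rw [← mul_zero C]
    exact (tendsto_pow_atTop_nhds_zero_of_lt_one (by positivity)
      ((div_lt_one hA0).2 (by linarith))).const_mul _
  obtain ⟨n, hn⟩ := (hlim2.eventually (gt_mem_nhds one_pos)).exists
  rw [div_pow, ← mul_div_assoc, div_lt_one (pow_pos hA0 n)] at hn
  exact absurd (hpow n) (not_le.2 hn)

theorem exists_norm_divPow_le (hd : d ≠ 0) {s : ℝ} (hs : 0 < s) (h : s < rad d) :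
    ∃ C : ℝ, 0 < C ∧ ∀ (i : ℕ) (c : K), ‖d^[i] c / (i.factorial : K)‖ * s ^ i ≤ C * ‖c‖ := by
  refine exists_norm_divPow_le_of_specNormWrt_lt hp d hs ?_
  rw [rad, lt_div_comm₀ hs (specNormWrt_derivation_pos hp d hd)] at h
  exact h

end Derivation

/-! ### The norm attached to a basis -/

section BasisNorm

variable {K : Type u} [NontriviallyNormedField K] [IsUltrametricDist K]
  {M : Type v} [AddCommGroup M] [Module K M] [FiniteDimensional K M]

theorem norm_repr_le_basisNorm (x : M) (i : Module.Basis.ofVectorSpaceIndex K M) :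
    ‖(Module.Basis.ofVectorSpace K M).repr x i‖ ≤ basisNorm K M x :=
  le_ciSup (f := fun i => ‖(Module.Basis.ofVectorSpace K M).repr x i‖)
    (Set.finite_range _).bddAbove i

theorem basisNorm_nonneg (x : M) : 0 ≤ basisNorm K M x := Real.iSup_nonneg fun _ => norm_nonneg _

theorem basisNorm_le {x : M} {B : ℝ} (hB : 0 ≤ B)
    (h : ∀ i, ‖(Module.Basis.ofVectorSpace K M).repr x i‖ ≤ B) : basisNorm K M x ≤ B :=
  Real.iSup_le h hB

theorem basisNorm_zero : basisNorm K M 0 = 0 :=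
  le_antisymm (basisNorm_le le_rfl fun i => by simp) (basisNorm_nonneg _)

theorem basisNorm_pos (x : M) (hx : x ≠ 0) : 0 < basisNorm K M x := by
  refine lt_of_le_of_ne (basisNorm_nonneg x) fun h => hx ?_
  refine (Module.Basis.ofVectorSpace K M).ext_elem fun i => ?_
  have := norm_repr_le_basisNorm (K := K) x i
  rw [← h] at this
  simpa using this

theorem basisNorm_add_le {x y : M} {B : ℝ} (hx : basisNorm K M x ≤ B) (hy : basisNorm K M y ≤ B) :
    basisNorm K M (x + y) ≤ B := by
  refine basisNorm_le ((basisNorm_nonneg x).trans hx) fun i => ?_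
  rw [map_add, Finsupp.add_apply]
  exact (IsUltrametricDist.norm_add_le_max _ _).trans
    (max_le ((norm_repr_le_basisNorm x i).trans hx) ((norm_repr_le_basisNorm y i).trans hy))

theorem basisNorm_sum_le {ι : Type*} {s : Finset ι} {f : ι → M} {B : ℝ} (hB : 0 ≤ B)
    (h : ∀ i ∈ s, basisNorm K M (f i) ≤ B) : basisNorm K M (∑ i ∈ s, f i) ≤ B :=
  Finset.sum_induction f (fun x => basisNorm K M x ≤ B) (fun _ _ => basisNorm_add_le)
    (basisNorm_zero.trans_le hB) h

theorem basisNorm_smul (c : K) (x : M) : basisNorm K M (c • x) = ‖c‖ * basisNorm K M x := by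
  rw [basisNorm, basisNorm, Real.mul_iSup_of_nonneg (norm_nonneg c)]
  simp

theorem exists_norm_le_basisNorm (χ : M →ₗ[K] K) :
    ∃ C : ℝ, 0 < C ∧ ∀ x, ‖χ x‖ ≤ C * basisNorm K M x := by
  set b := Module.Basis.ofVectorSpace K M
  refine ⟨∑ i, ‖χ (b i)‖ + 1, by positivity, fun x => ?_⟩
  conv_lhs => rw [← b.sum_repr x, map_sum]
  have hC : (0 : ℝ) ≤ ∑ i, ‖χ (b i)‖ + 1 := by positivity
  refine norm_sum_le_of_forall (mul_nonneg hC (basisNorm_nonneg _)) fun i _ => ?_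
  rw [map_smul, smul_eq_mul, norm_mul, mul_comm]
  refine mul_le_mul ?_ (norm_repr_le_basisNorm x i) (norm_nonneg _) hC
  have := Finset.single_le_sum (f := fun i => ‖χ (b i)‖) (fun _ _ => norm_nonneg _)
    (Finset.mem_univ i)
  linarith

variable {M' : Type w} [AddCommGroup M'] [Module K M'] [FiniteDimensional K M']

theorem exists_basisNorm_map_le (f : M →ₗ[K] M') :
    ∃ C : ℝ, 0 < C ∧ ∀ x, basisNorm K M' (f x) ≤ C * basisNorm K M x := by
  set b := Module.Basis.ofVectorSpace K M'
  choose C hC hb using fun i => exists_norm_le_basisNorm (b.coord i ∘ₗ f)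
  refine ⟨∑ i, C i + 1, add_pos_of_nonneg_of_pos (Finset.sum_nonneg fun i _ => (hC i).le) one_pos,
    fun x => basisNorm_le (mul_nonneg (add_nonneg (Finset.sum_nonneg fun i _ => (hC i).le)
      zero_le_one) (basisNorm_nonneg _)) fun i => (hb i x).trans ?_⟩
  refine mul_le_mul_of_nonneg_right ?_ (basisNorm_nonneg _)
  have := Finset.single_le_sum (f := C) (fun i _ => (hC i).le) (Finset.mem_univ i)
  linarith


end BasisNorm

/-! ### Divided powers of `T` -/

section DivPow

variable {K : Type u} [NontriviallyNormedField K] [IsUltrametricDist K] [CharZero K]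
  (d : Derivation ℤ K K) {M : Type v} [AddCommGroup M] [Module K M]
  [Module (TwistedPoly d) M] [IsScalarTower K (TwistedPoly d) M]

/-- The divided power `x ↦ (1/n!) Tⁿ x`. -/
def divT (n : ℕ) : M →+ M where
  toFun x := ((n.factorial : K)⁻¹) • T d ^ n • x
  map_zero' := by simp
  map_add' x y := by simp

theorem divT_apply (n : ℕ) (x : M) : divT d n x = ((n.factorial : K)⁻¹) • T d ^ n • x := rfl

theorem divT_zero (x : M) : divT d 0 x = x := by simp [divT_apply]

theorem natCast_factorial_ne_zero (n : ℕ) : (n.factorial : K) ≠ 0 :=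
  Nat.cast_ne_zero.2 n.factorial_ne_zero

theorem T_pow_smul_eq (n : ℕ) (x : M) : T d ^ n • x = (n.factorial : K) • divT d n x := by
  rw [divT_apply, smul_smul, mul_inv_cancel₀ (natCast_factorial_ne_zero n), one_smul]

theorem divT_smul (n : ℕ) (c : K) (x : M) :
    divT d n (c • x) = ∑ ij ∈ Finset.HasAntidiagonal.antidiagonal n,
      (d^[ij.1] c / (ij.1.factorial : K)) • divT d ij.2 x := by
  have h := divPow_leibniz d (A := M) (Module.toAddMonoidEnd (TwistedPoly d) M (T d))
    (fun r x => T_smul_smul r x) n c x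
  have hT : ∀ (n : ℕ) (y : M),
      (Module.toAddMonoidEnd (TwistedPoly d) M (T d) ^ n) y = T d ^ n • y := fun n y => by
    rw [← map_pow]; rfl
  simp only [hT] at h
  exact h

theorem T_pow_smul_natCast_inv_smul (n k : ℕ) (x : M) :
    T d ^ n • (k.factorial : K)⁻¹ • x = (k.factorial : K)⁻¹ • T d ^ n • x := by
  induction n with
  | zero => simp
  | succ n ih =>
    rw [pow_succ', mul_smul, ih, T_smul_smul, d_inv_factorial, zero_smul, add_zero, mul_smul]

theorem divT_divT (i j : ℕ) (x : M) :
    divT d i (divT d j x) = ((i + j).choose i : K) • divT d (i + j) x := by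
  rw [divT_apply, divT_apply, divT_apply, T_pow_smul_natCast_inv_smul, smul_smul, smul_smul,
    smul_smul, ← pow_add]
  congr 1
  have h1 := natCast_factorial_ne_zero (K := K) i
  have h2 := natCast_factorial_ne_zero (K := K) j
  have h3 := natCast_factorial_ne_zero (K := K) (i + j)
  have h4 : ((i + j).choose i : K) * i.factorial * j.factorial = (i + j).factorial := by
    rw [Nat.choose_symm_add]
    exact_mod_cast Nat.add_choose_mul_factorial_mul_factorial i j
  field_simp
  rw [← h4]; ring

theorem divT_T_smul (n : ℕ) (x : M) :
    divT d n (T d • x) = ((n + 1 : ℕ) : K) • divT d (n + 1) x := by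
  have := divT_divT d n 1 x
  simpa [divT_apply] using this

variable {d} in
theorem map_divT {N : Type w} [AddCommGroup N] [Module K N] [Module (TwistedPoly d) N]
    [IsScalarTower K (TwistedPoly d) N] (f : M →ₗ[TwistedPoly d] N) (n : ℕ) (x : M) :
    f (divT d n x) = divT d n (f x) := by
  simp only [divT_apply, smul_def (d := d), map_smul]

theorem divT_mem (N : Submodule (TwistedPoly d) M) {x : M} (hx : x ∈ N) (n : ℕ) :
    divT d n x ∈ N := by
  rw [divT_apply, smul_def (d := d)]
  exact N.smul_mem _ (N.smul_mem _ hx)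

theorem C_smul_mem (N : Submodule (TwistedPoly d) M) {x : M} (hx : x ∈ N) (c : K) :
    c • x ∈ N := by
  rw [smul_def (d := d)]
  exact N.smul_mem _ hx

variable {d} in
/-- A subgroup stable under scalars from `K` and under `T`, as a submodule. -/
def submoduleOfStable (S : AddSubgroup M) (hC : ∀ (c : K), ∀ x ∈ S, c • x ∈ S)
    (hT : ∀ x ∈ S, T d • x ∈ S) : Submodule (TwistedPoly d) M where
  __ := S
  smul_mem' p x hx := by
    change p • x ∈ S
    induction p using induction_mono with
    | hadd p q hp hq => rw [add_smul]; exact S.add_mem hp hq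
    | hmono i c =>
      rw [monomial_eq, mul_smul, ← smul_def]
      refine hC c _ ?_
      induction i with
      | zero => simpa using hx
      | succ i ih => rw [pow_succ', mul_smul]; exact hT _ ih

end DivPow

/-! ### Convergence of subquotients -/

section Convergence

variable {K : Type u} [NontriviallyNormedField K] [IsUltrametricDist K] [CharZero K]
  (d : Derivation ℤ K K)

/-- The divided powers of the derivation satisfy `|dⁱ/i!| = O(s⁻ⁱ)` for all `0 < s < R`. -/
def TaylorBounded (R : ℝ) : Prop := ∀ s : ℝ, 0 < s → s < R →
  ∃ C : ℝ, 0 < C ∧ ∀ (i : ℕ) (c : K), ‖d^[i] c / (i.factorial : K)‖ * s ^ i ≤ C * ‖c‖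

variable {M : Type v} [AddCommGroup M] [Module K M]
  [Module (TwistedPoly d) M] [IsScalarTower K (TwistedPoly d) M]

/-- The sequence `|χ((1/i!) Tⁱ x)| sⁱ` is bounded. -/
def BddDivT (s : ℝ) (χ : M →ₗ[K] K) (x : M) : Prop :=
  ∃ C : ℝ, ∀ i, ‖χ (divT d i x)‖ * s ^ i ≤ C

/-- The subquotient `B / A` of `M` converges at `s`: the sequences `|χ((1/i!) Tⁱ x)| sⁱ` are
bounded for all linear forms `χ` that vanish on `A` and all `x ∈ B`. -/
def ConvOn (s : ℝ) (A B : Submodule (TwistedPoly d) M) : Prop :=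
  ∀ χ : M →ₗ[K] K, (∀ a ∈ A, χ a = 0) → ∀ b ∈ B, BddDivT d s χ b

/-- The subquotient `B / A` has radius at least `r`. -/
def RadGE (r : ℝ) (A B : Submodule (TwistedPoly d) M) : Prop :=
  ∀ s : ℝ, 0 < s → s < r → ConvOn d s A B

/-- All nonzero subquotients of `B / A` have radius less than `r`. -/
def RadLT (r : ℝ) (A B : Submodule (TwistedPoly d) M) : Prop :=
  ∀ X Y : Submodule (TwistedPoly d) M, A ≤ X → X < Y → Y ≤ B → ¬ RadGE d r X Y

variable {d}

/-! ### Stability of boundedness under sums, scalars and `T`. -/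

section Bdd

variable {s : ℝ} {χ : M →ₗ[K] K} {x y : M}

theorem BddDivT.add (hs : 0 < s) (hx : BddDivT d s χ x) (hy : BddDivT d s χ y) :
    BddDivT d s χ (x + y) := by
  obtain ⟨C, hC⟩ := hx
  obtain ⟨D, hD⟩ := hy
  refine ⟨C + D, fun i => ?_⟩
  rw [map_add, map_add]
  refine (mul_le_mul_of_nonneg_right (norm_add_le _ _) (pow_pos hs i).le).trans ?_
  rw [add_mul]
  exact add_le_add (hC i) (hD i)

theorem BddDivT.T_smul (hs : 0 < s) (hx : BddDivT d s χ x) : BddDivT d s χ (T d • x) := by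
  obtain ⟨C, hC⟩ := hx
  refine ⟨C / s, fun i => ?_⟩
  rw [divT_T_smul, map_smul, smul_eq_mul, norm_mul, le_div_iff₀ hs, mul_assoc, mul_assoc,
    ← pow_succ]
  exact (mul_le_of_le_one_left (by positivity) (norm_natCast_le_one' _)).trans (hC (i + 1))

/-- For divided powers the Leibniz rule is a plain convolution without binomial coefficients; an
ultrametric convolution of two bounded sequences is bounded by the product of the bounds. -/
theorem norm_divT_smul_le {D C : ℝ} (hs : 0 < s)
    (hD : ∀ (i : ℕ) (c : K), ‖d^[i] c / (i.factorial : K)‖ * s ^ i ≤ D * ‖c‖)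
    (hD0 : 0 ≤ D) (hC0 : 0 ≤ C) (hC : ∀ i, ‖χ (divT d i x)‖ * s ^ i ≤ C) (c : K) (n : ℕ) :
    ‖χ (divT d n (c • x))‖ * s ^ n ≤ D * C * ‖c‖ := by
  rw [divT_smul, map_sum, ← le_div_iff₀ (pow_pos hs n)]
  refine norm_sum_le_of_forall (by positivity) fun ij hij => ?_
  rw [le_div_iff₀ (pow_pos hs n), ← Finset.HasAntidiagonal.mem_antidiagonal.1 hij, map_smul,
    smul_eq_mul, norm_mul, pow_add]
  calc _ = (‖d^[ij.1] c / (ij.1.factorial : K)‖ * s ^ ij.1) * (‖χ (divT d ij.2 x)‖ * s ^ ij.2) := by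
        ring
    _ ≤ (D * ‖c‖) * C := mul_le_mul (hD _ _) (hC _) (by positivity) (by positivity)
    _ = _ := by ring

theorem BddDivT.smul {R : ℝ} (hR : TaylorBounded d R) (hs : 0 < s) (hsR : s < R)
    (hx : BddDivT d s χ x) (c : K) : BddDivT d s χ (c • x) := by
  obtain ⟨C, hC⟩ := hx
  obtain ⟨D, hD0, hD⟩ := hR s hs hsR
  have hC0 : 0 ≤ C := le_trans (by positivity) (hC 0)
  exact ⟨_, norm_divT_smul_le hs hD hD0.le hC0 hC c⟩

theorem bddDivT_zero : BddDivT d s χ 0 := ⟨0, fun i => by simp⟩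

end Bdd

/-! ### Subquotients as intervals in the modular lattice of submodules. -/

section Interval

variable {s r : ℝ} {A B C A' B' : Submodule (TwistedPoly d) M}

/-- The restriction of `ψ` to `W` factors through the image of `W` in `M / V`, and a form on a
subspace of `M / V` extends to all of it. -/
theorem exists_linearMap_eqOn_of_vanish (W V : Submodule K M) (ψ : M →ₗ[K] K)
    (h : ∀ x ∈ W, x ∈ V → ψ x = 0) :
    ∃ χ : M →ₗ[K] K, (∀ x ∈ W, χ x = ψ x) ∧ ∀ x ∈ V, χ x = 0 := by
  let f : W →ₗ[K] (M ⧸ V) := V.mkQ ∘ₗ W.subtype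
  have hker : f.ker ≤ (ψ ∘ₗ W.subtype).ker := fun x hx => by
    rw [LinearMap.mem_ker] at hx ⊢
    exact h x x.2 ((Submodule.Quotient.mk_eq_zero V).1 hx)
  obtain ⟨g, hg⟩ := LinearMap.exists_extend (f.ker.liftQ (ψ ∘ₗ W.subtype) hker ∘ₗ
    f.quotKerEquivRange.symm.toLinearMap)
  refine ⟨g ∘ₗ V.mkQ, fun x hx => ?_, fun x hx => ?_⟩
  · have h1 := LinearMap.congr_fun hg ⟨f ⟨x, hx⟩, ⟨_, rfl⟩⟩
    change g (V.mkQ x) = _ at h1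
    rw [LinearMap.comp_apply, h1, LinearMap.comp_apply, LinearEquiv.coe_coe]
    have : f.quotKerEquivRange.symm ⟨f ⟨x, hx⟩, ⟨_, rfl⟩⟩ = f.ker.mkQ ⟨x, hx⟩ := by
      rw [LinearEquiv.symm_apply_eq]; rfl
    rw [this]; rfl
  · rw [LinearMap.comp_apply, Submodule.mkQ_apply, (Submodule.Quotient.mk_eq_zero V).2 hx, map_zero]

theorem ConvOn.mono (h : ConvOn d s A B) (hA : A ≤ A') (hB : B' ≤ B) : ConvOn d s A' B' :=
  fun χ hχ b hb => h χ (fun a ha => hχ a (hA ha)) b (hB hb)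

/-- The component in `X` contributes nothing: `X` is stable under divided powers and the form kills
it. -/
theorem ConvOn.sup (hs : 0 < s) (h : ConvOn d s A B) (X : Submodule (TwistedPoly d) M) :
    ConvOn d s (A ⊔ X) (B ⊔ X) := by
  intro χ hχ b hb
  obtain ⟨y, hy, z, hz, rfl⟩ := Submodule.mem_sup.1 hb
  refine (h χ (fun a ha => hχ a (Submodule.mem_sup_left ha)) y hy).add hs ⟨0, fun i => ?_⟩
  rw [hχ _ (Submodule.mem_sup_right (divT_mem d X hz i))]
  simp

theorem ConvOn.inf (h : ConvOn d s A B) (X : Submodule (TwistedPoly d) M) :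
    ConvOn d s (A ⊓ X) (B ⊓ X) := by
  intro ψ hψ b hb
  obtain ⟨χ, h1, h2⟩ := exists_linearMap_eqOn_of_vanish (X.restrictScalars K)
    (A.restrictScalars K) ψ fun x hx hx' => hψ x ⟨hx', hx⟩
  obtain ⟨C, hC⟩ := h χ h2 b hb.1
  refine ⟨C, fun i => ?_⟩
  rw [← h1 _ (divT_mem d X hb.2 i)]
  exact hC i

theorem RadGE.mono (h : RadGE d r A B) (hA : A ≤ A') (hB : B' ≤ B) : RadGE d r A' B' :=
  fun s hs hr => (h s hs hr).mono hA hB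

theorem RadGE.sup (h : RadGE d r A B) (X : Submodule (TwistedPoly d) M) :
    RadGE d r (A ⊔ X) (B ⊔ X) := fun s hs hr => (h s hs hr).sup hs X

theorem RadGE.inf (h : RadGE d r A B) (X : Submodule (TwistedPoly d) M) :
    RadGE d r (A ⊓ X) (B ⊓ X) := fun s hs hr => (h s hs hr).inf X

theorem radGE_bot : RadGE d r (⊥ : Submodule (TwistedPoly d) M) ⊥ := fun s _ _ χ hχ b hb => by
  rw [(Submodule.mem_bot _).1 hb]
  exact bddDivT_zero

theorem RadLT.mono (h : RadLT d r A B) (hA : A ≤ A') (hB : B' ≤ B) : RadLT d r A' B' :=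
  fun X Y h1 h2 h3 => h X Y (hA.trans h1) h2 (h3.trans hB)

theorem radLT_self : RadLT d r A A := fun _ _ h1 h2 h3 =>
  absurd (h1.trans_lt (h2.trans_le h3)) (lt_irrefl _)

/-- By modularity a strict inclusion `X < Y` stays strict after intersecting with `B` or after
adding `B`. A subquotient of radius at least `r` therefore leaves a nonzero trace of that kind in `B
/ A` or in `C / B`. -/
theorem RadLT.trans (h1 : RadLT d r A B) (h2 : RadLT d r B C) (hAB : A ≤ B) (hBC : B ≤ C) :
    RadLT d r A C := by
  intro X Y hAX hXY hYC hGE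
  by_cases h : X ⊓ B < Y ⊓ B
  · exact h1 _ _ (le_inf hAX hAB) h inf_le_right (hGE.inf B)
  · refine h2 (X ⊔ B) (Y ⊔ B) le_sup_right (lt_of_le_of_ne (sup_le_sup_right hXY.le B) fun heq => ?_)
      (sup_le hYC hBC) (hGE.sup B)
    refine hXY.ne (eq_of_le_of_inf_le_of_sup_le hXY.le (z := B) ?_ heq.ge)
    have := eq_of_le_of_not_lt (inf_le_inf_right B hXY.le) h
    exact this.ge

/-- Intersecting with `B` is injective on chains between `A ⊔ X` and `B ⊔ X`, so a bad subquotient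
would reappear inside `B / A`. For `RadLT.inf` the same is done by adding `A`. -/
theorem RadLT.sup (h : RadLT d r A B) (hAB : A ≤ B) (X : Submodule (TwistedPoly d) M) :
    RadLT d r (A ⊔ X) (B ⊔ X) := by
  intro Y Z hY hYZ hZ hGE
  have hXY : X ≤ Y := le_sup_right.trans hY
  refine h (Y ⊓ B) (Z ⊓ B) (le_inf (le_sup_left.trans hY) hAB)
    (lt_of_le_of_ne (inf_le_inf_right B hYZ.le) fun heq => ?_) inf_le_right (hGE.inf B)
  refine hYZ.ne (eq_of_le_of_inf_le_of_sup_le hYZ.le (z := B) heq.ge ?_)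
  exact sup_le (hZ.trans (sup_le le_sup_right (hXY.trans le_sup_left))) le_sup_right

theorem RadLT.inf (h : RadLT d r A B) (hAB : A ≤ B) (X : Submodule (TwistedPoly d) M) :
    RadLT d r (A ⊓ X) (B ⊓ X) := by
  intro Y Z hY hYZ hZ hGE
  have hZX : Z ≤ X := hZ.trans inf_le_right
  refine h (Y ⊔ A) (Z ⊔ A) le_sup_right
    (lt_of_le_of_ne (sup_le_sup_right hYZ.le A) fun heq => ?_)
    (sup_le (hZ.trans inf_le_left) hAB) (hGE.sup A)
  refine hYZ.ne (eq_of_le_of_inf_le_of_sup_le hYZ.le (z := A) ?_ heq.ge)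
  exact le_inf ((le_inf inf_le_right (inf_le_left.trans hZX)).trans hY) inf_le_right

end Interval

/-! ### Uniform estimates and extensions. -/

section Uniform

variable [FiniteDimensional K M] {s r R : ℝ} {A B C : Submodule (TwistedPoly d) M}

/-- The pointwise bounds at the members of a finite `K`-basis of `B` suffice, since scalars cost
only the Taylor constant `D`. The coordinates on `B` are extended to `M` to compare them with the
norm of `M`. -/
theorem ConvOn.exists_norm_le (hR : TaylorBounded d R) (hs : 0 < s) (hsR : s < R)
    (h : ConvOn d s A B) {χ : M →ₗ[K] K} (hχ : ∀ a ∈ A, χ a = 0) :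
    ∃ C : ℝ, 0 < C ∧ ∀ b ∈ B, ∀ n, ‖χ (divT d n b)‖ * s ^ n ≤ C * basisNorm K M b := by
  let W : Submodule K M := B.restrictScalars K
  let e := Module.finBasis K W
  obtain ⟨D, hD0, hD⟩ := hR s hs hsR
  choose g hg using fun j => LinearMap.exists_extend (e.coord j)
  choose E hE0 hE using fun j => exists_norm_le_basisNorm (g j)
  choose F hF using fun j => h χ hχ (e j) (e j).2
  have hF0 : ∀ j, 0 ≤ F j := fun j => le_trans (by positivity) (hF j 0)
  have hnn : ∀ j ∈ Finset.univ, 0 ≤ D * F j * E j := fun j _ =>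
    mul_nonneg (mul_nonneg hD0.le (hF0 j)) (hE0 j).le
  refine ⟨∑ j, D * F j * E j + 1, add_pos_of_nonneg_of_pos (Finset.sum_nonneg hnn) one_pos,
    fun b hb n => ?_⟩
  have hsum : b = ∑ j, g j b • (e j : M) := by
    have h1 := congr_arg W.subtype (e.sum_repr ⟨b, hb⟩)
    rw [map_sum] at h1
    refine h1.symm.trans (Finset.sum_congr rfl fun j _ => ?_)
    rw [map_smul, ← e.coord_apply, ← hg j]; rfl
  have hC : (0 : ℝ) ≤ ∑ j, D * F j * E j + 1 := add_nonneg (Finset.sum_nonneg hnn) zero_le_one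
  conv_lhs => rw [hsum, map_sum, map_sum]
  rw [← le_div_iff₀ (pow_pos hs n)]
  refine norm_sum_le_of_forall (div_nonneg (mul_nonneg hC (basisNorm_nonneg _)) (pow_pos hs n).le)
    fun j _ => ?_
  rw [le_div_iff₀ (pow_pos hs n)]
  calc _ ≤ D * F j * ‖g j b‖ := norm_divT_smul_le hs hD hD0.le (hF0 j) (hF j) _ n
    _ ≤ D * F j * (E j * basisNorm K M b) :=
      mul_le_mul_of_nonneg_left (hE j b) (mul_nonneg hD0.le (hF0 j))
    _ = (D * F j * E j) * basisNorm K M b := by ring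
    _ ≤ _ := by
      refine mul_le_mul_of_nonneg_right ?_ (basisNorm_nonneg _)
      have := Finset.single_le_sum (f := fun j => D * F j * E j) hnn (Finset.mem_univ j)
      linarith

/-- Removing the denominators multiplies by `|n!|`, which is `O(μ^n)` only for `μ > ω`. The choice
`μ = ω s / t` is what forces the drop from `s` to `t`; the converse `bddDivT_of_norm_T_pow_le` is
lossless because `|n!| ≥ ω^n`. -/
theorem ConvOn.exists_norm_T_pow_le (hp : 0 < residueChar K) (hR : TaylorBounded d R) {t : ℝ}
    (ht : 0 < t) (hts : t < s) (hsR : s < R) (h : ConvOn d s A B) {χ : M →ₗ[K] K}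
    (hχ : ∀ a ∈ A, χ a = 0) : ∃ C : ℝ, 0 < C ∧ ∀ b ∈ B, ∀ n : ℕ,
      ‖χ (T d ^ n • b)‖ ≤ C * (omega K / t) ^ n * basisNorm K M b := by
  have hs := ht.trans hts
  have hω := omega_pos hp
  obtain ⟨C, hC0, hC⟩ := h.exists_norm_le hR hs hsR hχ
  obtain ⟨E, hE0, hE⟩ := exists_norm_factorial_le hp (μ := omega K * s / t) (by
    rw [lt_div_iff₀ ht]; gcongr)
  refine ⟨E * C, by positivity, fun b hb n => ?_⟩
  rw [T_pow_smul_eq, map_smul, smul_eq_mul, norm_mul]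
  have h1 := hC b hb n
  rw [← le_div_iff₀ (pow_pos hs n)] at h1
  have hN := basisNorm_nonneg (K := K) b
  calc _ ≤ (E * (omega K * s / t) ^ n) * (C * basisNorm K M b / s ^ n) :=
        mul_le_mul (hE n) h1 (norm_nonneg _) (by positivity)
    _ = _ := by rw [div_pow, div_pow, mul_pow]; field_simp

theorem bddDivT_of_norm_T_pow_le (hp : 0 < residueChar K) {t : ℝ} (ht : 0 < t) {χ : M →ₗ[K] K}
    {x : M} {C : ℝ} (h : ∀ n : ℕ, ‖χ (T d ^ n • x)‖ ≤ C * (omega K / t) ^ n) :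
    BddDivT d t χ x := by
  have hω := omega_pos hp
  refine ⟨C, fun n => ?_⟩
  have hn : (0 : ℝ) < ‖(n.factorial : K)‖ := norm_pos_iff.2 (natCast_factorial_ne_zero n)
  have hC : 0 ≤ C := le_trans (norm_nonneg _) ((h 0).trans_eq (by simp))
  rw [divT_apply, map_smul, smul_eq_mul, norm_mul, norm_inv, mul_assoc, inv_mul_le_iff₀ hn]
  calc ‖χ (T d ^ n • x)‖ * t ^ n ≤ C * (omega K / t) ^ n * t ^ n := by gcongr; exact h n
    _ = omega K ^ n * C := by rw [div_pow]; field_simp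
    _ ≤ _ := by gcongr; exact omega_pow_le_norm_factorial hp n

theorem exists_basisNorm_T_smul_le [IsBoundedDerivation d] :
    ∃ C : ℝ, 0 < C ∧ ∀ x : M, basisNorm K M (T d • x) ≤ C * basisNorm K M x := by
  set b := Module.Basis.ofVectorSpace K M
  obtain ⟨D, hD0, hD⟩ := exists_bound_nonneg d
  have hnn : ∀ i ∈ Finset.univ, 0 ≤ basisNorm K M (T d • b i) + D * basisNorm K M (b i) :=
    fun i _ => add_nonneg (basisNorm_nonneg _) (mul_nonneg hD0 (basisNorm_nonneg _))
  have hC : 0 < ∑ i, (basisNorm K M (T d • b i) + D * basisNorm K M (b i)) + 1 :=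
    add_pos_of_nonneg_of_pos (Finset.sum_nonneg hnn) one_pos
  refine ⟨_, hC, fun x => ?_⟩
  conv_lhs => rw [← b.sum_repr x, Finset.smul_sum]
  have hx := basisNorm_nonneg (K := K) x
  refine basisNorm_sum_le (mul_nonneg hC.le hx) fun i _ => ?_
  have h1 := Finset.single_le_sum hnn (Finset.mem_univ i)
  have h2 := norm_repr_le_basisNorm (K := K) x i
  have h3 := basisNorm_nonneg (K := K) (b i)
  have h4 := basisNorm_nonneg (K := K) (T d • b i)
  have h5 : basisNorm K M (T d • b i) * basisNorm K M x ≤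
      (∑ i, (basisNorm K M (T d • b i) + D * basisNorm K M (b i)) + 1) * basisNorm K M x := by
    refine mul_le_mul_of_nonneg_right ?_ hx
    nlinarith
  have h6 : D * basisNorm K M (b i) * basisNorm K M x ≤
      (∑ i, (basisNorm K M (T d • b i) + D * basisNorm K M (b i)) + 1) * basisNorm K M x := by
    refine mul_le_mul_of_nonneg_right ?_ hx
    nlinarith
  rw [T_smul_smul]
  refine basisNorm_add_le ?_ ?_ <;> rw [basisNorm_smul]
  · refine le_trans ?_ h5
    rw [mul_comm]
    exact mul_le_mul_of_nonneg_left h2 h4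
  · refine le_trans ?_ h6
    have := (hD (b.repr x i)).trans (mul_le_mul_of_nonneg_left h2 hD0)
    calc _ ≤ D * basisNorm K M x * basisNorm K M (b i) := mul_le_mul_of_nonneg_right this h3
      _ = _ := by ring

theorem exists_projection (W : Submodule K M) :
    ∃ π : M →ₗ[K] M, (∀ x, π x ∈ W) ∧ ∀ x ∈ W, π x = x := by
  obtain ⟨π, hπ⟩ := W.subtype.exists_leftInverse_of_injective W.ker_subtype
  exact ⟨W.subtype ∘ₗ π, fun x => (π x).2, fun x hx =>
    congr_arg Subtype.val (LinearMap.congr_fun hπ ⟨x, hx⟩)⟩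

/-- Convergence is preserved by extensions, up to an arbitrarily small loss in the radius. -/
theorem ConvOn.trans (hp : 0 < residueChar K) [IsBoundedDerivation d] (hR : TaylorBounded d R)
    {t : ℝ} (ht : 0 < t) (hts : t < s) (hsR : s < R) (h1 : ConvOn d s A B) (h2 : ConvOn d s B C) :
    ConvOn d t A C := by
  intro χ hχ c hc
  have hω := omega_pos hp
  obtain ⟨π, hπ, hπB⟩ := exists_projection (B.restrictScalars K)
  set e := Module.Basis.ofVectorSpace K M
  have hρ : ∀ x ∈ B, x - π x = 0 := fun x hx => sub_eq_zero.2 (hπB x hx).symm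
  -- Write `Tⁿc = zₙ + yₙ` with `yₙ = π(Tⁿc)` in `B`. The coordinates of `zₙ` are forms that vanish
  -- on `B`, so convergence of `C / B` controls `zₙ`.
  choose E hE0 hE using fun i => h2.exists_norm_T_pow_le hp hR ht hts hsR
    (χ := e.coord i ∘ₗ (LinearMap.id - π)) fun a ha => by
      rw [LinearMap.comp_apply, LinearMap.sub_apply, LinearMap.id_apply, hρ a ha, map_zero]
  obtain ⟨F, hF0, hF⟩ := h1.exists_norm_T_pow_le hp hR ht hts hsR hχ
  obtain ⟨G, hG0, hG⟩ := exists_basisNorm_T_smul_le (d := d) (M := M)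
  obtain ⟨P, hP0, hP⟩ := exists_basisNorm_map_le π
  obtain ⟨H, hH0, hH⟩ := exists_norm_le_basisNorm χ
  have hμ : 0 < omega K / t := by positivity
  set μ := omega K / t
  have hEs : ∀ i ∈ Finset.univ, 0 ≤ E i := fun i _ => (hE0 i).le
  have hE1 : 0 < ∑ i, E i + 1 := add_pos_of_nonneg_of_pos (Finset.sum_nonneg hEs) one_pos
  have hNc := basisNorm_nonneg (K := K) c
  have hNπ := basisNorm_nonneg (K := K) (π c)
  set E' := (∑ i, E i + 1) * basisNorm K M c with hE'
  have hE'0 : 0 ≤ E' := mul_nonneg hE1.le hNc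
  have hz : ∀ n : ℕ, basisNorm K M (T d ^ n • c - π (T d ^ n • c)) ≤ E' * μ ^ n := fun n => by
    refine basisNorm_le (by positivity) fun i => (hE i c hc n).trans ?_
    rw [hE', mul_right_comm]
    have := Finset.single_le_sum hEs (Finset.mem_univ i)
    have h3 : E i ≤ ∑ i, E i + 1 := by linarith
    gcongr
  -- The two summands bound the initial term `π c` and the corrections `π(T zₙ)`.
  set Y := F * basisNorm K M (π c) + F * (P * (G * E')) / μ with hY
  have hY0 : 0 ≤ Y := by positivity
  -- The recursion is `yₙ₊₁ = π(T zₙ) + T yₙ`. The estimate is made for all `m` at once so that the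
  -- outer `T` goes into `m`; the ultrametric inequality keeps the same `Y` at every step.
  have hy : ∀ n m : ℕ, ‖χ (T d ^ m • π (T d ^ n • c))‖ ≤ Y * μ ^ (m + n) := by
    intro n
    induction n with
    | zero =>
      intro m
      rw [pow_zero, one_smul, add_zero]
      refine (hF _ (hπ c) m).trans ?_
      rw [mul_right_comm]
      gcongr
      exact le_add_of_nonneg_right (by positivity)
    | succ n ih =>
      intro m
      have hsplit : π (T d ^ (n + 1) • c) = π (T d • (T d ^ n • c - π (T d ^ n • c))) +
          T d • π (T d ^ n • c) := by
        rw [smul_sub, map_sub, hπB (T d • π (T d ^ n • c)) (B.smul_mem _ (hπ _)), sub_add_cancel,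
          pow_succ', mul_smul]
      rw [hsplit, smul_add, map_add]
      refine (IsUltrametricDist.norm_add_le_max _ _).trans (max_le ?_ ?_)
      · refine (hF _ (hπ _) m).trans ?_
        have h3 : basisNorm K M (π (T d • (T d ^ n • c - π (T d ^ n • c)))) ≤
            P * (G * (E' * μ ^ n)) :=
          (hP _).trans (mul_le_mul_of_nonneg_left
            ((hG _).trans (mul_le_mul_of_nonneg_left (hz n) hG0.le)) hP0.le)
        calc _ ≤ F * μ ^ m * (P * (G * (E' * μ ^ n))) := by gcongr
          _ = F * (P * (G * E')) / μ * μ ^ (m + (n + 1)) := by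
            rw [pow_add, pow_succ]; field_simp
          _ ≤ _ := by
            gcongr
            exact le_add_of_nonneg_left (by positivity)
      · rw [← mul_smul, ← pow_succ, show m + (n + 1) = (m + 1) + n by ring]
        exact ih (m + 1)
  refine bddDivT_of_norm_T_pow_le hp ht (C := H * E' + Y) fun n => ?_
  rw [← sub_add_cancel (T d ^ n • c) (π (T d ^ n • c)), map_add]
  refine (IsUltrametricDist.norm_add_le_max _ _).trans (max_le ?_ ?_)
  · refine ((hH _).trans (mul_le_mul_of_nonneg_left (hz n) hH0.le)).trans ?_
    rw [← mul_assoc]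
    gcongr
    exact le_add_of_nonneg_right hY0
  · have h3 := hy n 0
    rw [pow_zero, one_smul, zero_add] at h3
    refine h3.trans ?_
    gcongr
    exact le_add_of_nonneg_left (by positivity)

/-- `RadGE` only concerns `t < r`, so the loss in `ConvOn.trans` is absorbed by the midpoint of `t`
and `r`. -/
theorem RadGE.trans (hp : 0 < residueChar K) [IsBoundedDerivation d] (hR : TaylorBounded d R)
    (hrR : r ≤ R) (h1 : RadGE d r A B) (h2 : RadGE d r B C) : RadGE d r A C := fun t ht htr =>
  ConvOn.trans hp hR ht (s := (t + r) / 2) (by linarith) (by linarith)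
    (h1 _ (by linarith) (by linarith)) (h2 _ (by linarith) (by linarith))

end Uniform

/-! ### Independence of the ambient module. -/

section Transport

variable {s r : ℝ}

theorem convOn_map_subtype {N : Submodule (TwistedPoly d) M} {A B : Submodule (TwistedPoly d) N} :
    ConvOn d s (A.map N.subtype) (B.map N.subtype) ↔ ConvOn d s A B := by
  constructor
  · intro h χ hχ b hb
    obtain ⟨χ', hχ'⟩ := LinearMap.exists_extend (p := N.restrictScalars K) χ
    have hχ'' : ∀ x : N, χ' x = χ x := fun x => LinearMap.congr_fun hχ' x
    obtain ⟨C, hC⟩ := h χ' (by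
      rintro _ ⟨a, ha, rfl⟩
      exact (hχ'' a).trans (hχ a ha)) _ ⟨b, hb, rfl⟩
    refine ⟨C, fun i => ?_⟩
    rw [← hχ'', ← N.subtype_apply, map_divT]
    exact hC i
  · rintro h χ hχ _ ⟨b, hb, rfl⟩
    obtain ⟨C, hC⟩ := h (χ ∘ₗ N.subtype.restrictScalars K) (fun a ha => hχ _ ⟨a, ha, rfl⟩) b hb
    refine ⟨C, fun i => ?_⟩
    rw [← map_divT]
    exact hC i

theorem radGE_map_subtype {N : Submodule (TwistedPoly d) M} {A B : Submodule (TwistedPoly d) N} :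
    RadGE d r (A.map N.subtype) (B.map N.subtype) ↔ RadGE d r A B :=
  forall_congr' fun _ => forall_congr' fun _ => forall_congr' fun _ => convOn_map_subtype

theorem radLT_map_subtype {N : Submodule (TwistedPoly d) M} {A B : Submodule (TwistedPoly d) N} :
    RadLT d r (A.map N.subtype) (B.map N.subtype) ↔ RadLT d r A B := by
  have hmono := Submodule.map_strictMono_of_injective (f := N.subtype) N.subtype_injective
  constructor
  · intro h X Y hA hXY hB hGE
    exact h _ _ (Submodule.map_mono hA) (hmono hXY) (Submodule.map_mono hB)
      (radGE_map_subtype.2 hGE)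
  · intro h X Y hA hXY hB hGE
    have hYN : Y ≤ N := hB.trans (Submodule.map_subtype_le N B)
    have hX : (X.comap N.subtype).map N.subtype = X := by
      rw [Submodule.map_comap_subtype, inf_eq_right]
      exact hXY.le.trans hYN
    have hY : (Y.comap N.subtype).map N.subtype = Y := by
      rw [Submodule.map_comap_subtype, inf_eq_right]
      exact hYN
    rw [← hX, ← hY] at hGE
    refine h (X.comap N.subtype) (Y.comap N.subtype) (Submodule.map_le_iff_le_comap.1 hA) ?_ ?_
      (radGE_map_subtype.1 hGE)
    · refine lt_of_le_of_ne (Submodule.comap_mono hXY.le) fun heq => hXY.ne ?_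
      rw [← hX, ← hY, heq]
    · rw [← Submodule.comap_map_eq_of_injective N.subtype_injective B]
      exact Submodule.comap_mono hB

theorem radGE_bot_top_subtype {N : Submodule (TwistedPoly d) M} :
    RadGE d r (⊥ : Submodule (TwistedPoly d) N) ⊤ ↔ RadGE d r ⊥ N := by
  rw [← radGE_map_subtype, Submodule.map_bot, Submodule.map_subtype_top]

theorem radLT_bot_top_subtype {N : Submodule (TwistedPoly d) M} :
    RadLT d r (⊥ : Submodule (TwistedPoly d) N) ⊤ ↔ RadLT d r ⊥ N := by
  rw [← radLT_map_subtype, Submodule.map_bot, Submodule.map_subtype_top]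

theorem convOn_quotient {A : Submodule (TwistedPoly d) M} :
    ConvOn d s (⊥ : Submodule (TwistedPoly d) (M ⧸ A)) ⊤ ↔ ConvOn d s A ⊤ := by
  constructor
  · intro h χ hχ b _
    let χ' : (M ⧸ A) →ₗ[K] K :=
      { toFun := QuotientAddGroup.lift A.toAddSubgroup χ.toAddMonoidHom hχ
        map_add' := map_add _
        map_smul' := fun c x => by
          induction x using Submodule.Quotient.induction_on with
          | H x => exact χ.map_smul c x }
    obtain ⟨C, hC⟩ := h χ' (fun a ha => by rw [(Submodule.mem_bot _).1 ha, map_zero])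
      (A.mkQ b) trivial
    refine ⟨C, fun i => ?_⟩
    have := hC i
    rw [← map_divT] at this
    exact this
  · intro h χ _ b _
    obtain ⟨b, rfl⟩ := A.mkQ_surjective b
    obtain ⟨C, hC⟩ := h (χ ∘ₗ A.mkQ.restrictScalars K) (fun a ha => by
      have : A.mkQ a = 0 := (Submodule.Quotient.mk_eq_zero A).2 ha
      change χ (A.mkQ a) = 0
      rw [this, map_zero]) b trivial
    refine ⟨C, fun i => ?_⟩
    rw [← map_divT]
    exact hC i

end Transport

end Convergence

/-! ### Duality and convergence -/

section PairingBound

variable {K : Type u} [NontriviallyNormedField K] [IsUltrametricDist K] [CharZero K]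
  {d : Derivation ℤ K K}

theorem iterate_derivation_natCast_inv_mul (i n : ℕ) (y : K) :
    d^[i] ((n.factorial : K)⁻¹ * y) = (n.factorial : K)⁻¹ * d^[i] y := by
  induction i generalizing y with
  | zero => rfl
  | succ i ih =>
    rw [Function.iterate_succ_apply, Derivation.leibniz, d_inv_factorial, smul_zero, add_zero,
      smul_eq_mul, ih, Function.iterate_succ_apply]

theorem T_smul_iterate {M : Type v} [AddCommGroup M] [Module (TwistedPoly d) M] (n : ℕ) (x : M) :
    (fun y : M => T d • y)^[n] x = T d ^ n • x := by
  induction n with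
  | zero => simp
  | succ n ih => rw [Function.iterate_succ_apply', ih, pow_succ', mul_smul]

variable {M : Type v} [AddCommGroup M] [Module K M]
  [Module (TwistedPoly d) M] [IsScalarTower K (TwistedPoly d) M]
  {N : Type w} [AddCommGroup N] [Module K N]
  [Module (TwistedPoly d) N] [IsScalarTower K (TwistedPoly d) N]

/-- This is `pairing_iterate` divided by `n!`: the factorials absorb the binomial coefficients, so
no small denominators remain. -/
theorem pairing_divT (b : M →ₗ[K] N →ₗ[K] K)
    (hb : ∀ x y, d (b x y) = b (T d • x) y + b x (T d • y)) (n : ℕ) (x : M) (y : N) :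
    b (divT d n x) y = ∑ ij ∈ Finset.HasAntidiagonal.antidiagonal n,
      (-1) ^ ij.2 * (d^[ij.1] (b x (divT d ij.2 y)) / (ij.1.factorial : K)) := by
  have h := pairing_iterate (A := M) (B := N) (H := K)
    { toFun := fun x => (b x).toAddMonoidHom
      map_zero' := by ext; simp
      map_add' := fun x y => by ext; simp } (fun x => T d • x) (fun x => T d • x)
    d.toLinearMap.toAddMonoidHom hb n x y
  change b _ _ = _ at h
  rw [divT_apply, map_smul, LinearMap.smul_apply, ← T_smul_iterate, h, smul_eq_mul, Finset.mul_sum]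
  refine Finset.sum_congr rfl fun ij hij => ?_
  have hn := Finset.HasAntidiagonal.mem_antidiagonal.1 hij
  have h1 := natCast_factorial_ne_zero (K := K) ij.1
  have h2 := natCast_factorial_ne_zero (K := K) ij.2
  have h3 := natCast_factorial_ne_zero (K := K) n
  have h4 : (n.choose ij.1 : K) * ij.1.factorial * ij.2.factorial = n.factorial := by
    rw [← hn, Nat.choose_symm_add]
    exact_mod_cast Nat.add_choose_mul_factorial_mul_factorial ij.1 ij.2
  have h5 : ∀ (k i : ℕ) (z : K), d.toLinearMap.toAddMonoidHom^[i] ((-1 : ℤ) ^ k • z) =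
      (-1) ^ k * d^[i] z := fun k i z => by
    have : ∀ w : K, d.toLinearMap.toAddMonoidHom^[i] w = d^[i] w := fun w => rfl
    rw [iterate_map_zsmul, this]
    simp
  rw [h5, divT_apply, map_smul, smul_eq_mul, iterate_derivation_natCast_inv_mul, T_smul_iterate]
  change _ * (_ • ((-1) ^ ij.2 * d^[ij.1] (b x _))) = _
  rw [nsmul_eq_mul]
  field_simp
  rw [← h4]; ring

theorem exists_norm_pairing_divT_le {R s : ℝ} (hR : TaylorBounded d R) (hs : 0 < s) (hsR : s < R)
    (b : M →ₗ[K] N →ₗ[K] K) (hb : ∀ x y, d (b x y) = b (T d • x) y + b x (T d • y)) {x : M} {y : N}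
    (h : ∃ C : ℝ, ∀ i, ‖b x (divT d i y)‖ * s ^ i ≤ C) :
    ∃ C : ℝ, ∀ i, ‖b (divT d i x) y‖ * s ^ i ≤ C := by
  obtain ⟨C, hC⟩ := h
  obtain ⟨D, hD0, hD⟩ := hR s hs hsR
  have hC0 : 0 ≤ C := le_trans (by positivity) (hC 0)
  refine ⟨D * C, fun n => ?_⟩
  rw [pairing_divT b hb, ← le_div_iff₀ (pow_pos hs n)]
  refine norm_sum_le_of_forall (by positivity) fun ij hij => ?_
  rw [le_div_iff₀ (pow_pos hs n), ← Finset.HasAntidiagonal.mem_antidiagonal.1 hij, norm_mul,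
    norm_pow, norm_neg, norm_one, one_pow, one_mul, pow_add, ← mul_assoc]
  calc _ ≤ (D * ‖b x (divT d ij.2 y)‖) * s ^ ij.2 :=
        mul_le_mul_of_nonneg_right (hD _ _) (by positivity)
    _ = D * (‖b x (divT d ij.2 y)‖ * s ^ ij.2) := by ring
    _ ≤ D * C := by gcongr; exact hC _

/-- The action of `T` on the dual is defined so that evaluation satisfies the Leibniz rule;
`pairing_divT` can then be applied in both directions. -/
theorem bddDivT_iff_dual {R s : ℝ} (hR : TaylorBounded d R) (hs : 0 < s) (hsR : s < R)
    (χ : M →ₗ[K] K) (x : M) :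
    BddDivT d s χ x ↔ ∃ C : ℝ, ∀ i, ‖(divT d i χ) x‖ * s ^ i ≤ C := by
  have hb : ∀ (χ : M →ₗ[K] K) (x : M), d (χ x) = (T d • χ) x + χ (T d • x) := fun χ x => by
    rw [dual₀_T_smul_apply, sub_add_cancel]
  constructor
  · exact exists_norm_pairing_divT_le hR hs hsR (M := M →ₗ[K] K) (N := M) LinearMap.id hb
  · exact exists_norm_pairing_divT_le hR hs hsR (M := M) (N := M →ₗ[K] K) LinearMap.id.flip
      fun x χ => (hb χ x).trans (add_comm _ _)

/-- The annihilator of a submodule in the dual. -/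
def dualAnn (L : Submodule (TwistedPoly d) M) : Submodule (TwistedPoly d) (M →ₗ[K] K) :=
  submoduleOfStable (L.restrictScalars K).dualAnnihilator.toAddSubgroup
    (fun c χ hχ => (L.restrictScalars K).dualAnnihilator.smul_mem c hχ)
    (fun χ hχ => by
      change T d • χ ∈ (L.restrictScalars K).dualAnnihilator
      rw [Submodule.mem_dualAnnihilator] at *
      intro x hx
      have h2 := (Submodule.mem_dualAnnihilator χ).1 hχ
      rw [dual₀_T_smul_apply, h2 x hx, h2 _ (L.smul_mem _ hx), map_zero, sub_zero])

theorem mem_dualAnn {L : Submodule (TwistedPoly d) M} {χ : M →ₗ[K] K} :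
    χ ∈ dualAnn L ↔ ∀ x ∈ L, χ x = 0 := Submodule.mem_dualAnnihilator (W := L.restrictScalars K) χ

/-- The common kernel of a submodule of the dual. -/
def dualCoann (A : Submodule (TwistedPoly d) (M →ₗ[K] K)) : Submodule (TwistedPoly d) M :=
  submoduleOfStable
    (Submodule.dualCoannihilator (R := K) (M := M) (A.restrictScalars K)).toAddSubgroup
    (fun c _ hx =>
      (Submodule.dualCoannihilator (R := K) (M := M) (A.restrictScalars K)).smul_mem c hx)
    (fun x hx => by
      have h2 := (Submodule.mem_dualCoannihilator (R := K) x).1 hx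
      refine (Submodule.mem_dualCoannihilator (R := K) _).2 fun χ hχ => ?_
      have h3 := dual₀_T_smul_apply (d := d) χ x
      rw [h2 χ hχ, map_zero, zero_sub] at h3
      rw [← neg_eq_zero, ← h3]
      exact h2 _ (A.smul_mem (T d) hχ))

theorem mem_dualCoann {A : Submodule (TwistedPoly d) (M →ₗ[K] K)} {x : M} :
    x ∈ dualCoann A ↔ ∀ χ ∈ A, χ x = 0 :=
  Submodule.mem_dualCoannihilator (R := K) (Φ := A.restrictScalars K) x

theorem dualCoann_dualAnn (L : Submodule (TwistedPoly d) M) : dualCoann (dualAnn L) = L := by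
  refine le_antisymm (fun x hx => ?_) fun x hx => mem_dualCoann.2 fun χ hχ => mem_dualAnn.1 hχ x hx
  have : x ∈ (L.restrictScalars K).dualAnnihilator.dualCoannihilator :=
    (Submodule.mem_dualCoannihilator x).2 fun χ hχ => mem_dualCoann.1 hx χ hχ
  rwa [Subspace.dualAnnihilator_dualCoannihilator_eq] at this

variable [FiniteDimensional K M]

theorem dualAnn_dualCoann (A : Submodule (TwistedPoly d) (M →ₗ[K] K)) :
    dualAnn (dualCoann A) = A := by
  refine le_antisymm (fun χ hχ => ?_) fun χ hχ => mem_dualAnn.2 fun x hx => mem_dualCoann.1 hx χ hχ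
  have h : χ ∈ (Submodule.dualCoannihilator (R := K) (M := M)
      (A.restrictScalars K)).dualAnnihilator :=
    (Submodule.mem_dualAnnihilator χ).2 fun x hx => mem_dualAnn.1 hχ x hx
  have : FiniteDimensional K (Module.Dual K M) := inferInstance
  rwa [Subspace.dualCoannihilator_dualAnnihilator_eq] at h

theorem exists_eval_of_vanish {L : Submodule (TwistedPoly d) M} (Θ : (M →ₗ[K] K) →ₗ[K] K)
    (h : ∀ χ ∈ dualAnn L, Θ χ = 0) : ∃ x ∈ L, ∀ χ, Θ χ = χ x := by
  obtain ⟨x, rfl⟩ := (Module.evalEquiv K M).surjective Θ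
  refine ⟨x, ?_, fun χ => rfl⟩
  rw [← dualCoann_dualAnn L]
  exact mem_dualCoann.2 h

variable {R s r : ℝ}

theorem ConvOn.dualCoann (hR : TaylorBounded d R) (hs : 0 < s) (hsR : s < R)
    {A B : Submodule (TwistedPoly d) (M →ₗ[K] K)} (h : ConvOn d s A B) :
    ConvOn d s (dualCoann B) (dualCoann A) := by
  intro χ hχ x hx
  have hB : χ ∈ B := by
    rw [← dualAnn_dualCoann B]
    exact mem_dualAnn.2 hχ
  exact (bddDivT_iff_dual hR hs hsR χ x).2
    (h (LinearMap.id.flip x) (fun ψ hψ => mem_dualCoann.1 hx ψ hψ) χ hB)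

theorem ConvOn.dualAnn (hR : TaylorBounded d R) (hs : 0 < s) (hsR : s < R)
    {A B : Submodule (TwistedPoly d) M} (h : ConvOn d s A B) :
    ConvOn d s (dualAnn B) (dualAnn A) := by
  intro Θ hΘ χ hχ
  obtain ⟨x, hx, hΘx⟩ := exists_eval_of_vanish Θ hΘ
  obtain ⟨C, hC⟩ := (bddDivT_iff_dual hR hs hsR χ x).1 (h χ (mem_dualAnn.1 hχ) x hx)
  exact ⟨C, fun i => by rw [hΘx]; exact hC i⟩

theorem RadGE.dualAnn (hR : TaylorBounded d R) (hrR : r ≤ R) {A B : Submodule (TwistedPoly d) M}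
    (h : RadGE d r A B) : RadGE d r (dualAnn B) (dualAnn A) :=
  fun s hs hsr => (h s hs hsr).dualAnn hR hs (hsr.trans_le hrR)

/-- Annihilators reverse inclusions bijectively in finite dimension, so a subquotient of the dual of
radius at least `r` comes from a nonzero subquotient of `B / A` with the same property. -/
theorem RadLT.dualAnn (hR : TaylorBounded d R) (hrR : r ≤ R) {A B : Submodule (TwistedPoly d) M}
    (h : RadLT d r A B) : RadLT d r (dualAnn B) (dualAnn A) := by
  intro X Y hX hXY hY hGE
  refine h (dualCoann Y) (dualCoann X) ?_ (lt_of_le_of_ne ?_ ?_) ?_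
    fun s hs hsr => (hGE s hs hsr).dualCoann hR hs (hsr.trans_le hrR)
  · exact fun x hx => mem_dualCoann.2 fun χ hχ => mem_dualAnn.1 (hY hχ) x hx
  · exact fun x hx => mem_dualCoann.2 fun χ hχ => mem_dualCoann.1 hx χ (hXY.le hχ)
  · intro heq
    rw [← dualAnn_dualCoann X, ← dualAnn_dualCoann Y, heq] at hXY
    exact lt_irrefl _ hXY
  · rw [← dualCoann_dualAnn B]
    exact fun x hx => mem_dualCoann.2 fun χ hχ => mem_dualCoann.1 hx χ (hX hχ)

end PairingBound

/-! ### Vanishing of extensions between modules of different radii -/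

section Lattices

variable {K : Type u} [NontriviallyNormedField K] [CompleteSpace K]
  {X : Type v} [AddCommGroup X] [Module K X] [FiniteDimensional K X]

/-- A linear form that vanishes on the intersection of an increasing family of lattices of `X`
is bounded with respect to the gauge of that family. -/
theorem exists_norm_le_of_vanish_of_gauge (Λ : ℝ → AddSubgroup X) (hmono : Monotone Λ)
    (hsmul : ∀ (c : K) (t : ℝ), c ≠ 0 → ∀ x ∈ Λ t, c • x ∈ Λ (‖c‖ * t)) (χ : X →ₗ[K] K)
    (hχ : ∀ x, (∀ t : ℝ, 0 < t → x ∈ Λ t) → χ x = 0) :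
    ∃ C : ℝ, ∀ t : ℝ, 0 < t → ∀ x ∈ Λ t, ‖χ x‖ ≤ C * t := by
  let V₀ : Submodule K X :=
    { carrier := {x | ∀ t : ℝ, 0 < t → x ∈ Λ t}
      zero_mem' := fun t _ => (Λ t).zero_mem
      add_mem' := fun hx hy t ht => (Λ t).add_mem (hx t ht) (hy t ht)
      smul_mem' := fun c x hx t ht => by
        by_cases hc : c = 0
        · rw [hc, zero_smul]; exact (Λ t).zero_mem
        · have := hsmul c (t / ‖c‖) hc x (hx _ (div_pos ht (norm_pos_iff.2 hc)))
          rwa [mul_div_cancel₀ _ (norm_ne_zero_iff.2 hc)] at this }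
  let V : Submodule K X :=
    { carrier := {x | ∃ t : ℝ, 0 < t ∧ x ∈ Λ t}
      zero_mem' := ⟨1, one_pos, (Λ 1).zero_mem⟩
      add_mem' := by
        rintro x y ⟨t, ht, hx⟩ ⟨t', ht', hy⟩
        exact ⟨max t t', lt_max_of_lt_left ht, (Λ _).add_mem (hmono (le_max_left _ _) hx)
          (hmono (le_max_right _ _) hy)⟩
      smul_mem' := by
        rintro c x ⟨t, ht, hx⟩
        by_cases hc : c = 0
        · rw [hc, zero_smul]; exact ⟨1, one_pos, (Λ 1).zero_mem⟩
        · exact ⟨_, mul_pos (norm_pos_iff.2 hc) ht, hsmul c t hc x hx⟩ }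
  obtain ⟨W₀, hW₀⟩ := V₀.exists_isCompl
  -- On `W` the gauge is finite because `W ⊆ V`, and it separates points because `W` meets `V₀`
  -- trivially. It is thus a norm, and over the complete field `K` every form on the
  -- finite-dimensional `W` is continuous for it.
  let W : Submodule K X := W₀ ⊓ V
  let ν : W → ℝ := fun x => sInf {t : ℝ | 0 < t ∧ (x : X) ∈ Λ t}
  have hbdd : ∀ x : W, BddBelow {t : ℝ | 0 < t ∧ (x : X) ∈ Λ t} := fun x =>
    ⟨0, fun t ht => ht.1.le⟩
  have hle : ∀ (x : W) (t : ℝ), 0 < t → (x : X) ∈ Λ t → ν x ≤ t := fun x t ht hx =>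
    csInf_le (hbdd x) ⟨ht, hx⟩
  have hlt : ∀ (x : W) (t : ℝ), ν x < t → (x : X) ∈ Λ t := fun x t h => by
    obtain ⟨t', ht', h'⟩ := exists_lt_of_csInf_lt (s := {t : ℝ | 0 < t ∧ (x : X) ∈ Λ t}) x.2.2 h
    exact hmono h'.le ht'.2
  have hnn : ∀ x : W, 0 ≤ ν x := fun x => le_csInf x.2.2 fun t ht => ht.1.le
  have hν0 : ν 0 = 0 := le_antisymm
    (le_of_forall_gt_imp_ge_of_dense fun t ht => hle 0 t ht (Λ t).zero_mem) (hnn 0)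
  let N : AddGroupNorm W :=
    { toFun := ν
      map_zero' := hν0
      add_le' := fun x y => by
        refine le_of_forall_pos_le_add fun ε hε => ?_
        have hx := hlt x (ν x + ε / 2) (by linarith)
        have hy := hlt y (ν y + ε / 2) (by linarith)
        refine hle _ _ (by linarith [hnn x, hnn y]) ((Λ _).add_mem (hmono ?_ hx) (hmono ?_ hy)) <;>
          linarith [hnn x, hnn y]
      neg' := fun x => by
        change sInf _ = sInf _
        simp
      eq_zero_of_map_eq_zero' := fun x hx => by
        have h1 : (x : X) ∈ V₀ := fun t ht => hlt x t (hx.trans_lt ht)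
        exact Subtype.ext (Submodule.disjoint_def.1 hW₀.disjoint _ h1 x.2.1) }
  let _ : NormedAddCommGroup W := N.toNormedAddCommGroup
  let _ : NormedSpace K W :=
    { norm_smul_le := fun c x => by
        change ν (c • x) ≤ ‖c‖ * ν x
        by_cases hc : c = 0
        · rw [hc, zero_smul, hν0, norm_zero, zero_mul]
        · have hc' := norm_pos_iff.2 hc
          rw [← div_le_iff₀' hc']
          refine le_of_forall_gt_imp_ge_of_dense fun t ht => ?_
          rw [div_le_iff₀' hc']
          exact hle _ _ (mul_pos hc' ((hnn x).trans_lt ht)) (hsmul c t hc x (hlt x t ht)) }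
  refine ⟨‖LinearMap.toContinuousLinearMap (χ ∘ₗ W.subtype)‖, fun t ht x hx => ?_⟩
  obtain ⟨v, hv, w, hw, rfl⟩ := Submodule.mem_sup.1 (hW₀.sup_eq_top ▸ Submodule.mem_top : x ∈ V₀ ⊔ W₀)
  have hwt : w ∈ Λ t := by
    have := (Λ t).sub_mem hx (hv t ht)
    rwa [add_sub_cancel_left] at this
  rw [map_add, hχ v hv, zero_add]
  refine ((LinearMap.toContinuousLinearMap (χ ∘ₗ W.subtype)).le_opNorm
    ⟨w, hw, t, ht, hwt⟩).trans (mul_le_mul_of_nonneg_left ?_ (norm_nonneg _))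
  exact hle _ t ht hwt

variable [IsUltrametricDist K]

/-- `φ` is only additive, so linear algebra does not apply; `z` is the fixed point of the
contraction `v ↦ y + φ(v)`. -/
theorem exists_sub_eq_of_basisNorm_le (φ : X →+ X)
    (hφ : ∀ y, basisNorm K X (φ y) ≤ 1 / 2 * basisNorm K X y) (y : X) : ∃ z, z - φ z = y := by
  let e := (Module.Basis.ofVectorSpace K X).equivFun
  have he : ∀ z, ‖e z‖ = basisNorm K X z := fun z => le_antisymm
    ((pi_norm_le_iff_of_nonneg (basisNorm_nonneg z)).2 fun i => norm_repr_le_basisNorm z i)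
    (basisNorm_le (norm_nonneg _) fun i => norm_le_pi_norm (e z) i)
  have hc : ContractingWith (1 / 2) fun v => e y + e (φ (e.symm v)) := by
    refine ⟨by norm_num, LipschitzWith.of_dist_le_mul fun v w => ?_⟩
    rw [dist_add_left, dist_eq_norm, dist_eq_norm, ← map_sub, he, ← map_sub, ← map_sub]
    refine (hφ _).trans ?_
    rw [← he, LinearEquiv.apply_symm_apply]
    simp
  have hfix := hc.fixedPoint_isFixedPt
  set v := ContractingWith.fixedPoint _ hc
  refine ⟨e.symm v, sub_eq_of_eq_add ?_⟩
  rw [LinearEquiv.symm_apply_eq, map_add]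
  exact hfix.symm

end Lattices

/-! ### Integration by parts against a module of larger radius. -/

section Extensions

variable {K : Type u} [NontriviallyNormedField K] [IsUltrametricDist K] [CharZero K]
  {d : Derivation ℤ K K}
  {X : Type v} [AddCommGroup X] [Module K X] [Module (TwistedPoly d) X]
  [IsScalarTower K (TwistedPoly d) X]
  {Y : Type w} [AddCommGroup Y] [Module K Y] [Module (TwistedPoly d) Y]
  [IsScalarTower K (TwistedPoly d) Y]

theorem ConvOn.exists_basisNorm_divT_le [FiniteDimensional K Y] {R s : ℝ} (hR : TaylorBounded d R)
    (hs : 0 < s) (hsR : s < R) (h : ConvOn d s (⊥ : Submodule (TwistedPoly d) Y) ⊤) :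
    ∃ C : ℝ, 0 < C ∧ ∀ (n : ℕ) (y : Y),
      basisNorm K Y (divT d n y) * s ^ n ≤ C * basisNorm K Y y := by
  set e := Module.Basis.ofVectorSpace K Y
  choose C hC0 hC using fun i => h.exists_norm_le hR hs hsR (χ := e.coord i)
    fun a ha => by rw [(Submodule.mem_bot _).1 ha, map_zero]
  have hnn : ∀ i ∈ Finset.univ, 0 ≤ C i := fun i _ => (hC0 i).le
  have hpos : 0 < ∑ i, C i + 1 := add_pos_of_nonneg_of_pos (Finset.sum_nonneg hnn) one_pos
  refine ⟨∑ i, C i + 1, hpos, fun n y => ?_⟩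
  have hy := basisNorm_nonneg (K := K) y
  rw [← le_div_iff₀ (pow_pos hs n)]
  refine basisNorm_le (by positivity) fun i => ?_
  rw [le_div_iff₀ (pow_pos hs n)]
  refine (hC i y trivial n).trans (mul_le_mul_of_nonneg_right ?_ hy)
  have := Finset.single_le_sum hnn (Finset.mem_univ i)
  linarith

/-- The finite sums of elements of `X₀` and of elements `q (1/i!) Tⁱ x` with `|q| ≤ t sⁱ`. -/
def divLattice (X₀ : Submodule (TwistedPoly d) X) (x : X) (s t : ℝ) : AddSubgroup X :=
  AddSubgroup.closure ({z | ∃ (q : K) (i : ℕ), ‖q‖ ≤ t * s ^ i ∧ z = q • divT d i x} ∪ X₀)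

section divLattice

variable {X₀ : Submodule (TwistedPoly d) X} {x : X} {s t : ℝ}

theorem smul_divT_mem_divLattice {q : K} {i : ℕ} (h : ‖q‖ ≤ t * s ^ i) :
    q • divT d i x ∈ divLattice X₀ x s t := AddSubgroup.subset_closure (Or.inl ⟨q, i, h, rfl⟩)

theorem mem_divLattice_of_mem {z : X} (h : z ∈ X₀) : z ∈ divLattice X₀ x s t :=
  AddSubgroup.subset_closure (Or.inr h)

theorem divLattice_le {S : AddSubgroup X} (h0 : ∀ z ∈ X₀, z ∈ S)
    (h : ∀ (q : K) (i : ℕ), ‖q‖ ≤ t * s ^ i → q • divT d i x ∈ S) : divLattice X₀ x s t ≤ S := by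
  rw [divLattice, AddSubgroup.closure_le]
  rintro z (⟨q, i, hq, rfl⟩ | hz)
  · exact h q i hq
  · exact h0 z hz

theorem divLattice_mono (hs : 0 < s) : Monotone (divLattice X₀ x s) := fun _ _ htt' =>
  divLattice_le (fun _ hz => mem_divLattice_of_mem hz) fun _ i hq =>
    smul_divT_mem_divLattice (hq.trans (mul_le_mul_of_nonneg_right htt' (pow_pos hs i).le))

theorem divLattice_mono_left {s' : ℝ} (hs : 0 < s) (hss' : s ≤ s') (ht : 0 ≤ t) :
    divLattice X₀ x s t ≤ divLattice X₀ x s' t :=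
  divLattice_le (fun _ hz => mem_divLattice_of_mem hz) fun _ _ hq =>
    smul_divT_mem_divLattice (hq.trans (by gcongr))

theorem smul_mem_divLattice (c : K) {z : X} (hz : z ∈ divLattice X₀ x s t) :
    c • z ∈ divLattice X₀ x s (‖c‖ * t) := by
  have := divLattice_le (S := (divLattice X₀ x s (‖c‖ * t)).comap
    (DistribSMul.toAddMonoidHom X c)) (X₀ := X₀) (x := x) (s := s) (t := t)
    (fun z (hz : z ∈ X₀) => mem_divLattice_of_mem (C_smul_mem d X₀ hz c)) (fun q i hq => by
      change c • q • divT d i x ∈ divLattice X₀ x s (‖c‖ * t)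
      rw [smul_smul]
      refine smul_divT_mem_divLattice ?_
      rw [norm_mul, mul_assoc]
      exact mul_le_mul_of_nonneg_left hq (norm_nonneg c))
  exact this hz

/-- In the Leibniz expansion a divided derivative of order `a` of the coefficient costs `D / s^a`,
and moving from `Tⁱx/i!` to a higher divided power costs only an integer. So the `j`-th divided
power has size at most `D / s^j` for the gauge, as in a module convergent at `s`. -/
theorem divT_mem_divLattice {D : ℝ} (hs : 0 < s)
    (hD : ∀ (i : ℕ) (c : K), ‖d^[i] c / (i.factorial : K)‖ * s ^ i ≤ D * ‖c‖)
    (hD0 : 0 ≤ D) (j : ℕ) {z : X} (hz : z ∈ divLattice X₀ x s t) :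
    divT d j z ∈ divLattice X₀ x s (D * t / s ^ j) := by
  have := divLattice_le (S := (divLattice X₀ x s (D * t / s ^ j)).comap (divT d j)) (X₀ := X₀)
    (x := x) (s := s) (t := t) (fun z (hz : z ∈ X₀) => mem_divLattice_of_mem (divT_mem d X₀ hz j))
    (fun q i hq => by
      change divT d j (q • divT d i x) ∈ divLattice X₀ x s (D * t / s ^ j)
      rw [divT_smul]
      refine AddSubgroup.sum_mem _ fun ab hab => ?_
      rw [Finset.HasAntidiagonal.mem_antidiagonal] at hab
      rw [divT_divT, smul_smul]
      refine smul_divT_mem_divLattice ?_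
      rw [norm_mul]
      have h1 : ‖d^[ab.1] q / (ab.1.factorial : K)‖ ≤ D * (t * s ^ i) / s ^ ab.1 := by
        rw [le_div_iff₀ (pow_pos hs _)]
        exact (hD _ _).trans (mul_le_mul_of_nonneg_left hq hD0)
      refine (mul_le_of_le_one_right (norm_nonneg _) (norm_natCast_le_one' _)).trans
        (h1.trans (le_of_eq ?_))
      rw [← hab, pow_add, pow_add]
      field_simp)
  exact this hz

end divLattice

/-- Integration by parts: if `b (T x) y + b x (T y) ∈ I` for `x ∈ X₁`, where the nonzero
subquotients of `X₁` have radius less than `r` and `Y` has radius at least `r`, then `b` takes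
values in `I` on `X₁ × Y`. -/
theorem pairing_mem_of_radLT_of_radGE [CompleteSpace K] [FiniteDimensional K X]
    [FiniteDimensional K Y] {R r : ℝ} (hR : TaylorBounded d R) (hrR : r ≤ R) (hr : 0 < r)
    {X₁ : Submodule (TwistedPoly d) X} (hX : RadLT d r ⊥ X₁)
    (hY : RadGE d r (⊥ : Submodule (TwistedPoly d) Y) ⊤) {H : Type*} [AddCommGroup H]
    (b : X →+ Y →+ H) (hb : ∀ (c : K) x y, b (c • x) y = b x (c • y)) (I : AddSubgroup H)
    (hI : ∀ x ∈ X₁, ∀ y, b (T d • x) y + b x (T d • y) ∈ I) : ∀ x ∈ X₁, ∀ y, b x y ∈ I := by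
  have hpow : ∀ i : ℕ, ∀ x ∈ X₁, ∀ y, b (T d ^ i • x) y - (-1 : ℤ) ^ i • b x (T d ^ i • y) ∈ I := by
    intro i
    induction i with
    | zero => intro x _ y; simp
    | succ i ih =>
      intro x hx y
      have h1 := hI (T d ^ i • x) (X₁.smul_mem _ hx) y
      have h2 := ih x hx (T d • y)
      have := I.sub_mem h1 h2
      rw [← mul_smul, ← mul_smul, ← pow_succ', ← pow_succ] at this
      convert this using 1
      rw [pow_succ (-1 : ℤ), mul_neg_one, neg_smul]
      abel
  have hdiv : ∀ i : ℕ, ∀ x ∈ X₁, ∀ y,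
      b (divT d i x) y - (-1 : ℤ) ^ i • b x (divT d i y) ∈ I := fun i x hx y => by
    have := hpow i x hx ((i.factorial : K)⁻¹ • y)
    rwa [← hb, T_pow_smul_natCast_inv_smul] at this
  -- The vectors for which the claim already holds; `hI` makes them stable under `T`.
  let X₀ : Submodule (TwistedPoly d) X := submoduleOfStable
    { carrier := {x | x ∈ X₁ ∧ ∀ y, b x y ∈ I}
      zero_mem' := ⟨X₁.zero_mem, fun y => by simp⟩
      add_mem' := fun {x z} hx hz => ⟨X₁.add_mem hx.1 hz.1, fun y => by
        rw [map_add]; exact I.add_mem (hx.2 y) (hz.2 y)⟩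
      neg_mem' := fun {x} hx => ⟨X₁.neg_mem hx.1, fun y => by
        rw [map_neg]; exact I.neg_mem (hx.2 y)⟩ }
    (fun c x hx => ⟨C_smul_mem d X₁ hx.1 c, fun y => by rw [hb]; exact hx.2 _⟩)
    (fun x hx => ⟨X₁.smul_mem _ hx.1, fun y => by
      have := I.sub_mem (hI x hx.1 y) (hx.2 (T d • y))
      rwa [add_sub_cancel_right] at this⟩)
  by_contra! hcon
  obtain ⟨x, hx, y₀, hy₀⟩ := hcon
  let B : Submodule (TwistedPoly d) X := Submodule.span (TwistedPoly d) {x} ⊔ X₀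
  have hxB : x ∈ B := Submodule.mem_sup_left (Submodule.mem_span_singleton_self x)
  have hBX : B ≤ X₁ := sup_le ((Submodule.span_singleton_le_iff_mem _ _).2 hx) fun z hz => hz.1
  have hΛB : ∀ s t, divLattice X₀ x s t ≤ B.toAddSubgroup := fun s t =>
    divLattice_le (fun z hz => Submodule.mem_sup_right hz)
      fun q i _ => C_smul_mem d B (divT_mem d B hxB i) q
  have hT1 : ∀ z : X, T d • z = divT d 1 z := fun z => by simp [divT_apply]
  -- The vectors of gauge zero for some `s < r`. It is enough to prove that `Z` is not all of `B`
  -- and that `B / Z` has radius at least `r`, since this contradicts `hX`.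
  let Z : Submodule (TwistedPoly d) X := submoduleOfStable
    { carrier := {z | ∃ s : ℝ, 0 < s ∧ s < r ∧ ∀ t : ℝ, 0 < t → z ∈ divLattice X₀ x s t}
      zero_mem' := ⟨r / 2, by linarith, by linarith, fun t _ => AddSubgroup.zero_mem _⟩
      add_mem' := by
        rintro z w ⟨s, hs, hsr, hz⟩ ⟨s', hs', hsr', hw⟩
        exact ⟨max s s', lt_max_of_lt_left hs, max_lt hsr hsr', fun t ht => AddSubgroup.add_mem _
          (divLattice_mono_left hs (le_max_left _ _) ht.le (hz t ht))
          (divLattice_mono_left hs' (le_max_right _ _) ht.le (hw t ht))⟩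
      neg_mem' := by
        rintro z ⟨s, hs, hsr, hz⟩
        exact ⟨s, hs, hsr, fun t ht => AddSubgroup.neg_mem _ (hz t ht)⟩ }
    (by
      rintro c z ⟨s, hs, hsr, hz⟩
      refine ⟨s, hs, hsr, fun t ht => ?_⟩
      by_cases hc : c = 0
      · rw [hc, zero_smul]; exact AddSubgroup.zero_mem _
      · have := smul_mem_divLattice c (hz (t / ‖c‖) (div_pos ht (norm_pos_iff.2 hc)))
        rwa [mul_div_cancel₀ _ (norm_ne_zero_iff.2 hc)] at this)
    (by
      rintro z ⟨s, hs, hsr, hz⟩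
      refine ⟨s, hs, hsr, fun t ht => ?_⟩
      obtain ⟨D, hD0, hD⟩ := hR s hs (hsr.trans_le hrR)
      have := divT_mem_divLattice hs hD hD0.le 1 (hz (t * s / D) (by positivity))
      rw [hT1]
      convert this using 2
      field_simp)
  have hZB : Z ≤ B := fun z ⟨s, _, _, hz⟩ => hΛB s 1 (hz 1 one_pos)
  refine hX Z B bot_le (lt_of_le_of_ne hZB fun heq => ?_) hBX fun s hs hsr χ hχ z hz => ?_
  · obtain ⟨s, hs, hsr, hxs⟩ : x ∈ Z := heq ▸ hxB
    obtain ⟨C, hC0, hC⟩ := (hY s hs hsr).exists_basisNorm_divT_le hR hs (hsr.trans_le hrR)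
    -- If `Z = B`, then `x` lies in every lattice for some `s`. At level `1 / (2 * C)` the bound
    -- `|q| ≤ sⁱ / (2 C)` cancels the constant `C` of `Y`, so transferring the divided powers from
    -- `x` to `y` gives a map of norm at most `1 / 2`.
    have key : ∀ z ∈ divLattice X₀ x s (1 / (2 * C)), ∃ φ : Y →+ Y,
        (∀ y, basisNorm K Y (φ y) ≤ 1 / 2 * basisNorm K Y y) ∧ ∀ y, b z y - b x (φ y) ∈ I := by
      intro z hz
      refine AddSubgroup.closure_induction (p := fun z _ => ∃ φ : Y →+ Y,
        (∀ y, basisNorm K Y (φ y) ≤ 1 / 2 * basisNorm K Y y) ∧ ∀ y, b z y - b x (φ y) ∈ I)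
        ?_ ?_ ?_ ?_ hz
      · rintro z (⟨q, i, hq, rfl⟩ | hz)
        · refine ⟨(-1 : ℤ) ^ i • (divT d i).comp (DistribSMul.toAddMonoidHom Y q),
            fun y => ?_, fun y => ?_⟩
          · have h1 : basisNorm K Y (((-1 : ℤ) ^ i • (divT d i).comp
                (DistribSMul.toAddMonoidHom Y q)) y) = basisNorm K Y (divT d i (q • y)) := by
              rcases neg_one_pow_eq_or ℤ i with h | h <;> rw [h]
              · rw [one_smul]; rfl
              · rw [neg_one_smul]
                change basisNorm K Y (-(divT d i (q • y))) = _
                rw [← neg_one_smul K, basisNorm_smul]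
                simp
            have h2 := hC i (q • y)
            rw [basisNorm_smul, ← le_div_iff₀ (pow_pos hs i)] at h2
            have hy := basisNorm_nonneg (K := K) y
            rw [h1]
            calc _ ≤ C * (‖q‖ * basisNorm K Y y) / s ^ i := h2
              _ ≤ C * ((1 / (2 * C) * s ^ i) * basisNorm K Y y) / s ^ i := by gcongr
              _ = _ := by field_simp
          · rw [hb]
            have := hdiv i x hx (q • y)
            convert this using 2
            change b x ((-1 : ℤ) ^ i • divT d i (q • y)) = _
            rw [map_zsmul]
        · exact ⟨0, fun y => by
            have := basisNorm_nonneg (K := K) y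
            rw [AddMonoidHom.zero_apply, basisNorm_zero]; positivity, fun y => by
            rw [AddMonoidHom.zero_apply, map_zero, sub_zero]; exact hz.2 y⟩
      · exact ⟨0, fun y => by
            have := basisNorm_nonneg (K := K) y
            rw [AddMonoidHom.zero_apply, basisNorm_zero]; positivity, fun y => by simp⟩
      · rintro z w _ _ ⟨φ, h1, h2⟩ ⟨ψ, h3, h4⟩
        refine ⟨φ + ψ, fun y => basisNorm_add_le (h1 y) (h3 y), fun y => ?_⟩
        have := I.add_mem (h2 y) (h4 y)
        rw [map_add, AddMonoidHom.add_apply, AddMonoidHom.add_apply, map_add]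
        convert this using 1
        abel
      · rintro z _ ⟨φ, h1, h2⟩
        refine ⟨-φ, fun y => ?_, fun y => ?_⟩
        · rw [AddMonoidHom.neg_apply, ← neg_one_smul K, basisNorm_smul, norm_neg, norm_one, one_mul]
          exact h1 y
        · have := I.neg_mem (h2 y)
          rw [map_neg, AddMonoidHom.neg_apply, AddMonoidHom.neg_apply, map_neg]
          convert this using 1
          abel
    obtain ⟨φ, hφ, hφI⟩ := key x (hxs _ (by positivity))
    -- With `z = x` in `key`, `b x (y - φ y)` lies in `I` for all `y`, and `y₀` has the form `y - φ
    -- y`.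
    obtain ⟨z, hz⟩ := exists_sub_eq_of_basisNorm_le φ hφ y₀
    refine hy₀ ?_
    rw [← hz, map_sub]
    exact hφI z
  · obtain ⟨D, hD0, hD⟩ := hR s hs (hsr.trans_le hrR)
    -- A form that vanishes on `Z` vanishes on the vectors of gauge zero for this `s`, hence is
    -- bounded by the gauge; together with `divT_mem_divLattice` this is convergence of `B / Z` at
    -- `s`.
    obtain ⟨C, hC⟩ := exists_norm_le_of_vanish_of_gauge (divLattice X₀ x s) (divLattice_mono hs)
      (fun c t _ w hw => smul_mem_divLattice c hw) χ fun w hw => hχ w ⟨s, hs, hsr, hw⟩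
    let U : Submodule (TwistedPoly d) X := submoduleOfStable
      { carrier := {z | ∃ t : ℝ, 0 < t ∧ z ∈ divLattice X₀ x s t}
        zero_mem' := ⟨1, one_pos, AddSubgroup.zero_mem _⟩
        add_mem' := by
          rintro z w ⟨t, ht, hz⟩ ⟨t', ht', hw⟩
          exact ⟨max t t', lt_max_of_lt_left ht, AddSubgroup.add_mem _
            (divLattice_mono hs (le_max_left _ _) hz) (divLattice_mono hs (le_max_right _ _) hw)⟩
        neg_mem' := by
          rintro z ⟨t, ht, hz⟩
          exact ⟨t, ht, AddSubgroup.neg_mem _ hz⟩ }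
      (by
        rintro c z ⟨t, ht, hz⟩
        exact ⟨(‖c‖ + 1) * t, by positivity, divLattice_mono hs
          (mul_le_mul_of_nonneg_right (le_add_of_nonneg_right zero_le_one) ht.le)
          (smul_mem_divLattice c hz)⟩)
      (by
        rintro z ⟨t, ht, hz⟩
        rw [hT1]
        exact ⟨D * t / s ^ 1, by positivity, divT_mem_divLattice hs hD hD0.le 1 hz⟩)
    -- The union `U` of the lattices is a submodule containing `x` and `X₀`, so the gauge is finite
    -- on all of `B`.
    have hBU : B ≤ U := by
      refine sup_le ((Submodule.span_singleton_le_iff_mem _ _).2 ⟨1, one_pos, ?_⟩)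
        fun w hw => ⟨1, one_pos, mem_divLattice_of_mem hw⟩
      have := smul_divT_mem_divLattice (d := d) (X₀ := X₀) (x := x) (s := s) (t := 1) (q := 1)
        (i := 0) (by simp)
      rwa [one_smul, divT_zero] at this
    obtain ⟨t, ht, hzt⟩ := hBU hz
    refine ⟨C * (D * t), fun i => ?_⟩
    have := hC _ (by positivity) _ (divT_mem_divLattice hs hD hD0.le i hzt)
    rwa [← mul_div_assoc, le_div_iff₀ (pow_pos hs i)] at this

end Extensions

/-! ### Splitting by radii -/

section Splitting

variable {K : Type u} [NontriviallyNormedField K] [IsUltrametricDist K] [CharZero K]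
  {d : Derivation ℤ K K} {M : Type v} [AddCommGroup M] [Module K M]
  [Module (TwistedPoly d) M] [IsScalarTower K (TwistedPoly d) M]

instance finiteDimensional_submodule [FiniteDimensional K M] (N : Submodule (TwistedPoly d) M) :
    FiniteDimensional K N := inferInstanceAs (FiniteDimensional K (N.restrictScalars K))

instance finiteDimensional_quotient [FiniteDimensional K M] (N : Submodule (TwistedPoly d) M) :
    FiniteDimensional K (M ⧸ N) :=
  Module.Finite.of_surjective (N.mkQ.restrictScalars K) N.mkQ_surjective

/-- The commutator `x ↦ T V(x) - V(T x)` of a `K`-linear endomorphism `V` with `T`. -/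
def commT : (M →ₗ[K] M) →+ (M →ₗ[K] M) where
  toFun V :=
    { toFun := fun x => T d • V x - V (T d • x)
      map_add' := fun x y => by simp only [map_add, smul_add]; abel
      map_smul' := fun c x => by
        rw [V.map_smul, T_smul_smul, T_smul_smul, map_add, V.map_smul, V.map_smul, smul_sub,
          RingHom.id_apply]
        abel }
  map_zero' := by ext; simp
  map_add' V W := by ext x; simp; abel

theorem commT_apply (V : M →ₗ[K] M) (x : M) : commT (d := d) V x = T d • V x - V (T d • x) := rfl

theorem commT_smulRight (χ : M →ₗ[K] K) (y : M) : commT (d := d) (χ.smulRight y) =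
    (T d • χ).smulRight y + χ.smulRight (T d • y) := by
  ext x
  simp only [commT_apply, LinearMap.smulRight_apply, LinearMap.add_apply, dual₀_T_smul_apply,
    T_smul_smul, sub_smul]
  abel

/-- The `K`-linear endomorphisms of `M` that vanish on `L` and have values in `L`. -/
def homThrough (L : Submodule (TwistedPoly d) M) : AddSubgroup (M →ₗ[K] M) where
  carrier := {V | (∀ x ∈ L, V x = 0) ∧ ∀ x, V x ∈ L}
  zero_mem' := ⟨fun _ _ => rfl, fun _ => L.zero_mem⟩
  add_mem' h1 h2 := ⟨fun x hx => by rw [LinearMap.add_apply, h1.1 x hx, h2.1 x hx, add_zero],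
    fun x => L.add_mem (h1.2 x) (h2.2 x)⟩
  neg_mem' h := ⟨fun x hx => by rw [LinearMap.neg_apply, h.1 x hx, neg_zero],
    fun x => L.neg_mem (h.2 x)⟩

theorem smulRight_mem_homThrough {L : Submodule (TwistedPoly d) M} {χ : M →ₗ[K] K} {y : M}
    (hχ : χ ∈ dualAnn L) (hy : y ∈ L) : χ.smulRight y ∈ homThrough L :=
  ⟨fun x hx => by rw [LinearMap.smulRight_apply, mem_dualAnn.1 hχ x hx, zero_smul],
    fun _ => C_smul_mem d L hy _⟩

/-- The commutator of `T` with a `K`-linear projection `ρ` onto `L` is the extension class. If it is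
also the commutator of some `V` that factors through `M / L → L`, then `ρ - V` is a projection
commuting with `T`, and its kernel is a complement. -/
theorem exists_isCompl_of_homThrough_le {L : Submodule (TwistedPoly d) M}
    (h : homThrough L ≤ (homThrough L).map (commT (d := d))) : ∃ L', IsCompl L L' := by
  obtain ⟨π, hπ⟩ := (L.restrictScalars K).subtype.exists_leftInverse_of_injective
    (L.restrictScalars K).ker_subtype
  have hπL : ∀ x (hx : x ∈ L), ((π x : L.restrictScalars K) : M) = x := fun x hx =>
    congr_arg Subtype.val (LinearMap.congr_fun hπ ⟨x, hx⟩)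
  set ρ : M →ₗ[K] M := (L.restrictScalars K).subtype ∘ₗ π with hρ
  have hρL : ∀ x ∈ L, ρ x = x := hπL
  have hρm : ∀ x, ρ x ∈ L := fun x => (π x).2
  obtain ⟨V, hV, hVU⟩ := h (x := commT (d := d) ρ) ⟨fun x hx => by
      rw [commT_apply, hρL x hx, hρL _ (L.smul_mem _ hx), sub_self],
    fun x => L.sub_mem (L.smul_mem _ (hρm x)) (hρm _)⟩
  have hcomm : ∀ x, T d • (ρ x - V x) = ρ (T d • x) - V (T d • x) := fun x => by
    have := LinearMap.congr_fun hVU x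
    rw [commT_apply, commT_apply] at this
    rw [smul_sub, sub_eq_sub_iff_sub_eq_sub, ← this]
  let f : M →ₗ[TwistedPoly d] L := mkLinear
    { toFun := fun x => ⟨ρ x - V x, L.sub_mem (hρm x) (hV.2 x)⟩
      map_zero' := by ext; simp
      map_add' := fun x y => by
        ext
        simp only [map_add, Submodule.coe_add]
        abel }
    (fun c x => Subtype.ext (by
      change ρ (C d c • x) - V (C d c • x) = C d c • (ρ x - V x)
      rw [← smul_def, ← smul_def, map_smul, map_smul, smul_sub]))
    (fun x => Subtype.ext (hcomm x).symm)
  refine ⟨f.ker, LinearMap.isCompl_of_proj fun x => Subtype.ext ?_⟩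
  change ρ x - V x = x
  rw [hρL x x.2, hV.1 x x.2, sub_zero]

variable [FiniteDimensional K M]

theorem homThrough_le_of_smulRight_mem {L : Submodule (TwistedPoly d) M}
    (I : AddSubgroup (M →ₗ[K] M)) (h : ∀ χ ∈ dualAnn L, ∀ y ∈ L, χ.smulRight y ∈ I) :
    homThrough L ≤ I := by
  intro U hU
  let e := Module.finBasis K (L.restrictScalars K)
  let U' : M →ₗ[K] L.restrictScalars K := U.codRestrict _ hU.2
  have hsum : U = ∑ j, (e.coord j ∘ₗ U').smulRight (e j : M) := by
    ext x
    have h1 := congr_arg (L.restrictScalars K).subtype (e.sum_repr (U' x))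
    rw [map_sum] at h1
    rw [LinearMap.sum_apply]
    exact h1.symm
  rw [hsum]
  refine I.sum_mem fun j _ => h _ (mem_dualAnn.2 fun x hx => ?_) _ (e j).2
  have : U' x = 0 := Subtype.ext (hU.1 x hx)
  rw [LinearMap.comp_apply, this, map_zero]

variable {R r : ℝ}

theorem isNoetherian_twistedPoly : IsNoetherian (TwistedPoly d) M := isNoetherian_of_tower K
  (inferInstance : IsNoetherian K M)

theorem isArtinian_twistedPoly : IsArtinian (TwistedPoly d) M := isArtinian_of_tower K
  (inferInstance : IsArtinian K M)

theorem radLT_of_covBy {A B : Submodule (TwistedPoly d) M} (h : A ⋖ B) (hn : ¬ RadGE d r A B) :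
    RadLT d r A B := by
  intro X Y hX hXY hY hGE
  have h1 : X = A := (h.eq_or_eq hX (hXY.le.trans hY)).resolve_right fun he =>
    absurd (he ▸ hXY.trans_le hY) (lt_irrefl _)
  have h2 : Y = B := (h.eq_or_eq (hX.trans hXY.le) hY).resolve_left fun he =>
    absurd (h1 ▸ he ▸ hXY) (lt_irrefl _)
  exact hn (h1 ▸ h2 ▸ hGE)

variable [CompleteSpace K]

/-- The annihilator of `L` is the dual of `M / L`, so it has only small radii and plays the role of
`X₁`, with `Y = L`. The pairing is `χ ⊗ y`, and `I` consists of the commutators; `commT_smulRight`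
is the required congruence. -/
theorem exists_isCompl_of_radGE_radLT (hR : TaylorBounded d R) (hrR : r ≤ R) (hr : 0 < r)
    {L : Submodule (TwistedPoly d) M} (h1 : RadGE d r ⊥ L) (h2 : RadLT d r L ⊤) :
    ∃ L', IsCompl L L' := by
  refine exists_isCompl_of_homThrough_le (homThrough_le_of_smulRight_mem _ ?_)
  have hX : RadLT d r ⊥ (dualAnn L) := (h2.dualAnn hR hrR).mono (fun χ hχ => by
    rw [Submodule.mem_bot]
    ext x
    exact mem_dualAnn.1 hχ x trivial) le_rfl
  have := pairing_mem_of_radLT_of_radGE hR hrR hr hX (radGE_bot_top_subtype.2 h1)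
    (H := M →ₗ[K] M)
    { toFun := fun χ => { toFun := fun y => χ.smulRight (y : M)
                          map_zero' := by ext; simp
                          map_add' := fun y z => by ext; simp }
      map_zero' := by ext; simp
      map_add' := fun χ ψ => by ext; simp [add_smul] }
    (fun c χ y => by
      ext x
      change (c • χ x) • (y : M) = χ x • c • (y : M)
      rw [smul_eq_mul, mul_comm, mul_smul])
    ((homThrough L).map (commT (d := d)))
    (fun χ hχ y => ⟨χ.smulRight (y : M), smulRight_mem_homThrough hχ y.2, commT_smulRight χ y⟩)
  exact fun χ hχ y hy => this χ hχ ⟨y, hy⟩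

/-- The same pairing with the roles exchanged: `L` is now `X₁`, and the annihilator of `L` is the
factor of large radius. -/
theorem exists_isCompl_of_radLT_radGE (hR : TaylorBounded d R) (hrR : r ≤ R) (hr : 0 < r)
    {L : Submodule (TwistedPoly d) M} (h1 : RadLT d r ⊥ L) (h2 : RadGE d r L ⊤) :
    ∃ L', IsCompl L L' := by
  refine exists_isCompl_of_homThrough_le (homThrough_le_of_smulRight_mem _ ?_)
  have hY : RadGE d r ⊥ (dualAnn L) := (h2.dualAnn hR hrR).mono (fun χ hχ => by
    rw [Submodule.mem_bot]
    ext x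
    exact mem_dualAnn.1 hχ x trivial) le_rfl
  have := pairing_mem_of_radLT_of_radGE hR hrR hr h1 (radGE_bot_top_subtype.2 hY)
    (H := M →ₗ[K] M)
    { toFun := fun y => { toFun := fun χ => (χ : M →ₗ[K] K).smulRight y
                          map_zero' := by ext; simp
                          map_add' := fun χ ψ => by ext; simp [add_smul] }
      map_zero' := by ext; simp
      map_add' := fun y z => by ext; simp }
    (fun c y χ => by
      ext x
      change (χ : M →ₗ[K] K) x • c • y = (c • (χ : M →ₗ[K] K) x) • y
      rw [smul_eq_mul, mul_comm, mul_smul])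
    ((homThrough L).map (commT (d := d)))
    (fun y hy χ => ⟨(χ : M →ₗ[K] K).smulRight y, smulRight_mem_homThrough χ.2 hy,
      (commT_smulRight _ y).trans (add_comm _ _)⟩)
  exact fun χ hχ y hy => this y hy ⟨χ, hχ⟩

theorem exists_complement_of_exists_isCompl {L N : Submodule (TwistedPoly d) M} (hLN : L ≤ N)
    (h : ∃ L', IsCompl (L.comap N.subtype) L') : ∃ L' ≤ N, L' ⊔ L = N ∧ L' ⊓ L = ⊥ := by
  obtain ⟨L', hL'⟩ := h
  have hL : (L.comap N.subtype).map N.subtype = L := by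
    rw [Submodule.map_comap_subtype, inf_eq_right]
    exact hLN
  refine ⟨L'.map N.subtype, Submodule.map_subtype_le _ _, ?_, ?_⟩
  · conv_lhs => rw [← hL]
    rw [← Submodule.map_sup, sup_comm, hL'.sup_eq_top, Submodule.map_subtype_top]
  · conv_lhs => rw [← hL]
    rw [← Submodule.map_inf _ N.subtype_injective, inf_comm, hL'.inf_eq_bot, Submodule.map_bot]

theorem exists_complement_of_radGE_radLT (hR : TaylorBounded d R) (hrR : r ≤ R) (hr : 0 < r)
    {L N : Submodule (TwistedPoly d) M} (hLN : L ≤ N) (h1 : RadGE d r ⊥ L) (h2 : RadLT d r L N) :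
    ∃ L' ≤ N, L' ⊔ L = N ∧ L' ⊓ L = ⊥ := by
  have hL : (L.comap N.subtype).map N.subtype = L := by
    rw [Submodule.map_comap_subtype, inf_eq_right]
    exact hLN
  refine exists_complement_of_exists_isCompl hLN (exists_isCompl_of_radGE_radLT hR hrR hr ?_ ?_)
  · rwa [← radGE_map_subtype, hL, Submodule.map_bot]
  · rwa [← radLT_map_subtype, hL, Submodule.map_subtype_top]

theorem exists_complement_of_radLT_radGE (hR : TaylorBounded d R) (hrR : r ≤ R) (hr : 0 < r)
    {L N : Submodule (TwistedPoly d) M} (hLN : L ≤ N) (h1 : RadLT d r ⊥ L) (h2 : RadGE d r L N) :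
    ∃ L' ≤ N, L' ⊔ L = N ∧ L' ⊓ L = ⊥ := by
  have hL : (L.comap N.subtype).map N.subtype = L := by
    rw [Submodule.map_comap_subtype, inf_eq_right]
    exact hLN
  refine exists_complement_of_exists_isCompl hLN (exists_isCompl_of_radLT_radGE hR hrR hr ?_ ?_)
  · rwa [← radLT_map_subtype, hL, Submodule.map_bot]
  · rwa [← radGE_map_subtype, hL, Submodule.map_subtype_top]

/-- Every submodule is the sum of a submodule of radius at least `r` and one whose nonzero
subquotients have radius less than `r`. -/
theorem exists_radGE_sup_radLT (hp : 0 < residueChar K) [IsBoundedDerivation d]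
    (hR : TaylorBounded d R) (hrR : r ≤ R) (hr : 0 < r) (N : Submodule (TwistedPoly d) M) :
    ∃ G L, RadGE d r ⊥ G ∧ RadLT d r ⊥ L ∧ G ⊔ L = N := by
  have := isNoetherian_twistedPoly (K := K) (d := d) (M := M)
  have := isArtinian_twistedPoly (K := K) (d := d) (M := M)
  let S : Set (Submodule (TwistedPoly d) M) :=
    {W | W ≤ N ∧ ∃ G L, RadGE d r ⊥ G ∧ RadLT d r ⊥ L ∧ G ⊔ L = W}
  -- A maximal decomposable `W` must be `N`: otherwise a cover `B` of `W` inside `N` has simple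
  -- quotient `B / W`, which is added to one of the two parts.
  obtain ⟨W, ⟨hWN, G, L, hG, hL, rfl⟩, hmax⟩ :=
    (wellFounded_gt (α := Submodule (TwistedPoly d) M)).has_min S
      ⟨⊥, bot_le, ⊥, ⊥, radGE_bot, radLT_self, bot_sup_eq _⟩
  by_cases hW : G ⊔ L = N
  · exact ⟨G, L, hG, hL, hW⟩
  obtain ⟨B, hB, hBN⟩ := exists_covBy_le_of_lt (lt_of_le_of_ne hWN hW)
  exfalso
  have hGL : RadGE d r L (G ⊔ L) := by simpa using hG.sup L
  have hLG : RadLT d r G (G ⊔ L) := by simpa [sup_comm] using hL.sup bot_le G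
  by_cases h : RadGE d r (G ⊔ L) B
  -- If `B / W` has radius at least `r`, so has `B / L`, and `L` splits off from `B`; otherwise `B /
  -- G` has only smaller radii and `G` splits off.
  · have hLB := RadGE.trans hp hR hrR hGL h
    obtain ⟨L', hL'B, hsup, hinf⟩ := exists_complement_of_radLT_radGE hR hrR hr
      (le_sup_right.trans hB.le) hL hLB
    refine hmax B ⟨hBN, L', L, ?_, hL, hsup⟩ hB.lt
    have := hLB.inf L'
    rwa [inf_comm, hinf, inf_eq_right.2 hL'B] at this
  · have hGB := hLG.trans (radLT_of_covBy hB h) le_sup_left hB.le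
    obtain ⟨L', hL'B, hsup, hinf⟩ := exists_complement_of_radGE_radLT hR hrR hr
      (le_sup_left.trans hB.le) hG hGB
    refine hmax B ⟨hBN, G, L', hG, ?_, by rw [sup_comm, hsup]⟩ hB.lt
    have := hGB.inf (le_sup_left.trans hB.le) L'
    rwa [inf_comm, hinf, inf_eq_right.2 hL'B] at this

end Splitting

/-! ### Generic radii and multiplicities -/

section GenericRadius

variable {K : Type u} [NontriviallyNormedField K] [IsUltrametricDist K] [CharZero K]
  (d : Derivation ℤ K K)

/-- The subquotient `B / A` is pure of radius `r`: it has radius at least `r`, and none of its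
nonzero subquotients has a larger radius. -/
def PureOn {M : Type v} [AddCommGroup M] [Module K M] [Module (TwistedPoly d) M]
    [IsScalarTower K (TwistedPoly d) M] (r : ℝ) (A B : Submodule (TwistedPoly d) M) : Prop :=
  RadGE d r A B ∧ ∀ r', r < r' → r' ≤ rad d → RadLT d r' A B

variable {d} [IsBoundedDerivation d]

theorem taylorBounded_rad (hp : 0 < residueChar K) (hd : d ≠ 0) : TaylorBounded d (rad d) :=
  fun _ hs hsr => exists_norm_divPow_le hp d hd hs hsr

variable {M : Type v} [AddCommGroup M] [Module K M] [Module (TwistedPoly d) M]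
  [IsScalarTower K (TwistedPoly d) M] [FiniteDimensional K M]

theorem exists_basisNorm_T_pow_le {μ : ℝ}
    (h : specNormWrt (basisNorm K M) (fun x => T d • x) < μ) :
    ∃ C : ℝ, 0 < C ∧ ∀ (n : ℕ) (x : M),
      basisNorm K M (T d ^ n • x) ≤ C * μ ^ n * basisNorm K M x := by
  obtain ⟨B, hB, hT⟩ := exists_basisNorm_T_smul_le (d := d) (M := M)
  obtain ⟨C, hC, hb⟩ := exists_iterate_le_of_specNormWrt_lt basisNorm_zero basisNorm_pos hB.le hT h
  exact ⟨C, hC, fun n x => by rw [← T_smul_iterate]; exact hb n x⟩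

/-- For a fixed `x ≠ 0`, `pairing_iterate` writes `∂ⁿ(c) x` as an integral combination of terms
`Tⁱ(c Tʲx)` with `i + j = n`, so any rate `μ` for `T` is also one for `∂`. -/
theorem specNormWrt_derivation_le (hp : 0 < residueChar K) [Nontrivial M] :
    specNormWrt (fun x : K => ‖x‖) d ≤ specNormWrt (basisNorm K M) fun x => T d • x := by
  refine le_of_forall_gt_imp_ge_of_dense fun μ hμ => ?_
  have hμ0 : 0 < μ := (specNormWrt_nonneg basisNorm_zero basisNorm_pos _).trans_lt hμ
  have hω := omega_pos hp
  obtain ⟨C, hC, hb⟩ := exists_basisNorm_T_pow_le hμ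
  obtain ⟨x, hx⟩ := exists_ne (0 : M)
  have hx0 := basisNorm_pos (K := K) x hx
  have key : ∀ (n : ℕ) (c : K), ‖d^[n] c‖ ≤ C * C * μ ^ n * ‖c‖ := fun n c => by
    have h := pairing_iterate (A := K) (B := M) (H := M)
      { toFun := fun c => DistribSMul.toAddMonoidHom M c
        map_zero' := by ext; simp
        map_add' := fun a b => by ext; simp [add_smul] } d (fun x => T d • x)
      (DistribSMul.toAddMonoidHom M (T d))
      (fun c x => by
        change T d • c • x = d c • x + c • T d • x
        rw [T_smul_smul, add_comm]) n c x
    change d^[n] c • x = _ at h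
    rw [← mul_le_mul_iff_left₀ hx0, ← basisNorm_smul, h]
    refine basisNorm_sum_le (by positivity) fun ij hij => ?_
    rw [Finset.HasAntidiagonal.mem_antidiagonal] at hij
    have h1 : (⇑(DistribSMul.toAddMonoidHom M (T d)))^[ij.1] ((-1 : ℤ) ^ ij.2 •
        c • (fun x => T d • x)^[ij.2] x) = (-1 : K) ^ ij.2 • T d ^ ij.1 • c • T d ^ ij.2 • x := by
      rw [iterate_map_zsmul, T_smul_iterate, ← Int.cast_smul_eq_zsmul K]
      push_cast
      exact congr_arg _ (T_smul_iterate (d := d) ij.1 _)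
    change basisNorm K M (_ • (⇑(DistribSMul.toAddMonoidHom M (T d)))^[ij.1] ((-1 : ℤ) ^ ij.2 •
        c • (fun x => T d • x)^[ij.2] x)) ≤ _
    rw [h1, ← Nat.cast_smul_eq_nsmul K, basisNorm_smul, basisNorm_smul, norm_pow, norm_neg,
      norm_one, one_pow, one_mul]
    calc _ ≤ basisNorm K M (T d ^ ij.1 • c • T d ^ ij.2 • x) :=
          mul_le_of_le_one_left (basisNorm_nonneg _) (norm_natCast_le_one' _)
      _ ≤ C * μ ^ ij.1 * (‖c‖ * (C * μ ^ ij.2 * basisNorm K M x)) := by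
          refine (hb _ _).trans ?_
          rw [basisNorm_smul]
          gcongr
          exact hb _ _
      _ = C * C * μ ^ n * ‖c‖ * basisNorm K M x := by rw [← hij, pow_add]; ring
  have := specNormWrt_le_of_factorial hp (f := d) (C := C * C) (s := omega K / μ) norm_zero
    (fun _ => norm_pos_iff.2) (by positivity) (by positivity) fun n c => by
      calc ‖d^[n] c‖ * (omega K / μ) ^ n ≤ C * C * μ ^ n * ‖c‖ * (omega K / μ) ^ n := by
            gcongr; exact key n c
        _ = C * C * omega K ^ n * ‖c‖ := by rw [div_pow]; field_simp
        _ ≤ _ := by gcongr; exact omega_pow_le_norm_factorial hp n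
  rwa [div_div_cancel₀ hω.ne'] at this

theorem specNormWrt_T_pos (hp : 0 < residueChar K) (hd : d ≠ 0) [Nontrivial M] :
    0 < specNormWrt (basisNorm K M) fun x => T d • x :=
  (specNormWrt_derivation_pos hp d hd).trans_le (specNormWrt_derivation_le hp)

theorem genRad_mem (hp : 0 < residueChar K) (hd : d ≠ 0) [Nontrivial M] :
    genRad d M ∈ Set.Ioc 0 (rad d) :=
  ⟨div_pos (omega_pos hp) (specNormWrt_T_pos hp hd),
    div_le_div_of_nonneg_left (omega_pos hp).le (specNormWrt_derivation_pos hp d hd)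
      (specNormWrt_derivation_le hp)⟩

theorem radGE_genRad (hp : 0 < residueChar K) (hd : d ≠ 0) [Nontrivial M] :
    RadGE d (genRad d M) (⊥ : Submodule (TwistedPoly d) M) ⊤ := by
  intro s hs hsr χ _ x _
  rw [genRad, lt_div_comm₀ hs (specNormWrt_T_pos hp hd)] at hsr
  obtain ⟨C, hC, hb⟩ := exists_basisNorm_T_pow_le hsr
  obtain ⟨E, hE, hχ⟩ := exists_norm_le_basisNorm χ
  refine bddDivT_of_norm_T_pow_le hp hs (C := E * (C * basisNorm K M x)) fun n => ?_
  refine (hχ _).trans ((mul_le_mul_of_nonneg_left (hb n x) hE.le).trans (le_of_eq ?_))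
  ring

/-- With `radGE_genRad`, this identifies the generic radius of any nonzero module, irreducible or
not, as the largest admissible `r`. The bound `r ≤ rad d` is needed so that the scalars themselves
converge. -/
theorem le_genRad_of_radGE (hp : 0 < residueChar K) (hd : d ≠ 0) [Nontrivial M] {r : ℝ}
    (hr : r ≤ rad d) (h : RadGE d r (⊥ : Submodule (TwistedPoly d) M) ⊤) : r ≤ genRad d M := by
  refine le_of_forall_lt_imp_le_of_dense fun s hsr => ?_
  rcases le_or_gt s 0 with hs | hs
  · exact hs.trans (genRad_mem hp hd).1.le
  obtain ⟨C, hC, hb⟩ := (h s hs hsr).exists_basisNorm_divT_le (taylorBounded_rad hp hd) hs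
    (hsr.trans_le hr)
  rw [genRad, le_div_comm₀ hs (specNormWrt_T_pos hp hd)]
  refine specNormWrt_le_of_factorial hp basisNorm_zero basisNorm_pos hC.le hs fun n x => ?_
  rw [T_smul_iterate, T_pow_smul_eq, basisNorm_smul, mul_assoc, mul_comm C, mul_assoc]
  exact mul_le_mul_of_nonneg_left (hb n x) (norm_nonneg _)

theorem nontrivial_quotient_of_lt {A B : Submodule (TwistedPoly d) M} (h : A < B) :
    Nontrivial (B ⧸ A.submoduleOf B) := by
  refine Submodule.Quotient.nontrivial_iff.2 fun htop => ?_
  exact absurd (Submodule.submoduleOf_eq_top.1 htop) (not_le_of_gt h)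

theorem radGE_quotient {A B : Submodule (TwistedPoly d) M} (h : A ≤ B) {r : ℝ} :
    RadGE d r (⊥ : Submodule (TwistedPoly d) (B ⧸ A.submoduleOf B)) ⊤ ↔ RadGE d r A B := by
  refine forall_congr' fun s => forall_congr' fun _ => forall_congr' fun _ => ?_
  rw [convOn_quotient, ← convOn_map_subtype, Submodule.map_subtype_top, Submodule.submoduleOf,
    Submodule.map_comap_subtype, inf_eq_right.2 h]

theorem pureOn_of_covBy (hp : 0 < residueChar K) (hd : d ≠ 0) {A B : Submodule (TwistedPoly d) M}
    (h : A ⋖ B) : PureOn d (genRad d (B ⧸ A.submoduleOf B)) A B := by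
  have := nontrivial_quotient_of_lt h.lt
  refine ⟨(radGE_quotient h.le).1 (radGE_genRad hp hd), fun r' hr' hr'R =>
    radLT_of_covBy h fun hGE => ?_⟩
  exact absurd (le_genRad_of_radGE hp hd hr'R ((radGE_quotient h.le).2 hGE)) (not_le.2 hr')

theorem genRad_eq_of_pureOn (hp : 0 < residueChar K) (hd : d ≠ 0)
    {A B : Submodule (TwistedPoly d) M} (h : A < B) {r : ℝ} (hr : r ≤ rad d)
    (hpure : PureOn d r A B) : genRad d (B ⧸ A.submoduleOf B) = r := by
  have := nontrivial_quotient_of_lt h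
  refine le_antisymm (not_lt.1 fun hlt => ?_)
    (le_genRad_of_radGE hp hd hr ((radGE_quotient h.le).2 hpure.1))
  exact hpure.2 _ hlt (genRad_mem hp hd).2 A B le_rfl h le_rfl
    ((radGE_quotient h.le).1 (radGE_genRad hp hd))

theorem PureOn.trans (hp : 0 < residueChar K) (hd : d ≠ 0) {A B C : Submodule (TwistedPoly d) M}
    {r : ℝ} (hr : r ≤ rad d) (h1 : PureOn d r A B) (h2 : PureOn d r B C) (hAB : A ≤ B)
    (hBC : B ≤ C) : PureOn d r A C :=
  ⟨h1.1.trans hp (taylorBounded_rad hp hd) hr h2.1,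
    fun r' h h' => (h1.2 r' h h').trans (h2.2 r' h h') hAB hBC⟩

theorem PureOn.mono {A B A' B' : Submodule (TwistedPoly d) M} {r : ℝ} (h : PureOn d r A B)
    (hA : A ≤ A') (hB : B' ≤ B) : PureOn d r A' B' :=
  ⟨h.1.mono hA hB, fun r' h1 h2 => (h.2 r' h1 h2).mono hA hB⟩

theorem pureOn_bot_top_subtype {r : ℝ} {N : Submodule (TwistedPoly d) M} :
    PureOn d r (⊥ : Submodule (TwistedPoly d) N) ⊤ ↔ PureOn d r ⊥ N :=
  and_congr radGE_bot_top_subtype (forall_congr' fun _ => forall_congr' fun _ =>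
    forall_congr' fun _ => radLT_bot_top_subtype)

/-- The module `M` is pure of radius `r` if and only if the support of `m(M)` is contained
in `{r}`. -/
theorem suppMult_subset_singleton_iff (hp : 0 < residueChar K) (hd : d ≠ 0) {r : ℝ}
    (hr : r ∈ Set.Ioc 0 (rad d)) :
    suppMult d M ⊆ {r} ↔ PureOn d r (⊥ : Submodule (TwistedPoly d) M) ⊤ := by
  have := isNoetherian_twistedPoly (K := K) (d := d) (M := M)
  have := isArtinian_twistedPoly (K := K) (d := d) (M := M)
  have h : ∃ s : CompositionSeries (Submodule (TwistedPoly d) M), s.head = ⊥ ∧ s.last = ⊤ :=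
    exists_compositionSeries_of_isNoetherian_isArtinian _ _
  have hmult : ∀ ρ, mult d M ρ ≠ 0 ↔ ∃ i, genRad d (factor d h.choose i) = ρ := fun ρ => by
    rw [mult, dif_pos h, ne_eq, Finset.sum_eq_zero_iff, not_forall]
    refine exists_congr fun i => ?_
    have : Nontrivial (factor d h.choose i) := nontrivial_quotient_of_lt (h.choose.step i).lt
    -- Factors have positive dimension, so no radius that occurs is lost in the sum of dimensions.
    have hf : Module.finrank K (factor d h.choose i) ≠ 0 := Module.finrank_pos.ne'
    by_cases hi : genRad d (factor d h.choose i) = ρ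
    · simp [hi, hf]
    · simp [hi]
  have hsupp : suppMult d M ⊆ {r} ↔ ∀ i, genRad d (factor d h.choose i) = r := by
    constructor
    · intro hs i
      have : Nontrivial (factor d h.choose i) := nontrivial_quotient_of_lt (h.choose.step i).lt
      exact hs ⟨genRad_mem hp hd, (hmult _).2 ⟨i, rfl⟩⟩
    · rintro hs ρ ⟨_, hρ⟩
      obtain ⟨i, rfl⟩ := (hmult ρ).1 hρ
      exact hs i
  rw [hsupp]
  obtain ⟨hhead, hlast⟩ := h.choose_spec
  constructor
  · intro hs
    have key : ∀ i : Fin (h.choose.length + 1), PureOn d r ⊥ (h.choose i) := by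
      intro i
      induction i using Fin.induction with
      | zero =>
        have : h.choose 0 = ⊥ := hhead
        rw [this]
        exact ⟨radGE_bot, fun _ _ _ => radLT_self⟩
      | succ i ih =>
        refine ih.trans hp hd hr.2 ?_ bot_le (h.choose.step i).le
        rw [← hs i]
        exact pureOn_of_covBy hp hd (h.choose.step i)
    have := key (Fin.last _)
    rwa [show h.choose (Fin.last _) = ⊤ from hlast] at this
  · intro hpure i
    exact genRad_eq_of_pureOn hp hd (h.choose.step i).lt hr.2 (hpure.mono bot_le le_top)

end GenericRadius

/-! ### The functors `F_{[r,r]}` and the decomposition by radii -/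

section Fat

variable {K : Type u} [NontriviallyNormedField K] [IsUltrametricDist K] [CharZero K]
  {d : Derivation ℤ K K} {M : Type v} [AddCommGroup M] [Module K M]
  [Module (TwistedPoly d) M] [IsScalarTower K (TwistedPoly d) M]

theorem coord_zero_T_pow_smul (i : ℕ) (a : F₀L₀ d) :
    coord 0 (T d ^ i • a) = (i.factorial : K) * coord i a := by
  induction i generalizing a with
  | zero => simp
  | succ i ih =>
    rw [pow_succ, mul_smul, ih, F₀L₀.coord_T_smul, Nat.factorial_succ]
    push_cast
    ring

theorem coord_dual_apply (i : ℕ) (s : Dual d M) (y : M) :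
    coord i (s y) = dualPhi d M s (divT d i y) := by
  rw [divT_apply, LinearMap.map_smul_of_tower, dualPhi_apply, map_smul, coord_zero_T_pow_smul,
    smul_eq_mul, inv_mul_cancel_left₀ (natCast_factorial_ne_zero i)]

/-- Through `Φ`, the coordinates of `c_M(x)(s)` are divided powers acting on the dual side.
`bddDivT_iff_dual` then translates the definition of `F_{[r,r(K,∂)]}` into convergence of `x`. -/
theorem coord_biDual_eq (i : ℕ) (x : M) (s : Dual d M) :
    coord i (biDual d M x s) = (divT d i (dualPhi d M s)) x := by
  rw [coord_biDual, ← map_divT]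
  rfl

theorem dualPhi_dualPsi (χ : M →ₗ[K] K) : dualPhi d M (dualPsi d M χ) = χ := by
  ext x
  rw [dualPhi_apply, coord_dualPsi]
  simp

theorem mem_boundedSeries_iff_coord {s : ℝ} {a : F₀L₀ d} :
    ser a ∈ boundedSeries K s ↔ ∃ B : ℝ, ∀ i, ‖coord i a‖ * s ^ i ≤ B := boundedSeries_iff

variable {R s r : ℝ}

theorem BddDivT.anti {s' : ℝ} {χ : M →ₗ[K] K} {x : M} (h : BddDivT d s χ x) (hs' : 0 < s')
    (hs's : s' ≤ s) : BddDivT d s' χ x := by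
  obtain ⟨C, hC⟩ := h
  exact ⟨C, fun i => le_trans (by gcongr) (hC i)⟩

/-- The elements of `M` whose images in `M / A` converge at `s`. -/
def convSubmodule (hR : TaylorBounded d R) (hs : 0 < s) (hsR : s < R)
    (A : Submodule (TwistedPoly d) M) : Submodule (TwistedPoly d) M :=
  submoduleOfStable
    { carrier := {x | ∀ χ : M →ₗ[K] K, (∀ a ∈ A, χ a = 0) → BddDivT d s χ x}
      zero_mem' := fun _ _ => bddDivT_zero
      add_mem' := fun hx hy χ hχ => (hx χ hχ).add hs (hy χ hχ)
      neg_mem' := fun {x} hx χ hχ => by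
        rw [← neg_one_smul K]
        exact (hx χ hχ).smul hR hs hsR _ }
    (fun c _ hx χ hχ => (hx χ hχ).smul hR hs hsR c) (fun _ hx χ hχ => (hx χ hχ).T_smul hs)

variable [IsBoundedDerivation d]

theorem mem_FfromTop_iff (hR : TaylorBounded d R) (hrR : r ≤ R) {x : M} :
    x ∈ FfromTop d M r ↔ ∀ s, 0 < s → s < r → ∀ χ : M →ₗ[K] K, BddDivT d s χ x := by
  constructor
  · intro h s hs hsr χ
    obtain ⟨B, hB⟩ := mem_boundedSeries_iff_coord.1 (h (dualPsi d M χ) s hs hsr)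
    refine (bddDivT_iff_dual hR hs (hsr.trans_le hrR) χ x).2 ⟨B, fun i => ?_⟩
    have := hB i
    rwa [coord_biDual_eq, dualPhi_dualPsi] at this
  · intro h t s hs hsr
    obtain ⟨B, hB⟩ := (bddDivT_iff_dual hR hs (hsr.trans_le hrR) _ x).1
      (h s hs hsr (dualPhi d M t))
    refine mem_boundedSeries_iff_coord.2 ⟨B, fun i => ?_⟩
    rw [coord_biDual_eq]
    exact hB i

/-- A form that vanishes on `L` converges beyond `r`, so under `Ψ` it becomes a morphism to
`f_{r+*}L_{r+}`. The coordinate of index zero of `c_M(x)` at that morphism is the value of the form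
at `x`. -/
theorem FzeroTo_le_of_radGE {r' : ℝ} (hr : 0 < r) (hrr' : r < r') (hr' : r' ≤ rad d)
    {L : Submodule (TwistedPoly d) M} (hL : RadGE d r' L ⊤) : FzeroTo d M r ≤ L := by
  intro x hx
  rw [FzeroTo, if_pos (hrr'.trans_le hr')] at hx
  rw [← dualCoann_dualAnn L, mem_dualCoann]
  intro χ hχ
  have h0 : biDual d M x (dualPsi d M χ) = 0 := by
    refine hx _ fun y => ⟨(r + r') / 2, by linarith, by linarith, ?_⟩
    obtain ⟨C, hC⟩ := hL ((r + r') / 2) (by linarith) (by linarith) χ (mem_dualAnn.1 hχ) y trivial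
    refine mem_boundedSeries_iff_coord.2 ⟨C, fun i => ?_⟩
    rw [coord_dual_apply, dualPhi_dualPsi]
    exact hC i
  have := coord_biDual_eq 0 x (dualPsi d M χ)
  rw [h0, map_zero, dualPhi_dualPsi, divT_zero] at this
  exact this.symm

variable [FiniteDimensional K M]

/-- A morphism to `f_{r+*}L_{r+}` gives a form `χ` that converges at some `τ > r`. The submodule of
the dual generated by `χ` converges there too, so by duality does the corresponding quotient of `M`;
purity makes it zero. -/
theorem FzeroTo_eq_top_of_pureOn (hp : 0 < residueChar K) (hd : d ≠ 0) (hr : 0 < r)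
    (h : PureOn d r (⊥ : Submodule (TwistedPoly d) M) ⊤) : FzeroTo d M r = ⊤ := by
  by_cases hrR : r < rad d
  swap
  · rw [FzeroTo, if_neg hrR]
  have hR := taylorBounded_rad hp hd
  rw [FzeroTo, if_pos hrR, eq_top_iff]
  intro x _ t ht
  suffices h0 : dualPhi d M t = 0 by
    have ht0 : t = 0 := LinearMap.ext fun y => F₀L₀.ext' fun i => by
      rw [coord_dual_apply, h0]; simp
    rw [ht0, map_zero]
  set χ := dualPhi d M t
  let e := Module.finBasis K M
  choose σ hσ0 hσr hσ using fun j => ht (e j)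
  obtain ⟨τ, ⟨hτ, hτR⟩, hτr⟩ : ∃ τ, ((∀ j, τ ≤ σ j) ∧ τ < rad d) ∧ r < τ := by
    refine (Filter.Eventually.and (Filter.Eventually.and
      (Filter.eventually_all.2 fun j => ?_) ?_) ?_ : ∀ᶠ τ in nhdsWithin r (Set.Ioi r), _).exists
    · exact nhdsWithin_le_nhds (ge_mem_nhds (hσr j))
    · exact nhdsWithin_le_nhds (gt_mem_nhds hrR)
    · exact self_mem_nhdsWithin
  have hτ0 := hr.trans hτr
  have hχ : ∀ y, BddDivT d τ χ y := fun y => by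
    rw [← e.sum_repr y]
    refine Finset.sum_induction _ (fun y => BddDivT d τ χ y) (fun _ _ => BddDivT.add hτ0)
      bddDivT_zero fun j _ => BddDivT.smul hR hτ0 hτR (BddDivT.anti ?_ hτ0 (hτ j)) _
    obtain ⟨B, hB⟩ := mem_boundedSeries_iff_coord.1 (hσ j)
    refine ⟨B, fun i => ?_⟩
    have := hB i
    rwa [coord_dual_apply] at this
  let S : Submodule (TwistedPoly d) (M →ₗ[K] K) := Submodule.span (TwistedPoly d) {χ}
  have hχS : χ ∈ S := Submodule.mem_span_singleton_self χ
  have hS : ConvOn d τ ⊥ S := by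
    have hle : S ≤ convSubmodule hR hτ0 hτR ⊥ :=
      (Submodule.span_singleton_le_iff_mem _ _).2 fun Θ _ => by
        obtain ⟨y, rfl⟩ := (Module.evalEquiv K M).surjective Θ
        exact (bddDivT_iff_dual hR hτ0 hτR χ y).1 (hχ y)
    exact fun Θ hΘ ψ hψ => hle hψ Θ hΘ
  have hconv : ConvOn d τ (dualCoann S) (⊤ : Submodule (TwistedPoly d) M) :=
    (hS.dualCoann hR hτ0 hτR).mono le_rfl fun y _ => mem_dualCoann.2 fun ψ hψ => by
      rw [(Submodule.mem_bot _).1 hψ, LinearMap.zero_apply]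
  have htop : dualCoann S = (⊤ : Submodule (TwistedPoly d) M) := by
    by_contra hne
    refine h.2 τ hτr hτR.le _ ⊤ bot_le (lt_top_iff_ne_top.2 hne) le_rfl fun s hs hsτ ψ hψ y hy => ?_
    exact (hconv ψ hψ y hy).anti hs hsτ.le
  ext y
  exact mem_dualCoann.1 (htop ▸ Submodule.mem_top : y ∈ dualCoann S) χ hχS

theorem Fat_eq_top_of_pureOn (hp : 0 < residueChar K) (hd : d ≠ 0)
    (hr : r ∈ Set.Ioc 0 (rad d)) (h : PureOn d r (⊥ : Submodule (TwistedPoly d) M) ⊤) :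
    Fat d M r = ⊤ := by
  rw [Fat, FzeroTo_eq_top_of_pureOn hp hd hr.1 h, top_inf_eq, eq_top_iff]
  intro x _
  exact (mem_FfromTop_iff (taylorBounded_rad hp hd) hr.2).2 fun s hs hsr χ =>
    h.1 s hs hsr χ (fun a ha => by rw [(Submodule.mem_bot _).1 ha, map_zero]) x trivial

theorem le_Fat_of_pureOn (hp : 0 < residueChar K) (hd : d ≠ 0) (hr : r ∈ Set.Ioc 0 (rad d))
    {N : Submodule (TwistedPoly d) M} (h : PureOn d r ⊥ N) : N ≤ Fat d M r := fun x hx =>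
  Fat_map d r N.subtype ⟨x, hx⟩
    (by rw [Fat_eq_top_of_pureOn hp hd hr (pureOn_bot_top_subtype.2 h)]; trivial)

theorem RadLT.bot_sup {A B : Submodule (TwistedPoly d) M} (hA : RadLT d r ⊥ A)
    (hB : RadLT d r ⊥ B) : RadLT d r ⊥ (A ⊔ B) := by
  have := hB.sup bot_le A
  rw [bot_sup_eq, sup_comm] at this
  exact hA.trans this bot_le le_sup_left

theorem inf_eq_bot_of_radGE_of_radLT {A B : Submodule (TwistedPoly d) M} (hA : RadGE d r ⊥ A)
    (hB : RadLT d r ⊥ B) : A ⊓ B = ⊥ := by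
  by_contra hne
  exact hB ⊥ (A ⊓ B) le_rfl (bot_lt_iff_ne_bot.2 hne) inf_le_right (hA.mono le_rfl inf_le_left)

variable [CompleteSpace K]

/-- For `r' > r` split `M = G + L` at `r'`. The quotient `M / L` is a quotient of `G`, so
`F_{(0,r]}` lies in `L`, which has only radii below `r'`. -/
theorem pureOn_Fat (hp : 0 < residueChar K) (hd : d ≠ 0) (hr : r ∈ Set.Ioc 0 (rad d)) :
    PureOn d r ⊥ (Fat d M r) := by
  have hR := taylorBounded_rad hp hd
  refine ⟨fun s hs hsr χ _ x hx => (mem_FfromTop_iff hR hr.2).1 hx.2 s hs hsr χ,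
    fun r' hrr' hr' => ?_⟩
  obtain ⟨G, L, hG, hL, hGL⟩ := exists_radGE_sup_radLT hp hR hr' (hr.1.trans hrr')
    (⊤ : Submodule (TwistedPoly d) M)
  refine hL.mono le_rfl (inf_le_left.trans (FzeroTo_le_of_radGE hr.1 hrr' hr' ?_))
  have := hG.sup L
  rwa [bot_sup_eq, hGL] at this

theorem isGreatest_Fat (hp : 0 < residueChar K) (hd : d ≠ 0) (hr : r ∈ Set.Ioc 0 (rad d)) :
    IsGreatest {N : Submodule (TwistedPoly d) M | suppMult d N ⊆ {r}} (Fat d M r) :=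
  ⟨(suppMult_subset_singleton_iff hp hd hr).2 (pureOn_bot_top_subtype.2 (pureOn_Fat hp hd hr)),
    fun _ hN => le_Fat_of_pureOn hp hd hr
      (pureOn_bot_top_subtype.1 ((suppMult_subset_singleton_iff hp hd hr).1 hN))⟩

theorem Fsp_eq_Fat (hp : 0 < residueChar K) (hd : d ≠ 0) (hr : r ∈ Set.Ioc 0 (rad d)) :
    Fsp d M {r} = Fat d M r := (isGreatest_Fat hp hd hr).isLUB.sSup_eq

/-- By induction, a submodule that is a sum of two smaller pieces of a decomposition is covered. One
without such pieces is pure of its generic radius: for each larger `r'` one part of the splitting is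
everything, and it cannot be the part of radius at least `r'`. -/
theorem iSup_Fat_eq_top (hp : 0 < residueChar K) (hd : d ≠ 0) :
    ⨆ r : Set.Ioc 0 (rad d), Fat d M r.1 = ⊤ := by
  have hR := taylorBounded_rad hp hd
  have := isArtinian_twistedPoly (K := K) (d := d) (M := M)
  suffices h : ∀ N : Submodule (TwistedPoly d) M, N ≤ ⨆ r : Set.Ioc 0 (rad d), Fat d M r.1 from
    top_le_iff.1 (h ⊤)
  intro N
  induction N using WellFoundedLT.induction with
  | ind N ih =>
    by_cases hN : N = ⊥
    · rw [hN]; exact bot_le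
    have : Nontrivial N := Submodule.nontrivial_iff_ne_bot.2 hN
    by_cases hsplit : ∃ r ∈ Set.Ioc 0 (rad d), ∃ G L : Submodule (TwistedPoly d) M,
        G < N ∧ L < N ∧ G ⊔ L = N
    · obtain ⟨r, _, G, L, hG, hL, hGL⟩ := hsplit
      rw [← hGL]
      exact sup_le (ih G hG) (ih L hL)
    · have hρ := genRad_mem (M := N) hp hd
      refine le_trans (le_Fat_of_pureOn hp hd hρ ⟨radGE_bot_top_subtype.1 (radGE_genRad hp hd),
        fun r' hr' hr'R => ?_⟩) (le_iSup (fun r : Set.Ioc 0 (rad d) => Fat d M r.1) ⟨_, hρ⟩)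
      have hr'0 := hρ.1.trans hr'
      obtain ⟨G, L, hG, hL, hGL⟩ := exists_radGE_sup_radLT hp hR hr'R hr'0 N
      by_cases hLN : L = N
      · exact hLN ▸ hL
      · have hGN : G = N := by
          by_contra hGN
          exact hsplit ⟨r', ⟨hr'0, hr'R⟩, G, L, lt_of_le_of_ne (hGL ▸ le_sup_left) hGN,
            lt_of_le_of_ne (hGL ▸ le_sup_right) hLN, hGL⟩
        exact absurd (le_genRad_of_radGE hp hd hr'R (radGE_bot_top_subtype.2 (hGN ▸ hG)))
          (not_le.2 hr')

/-- The term of largest radius `m` lies in a module of radius at least `m` and in a sum of modules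
with only smaller radii; these meet in zero. -/
theorem eq_zero_of_sum_Fat_eq_zero (hp : 0 < residueChar K) (hd : d ≠ 0)
    (S : Finset (Set.Ioc 0 (rad d))) (x : Set.Ioc 0 (rad d) → M) (hx : ∀ r, x r ∈ Fat d M r.1)
    (h : ∑ r ∈ S, x r = 0) : ∀ r ∈ S, x r = 0 := by
  induction S using Finset.induction_on_max with
  | empty => simp
  | insert m S hm ih =>
    have hmS : m ∉ S := fun hmem => lt_irrefl _ (hm m hmem)
    rw [Finset.sum_insert hmS] at h
    have hU : RadLT d m.1 ⊥ (S.sup fun r => Fat d M r.1) :=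
      Finset.sup_induction (p := fun U => RadLT d m.1 ⊥ U) radLT_self
        (fun _ hA _ hB => hA.bot_sup hB)
        fun r hr => (pureOn_Fat hp hd r.2).2 _ (hm r hr) m.2.2
    have hmem : ∑ r ∈ S, x r ∈ S.sup fun r => Fat d M r.1 := Submodule.sum_mem _ fun r hr =>
      Finset.le_sup (f := fun r : Set.Ioc 0 (rad d) => Fat d M r.1) hr (hx r)
    have hx0 : x m = 0 := by
      rw [← Submodule.mem_bot (R := TwistedPoly d),
        ← inf_eq_bot_of_radGE_of_radLT (pureOn_Fat hp hd m.2).1 hU]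
      refine ⟨hx m, ?_⟩
      rw [eq_neg_of_add_eq_zero_left h]
      exact Submodule.neg_mem _ hmem
    rw [hx0, zero_add] at h
    intro r hr
    rcases Finset.mem_insert.1 hr with rfl | hr
    · exact hx0
    · exact ih h r hr

variable {M' : Type v} [AddCommGroup M'] [Module K M'] [Module (TwistedPoly d) M']
  [IsScalarTower K (TwistedPoly d) M'] [FiniteDimensional K M']

/-- Strictness: an element of `F_{[r,r]} M` that is the image of an element of `M'` is the image of
an element of `F_{[r,r]} M'`. -/
theorem exists_mem_Fat_map_eq (hp : 0 < residueChar K) (hd : d ≠ 0)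
    (hr : r ∈ Set.Ioc 0 (rad d)) (α : M' →ₗ[TwistedPoly d] M) {x : M'}
    (hx : α x ∈ Fat d M r) : ∃ x' ∈ Fat d M' r, α x' = α x := by
  classical
  have hmem : x ∈ ⨆ r : Set.Ioc 0 (rad d), Fat d M' r.1 := by
    rw [iSup_Fat_eq_top hp hd]; trivial
  obtain ⟨f, hf, hsum⟩ := (Submodule.mem_iSup_iff_exists_finsupp _ _).1 hmem
  let ρ : Set.Ioc 0 (rad d) := ⟨r, hr⟩
  refine ⟨f ρ, hf ρ, ?_⟩
  -- The index `r` is inserted because the component of `x` at `r` may be zero.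
  have hsum' : ∑ i ∈ insert ρ f.support, f i = x := by
    rw [← hsum, Finsupp.sum]
    refine (Finset.sum_subset (Finset.subset_insert _ _) fun i _ hi => ?_).symm
    simpa using hi
  -- `α x` has two decompositions, one from the components of `x` and one concentrated in radius
  -- `r`; independence applied to their difference equates the components at `r`.
  have := eq_zero_of_sum_Fat_eq_zero hp hd (insert ρ f.support)
    (fun i => α (f i) - if i = ρ then α x else 0) (fun i => by
      refine Submodule.sub_mem _ (Fat_map d _ α _ (hf i)) ?_
      split_ifs with h
      · rw [h]; exact hx
      · exact Submodule.zero_mem _)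
    (by
      rw [Finset.sum_sub_distrib, ← map_sum, hsum', Finset.sum_ite_eq',
        if_pos (Finset.mem_insert_self _ _), sub_self]) ρ (Finset.mem_insert_self _ _)
  rw [if_pos rfl] at this
  exact sub_eq_zero.1 this

theorem bijective_Isp (hp : 0 < residueChar K) (hd : d ≠ 0) : Function.Bijective (Isp d M) := by
  classical
  have hF : ∀ r : Set.Ioc 0 (rad d), Fsp d M {r.1} = Fat d M r.1 := fun r => Fsp_eq_Fat hp hd r.2
  constructor
  · rw [← LinearMap.ker_eq_bot, LinearMap.ker_eq_bot']
    intro y hy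
    rw [Isp, DirectSum.coeLinearMap_eq_dfinsuppSum, DFinsupp.sum] at hy
    have := eq_zero_of_sum_Fat_eq_zero hp hd (DFinsupp.support y) (fun r => (y r : M))
      (fun r => hF r ▸ (y r).2) hy
    refine DFinsupp.ext fun r => Subtype.ext ?_
    by_cases hr : r ∈ DFinsupp.support y
    · exact this r hr
    · rw [DFinsupp.notMem_support_iff.1 hr]; rfl
  · rw [← LinearMap.range_eq_top, Isp, DirectSum.range_coeLinearMap, ← iSup_Fat_eq_top hp hd]
    exact iSup_congr hF

end Fat

end

/-! ### The decomposition theorem and exactness. -/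

theorem mainTheorem2 {K : Type u} [NontriviallyNormedField K] [IsUltrametricDist K]
    [CompleteSpace K] [CharZero K] (d : Derivation ℤ K K) [IsBoundedDerivation d] (hd : d ≠ 0)
    (hp : 0 < residueChar K) :
    (∀ (M : Type v) [AddCommGroup M] [Module K M] [Module (TwistedPoly d) M]
        [IsScalarTower K (TwistedPoly d) M] [FiniteDimensional K M],
      (∀ r ∈ Set.Ioc 0 (rad d),
        IsGreatest {N : Submodule (TwistedPoly d) M | suppMult d N ⊆ {r}} (Fsp d M {r}) ∧
        Fsp d M {r} = Fat d M r) ∧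
      Function.Bijective (Isp d M)) ∧
    (∀ (M' M : Type v) [AddCommGroup M'] [Module K M'] [Module (TwistedPoly d) M']
        [IsScalarTower K (TwistedPoly d) M'] [FiniteDimensional K M']
        [AddCommGroup M] [Module K M] [Module (TwistedPoly d) M]
        [IsScalarTower K (TwistedPoly d) M] [FiniteDimensional K M]
        (α : M' →ₗ[TwistedPoly d] M),
      ∃ hα : ∀ r : Set.Ioc 0 (rad d), ∀ x ∈ Fsp d M' {r.1}, α x ∈ Fsp d M {r.1},
        ∀ y, Isp d M (DirectSum.lmap (fun r => α.restrict (hα r)) y) = α (Isp d M' y)) ∧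
    (∀ (M' M M'' : Type v) [AddCommGroup M'] [Module K M'] [Module (TwistedPoly d) M']
        [IsScalarTower K (TwistedPoly d) M'] [FiniteDimensional K M']
        [AddCommGroup M] [Module K M] [Module (TwistedPoly d) M]
        [IsScalarTower K (TwistedPoly d) M] [FiniteDimensional K M]
        [AddCommGroup M''] [Module K M''] [Module (TwistedPoly d) M'']
        [IsScalarTower K (TwistedPoly d) M''] [FiniteDimensional K M'']
        (α : M' →ₗ[TwistedPoly d] M) (β : M →ₗ[TwistedPoly d] M''),
      Function.Injective α → Function.Exact α β → Function.Surjective β →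
      ∀ r ∈ Set.Ioc 0 (rad d),
        Function.Injective (FatMap d r α) ∧ Function.Exact (FatMap d r α) (FatMap d r β) ∧
        Function.Surjective (FatMap d r β)) := by
  refine ⟨fun M _ _ _ _ _ => ⟨fun r hr => ⟨?_, Fsp_eq_Fat hp hd hr⟩, bijective_Isp hp hd⟩,
    fun M' M _ _ _ _ _ _ _ _ _ _ α => ⟨fun r x hx => ?_, fun y => ?_⟩,
    fun M' M M'' _ _ _ _ _ _ _ _ _ _ _ _ _ _ _ α β hα hαβ hβ r hr => ⟨fun x y hxy => ?_,
      fun y => ⟨fun hy => ?_, ?_⟩, fun y => ?_⟩⟩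
  · rw [Fsp_eq_Fat hp hd hr]
    exact isGreatest_Fat hp hd hr
  · rw [Fsp_eq_Fat hp hd r.2] at hx ⊢
    exact Fat_map d r.1 α x hx
  · classical
    induction y using DirectSum.induction_on with
    | zero => simp only [map_zero]
    | of r x =>
      rw [← DirectSum.lof_eq_of (TwistedPoly d), DirectSum.lmap_lof, Isp, Isp,
        DirectSum.coeLinearMap_lof, DirectSum.coeLinearMap_lof]
      rfl
    | add x y hx hy => simp only [map_add, hx, hy]
  · exact Subtype.ext (hα (congrArg Subtype.val hxy))
  · obtain ⟨x, hx⟩ := (hαβ y.1).1 (congrArg Subtype.val hy)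
    -- Exactness in the middle, and surjectivity below, reduce to strictness: a preimage in the
    -- whole module is replaced by its component of radius `r`.
    obtain ⟨x', hx', h⟩ := exists_mem_Fat_map_eq hp hd hr α (x := x) (hx ▸ y.2)
    exact ⟨⟨x', hx'⟩, Subtype.ext (h.trans hx)⟩
  · rintro ⟨x, rfl⟩
    exact Subtype.ext ((hαβ _).2 ⟨x.1, rfl⟩)
  · obtain ⟨x, hx⟩ := hβ y.1
    obtain ⟨x', hx', h⟩ := exists_mem_Fat_map_eq hp hd hr β (x := x) (hx ▸ y.2)
    exact ⟨⟨x', hx'⟩, Subtype.ext (h.trans hx)⟩
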